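/- Let $d\ge 1$ and let $(J_{x,y})_{x,y\in\mathbb{Z}^d}$ be real coupling constants, $J_{x,y}=J_{y,x}$, which are translation invariant ($J_{x,y}=J_{0,y-x}$), ferromagnetic ($J_{x,y}\ge 0$), summable ($\sum_{x} J_{0,x}<\infty$) and aperiodic (for each $x\in\mathbb{Z}^d$ there are $0=x_0,x_1,\dots,x_m=x$ with $J_{x_{i},x_{i+1}}>0$ for all $0\le i<m$). Consider the Ising model at zero magnetic field: for finite $\Lambda\subset\mathbb{Z}^d$, inverse temperature $\beta$ and boundary condition $\tau\in\{-1,0,1\}^{\mathbb{Z}^d\setminus\Lambda}$, the finite-volume Gibbs measure gives $\sigma\in\{-1,1\}^\Lambda$ a probability proportional to $e^{-\beta H^\tau_\Lambda(\sigma)}$, where $$H_\Lambda^\tau(\sigma)=-\sum_{\{x,y\}\subset\Lambda,\,x\ne y}J_{x,y}\sigma_x\sigma_y-\sum_{x\in\Lambda,\,y\notin\Lambda}J_{x,y}\sigma_x\tau_y .$$ Let $\langle\cdot\rangle^0_\beta$ and $\langle\cdot\rangle^+_\beta$ be the limits, as $\Lambda\uparrow\mathbb{Z}^d$, of the finite-volume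 Gibbs expectations with the free ($\tau\equiv 0$) and plus ($\tau\equiv 1$) boundary conditions. Let $m^*(\beta)=\langle\sigma_0\rangle^+_\beta$ be the spontaneous magnetization, suppose that $m^*(\beta)>0$ for some $\beta>0$, and let $\beta_c=\inf\{\beta>0: m^*(\beta)>0\}$. Let $\widetilde M_{LRO}(\beta)\ge 0$ be given by $$\widetilde M_{LRO}(\beta)^2=\inf_{\emptyset\ne B\subset\mathbb{Z}^d,\ |B|<\infty}\ \frac1{|B|^2}\sum_{x,y\in B}\langle\sigma_x\sigma_y\rangle^0_\beta .$$ If $\widetilde M_{LRO}(\beta_c)=0$, then $m^*(\beta_c)=0$, and the model has exactly one Gibbs state at $\beta_c$, that is, exactly one probability measure on $\{-1,1\}^{\mathbb{Z}^d}$ satisfies the Dobrushin–Lanford–Ruelle equations at inverse temperature $\beta_c$ and zero magnetic field. -/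

import Mathlib

open Filter MeasureTheory

namespace IsingZd

/-- The sites of the lattice `ℤ^d`. -/
abbrev Site (d : ℕ) : Type := Fin d → ℤ

/-- Spin configurations `σ ∈ {-1,1}^{ℤ^d}`; the group `ℤˣ` is `{-1, 1}`. The type carries the product
σ-algebra. -/
abbrev Config (d : ℕ) : Type := Site d → ℤˣ

/-- The real value `±1` of a spin. -/
def spin (s : ℤˣ) : ℝ := ((s : ℤ) : ℝ)

/-- The assumptions on the coupling constants. As the couplings are attached to unordered pairs
`{x, y}`, they are symmetric. -/
structure Admissible {d : ℕ} (J : Site d → Site d → ℝ) : Prop where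
  /-- `J` is a function of unordered pairs -/
  symm : ∀ x y, J x y = J y x
  /-- translation invariant -/
  transl : ∀ x y, J x y = J 0 (y - x)
  /-- ferromagnetic -/
  ferro : ∀ x y, 0 ≤ J x y
  /-- locally finite -/
  summable : Summable (fun x => J 0 x)
  /-- aperiodic: every `x` is reached from `0` by finitely many steps along positive couplings -/
  aperiodic : ∀ x, Relation.ReflTransGen (fun a b => 0 < J a b) 0 x

noncomputable section

/-- The Hamiltonian (at zero magnetic field) in the finite volume `Λ` with boundary condition `τ`;
only the values of `τ` outside `Λ` matter. The first term is the sum over the unordered pairs of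
distinct sites of `Λ`, written as half of the sum over the ordered pairs. -/
def hamiltonian {d : ℕ} (J : Site d → Site d → ℝ) (Λ : Finset (Site d)) (τ : Site d → ℝ)
    (σ : Λ → ℤˣ) : ℝ :=
  - ((1 / 2 : ℝ) * ∑ x : Λ, ∑ y : Λ, if x = y then 0 else J x y * spin (σ x) * spin (σ y))
  - ∑ x : Λ, ∑' y : {y : Site d // y ∉ Λ}, J x y * spin (σ x) * τ y

/-- The finite volume Gibbs expectation `⟨f⟩` in `Λ` at inverse temperature `β` with boundary
condition `τ`. -/
def gibbsExp {d : ℕ} (J : Site d → Site d → ℝ) (β : ℝ) (Λ : Finset (Site d)) (τ : Site d → ℝ)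
    (f : (Λ → ℤˣ) → ℝ) : ℝ :=
  (∑ σ : Λ → ℤˣ, f σ * Real.exp (-β * hamiltonian J Λ τ σ)) /
    ∑ σ : Λ → ℤˣ, Real.exp (-β * hamiltonian J Λ τ σ)

open Classical in
/-- The configuration equal to `σ` in `Λ` and to `ω` outside `Λ`. -/
def glue {d : ℕ} (Λ : Finset (Site d)) (σ : Λ → ℤˣ) (ω : Config d) : Config d :=
  fun x => if h : x ∈ Λ then σ ⟨x, h⟩ else ω x

/-- The infinite volume expectation of a local observable `F` with boundary condition `τ`: the limit
of its finite volume expectations as the finite set `Λ` increases to `ℤ^d`. The all-plus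
configuration that completes `σ` is immaterial, as a local `F` depends only on the spins in `Λ` once
`Λ` is large. Used for the free and plus boundary conditions, for which the limit exists. -/
def infiniteExp {d : ℕ} (J : Site d → Site d → ℝ) (β : ℝ) (τ : Site d → ℝ) (F : Config d → ℝ) : ℝ :=
  limUnder atTop (fun Λ : Finset (Site d) => gibbsExp J β Λ τ (fun σ => F (glue Λ σ 1)))

/-- The free state `⟨F⟩⁰_β`: boundary condition `τ = 0`. -/
def freeExp {d : ℕ} (J : Site d → Site d → ℝ) (β : ℝ) (F : Config d → ℝ) : ℝ :=
  infiniteExp J β (fun _ => 0) F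

/-- The plus state `⟨F⟩⁺_β`: boundary condition `τ = 1`. -/
def plusExp {d : ℕ} (J : Site d → Site d → ℝ) (β : ℝ) (F : Config d → ℝ) : ℝ :=
  infiniteExp J β (fun _ => 1) F

/-- The spontaneous magnetization `m*(β) = ⟨σ_0⟩⁺_β`. -/
def spontaneousMagnetization {d : ℕ} (J : Site d → Site d → ℝ) (β : ℝ) : ℝ :=
  plusExp J β (fun ω => spin (ω 0))

/-- The long range order parameter `M̃_LRO(β)`, the nonnegative number whose square is the infimum over
the nonempty finite sets `B` of `|B|⁻² ∑_{x,y ∈ B} ⟨σ_x σ_y⟩⁰_β`. -/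
def modifiedLRO {d : ℕ} (J : Site d → Site d → ℝ) (β : ℝ) : ℝ :=
  √(⨅ B : {B : Finset (Site d) // B.Nonempty},
    (1 / (B.1.card : ℝ) ^ 2) *
      ∑ x ∈ B.1, ∑ y ∈ B.1, freeExp J β (fun ω => spin (ω x) * spin (ω y)))

/-- `βc` is the critical inverse temperature: the (finite) threshold above which the spontaneous
magnetization is positive. No real number qualifies if there is no phase transition. -/
def IsCriticalBeta {d : ℕ} (J : Site d → Site d → ℝ) (βc : ℝ) : Prop :=
  IsGLB {β : ℝ | 0 < β ∧ 0 < spontaneousMagnetization J β} βc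

/-- `μ` is a Gibbs state at inverse temperature `β`: it satisfies the Dobrushin–Lanford–Ruelle
equations, that is, resampling the spins in any finite `Λ` from the finite volume Gibbs measure whose
boundary condition is the configuration outside `Λ` leaves `μ` invariant. -/
def IsGibbsState {d : ℕ} (J : Site d → Site d → ℝ) (β : ℝ)
    (μ : ProbabilityMeasure (Config d)) : Prop :=
  ∀ (Λ : Finset (Site d)) (F : Config d → ℝ), Measurable F → (∃ C : ℝ, ∀ ω, |F ω| ≤ C) →
    ∫ ω, gibbsExp J β Λ (fun y => spin (ω y)) (fun σ => F (glue Λ σ ω)) ∂(μ : Measure (Config d))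
      = ∫ ω, F ω ∂(μ : Measure (Config d))

end

end IsingZd

/-!
Take two independent copies of a finite Ising model, one of them in a nonnegative field, and expand
the product of their Boltzmann weights over random sets of pairs and field terms, whose clusters
carry the spins. In this expansion, `x` and `y` are connected with probability
`⟨σ_x σ_y⟩ ⟨σ_x σ_y⟩ʰ`, and the probability that `x` is connected to the field bounds the difference
`⟨σ_x σ_y⟩ʰ - ⟨σ_x σ_y⟩` up to a factor that depends only on a path from `x` to `y`.

Suppose that the free state has no long-range order but the magnetization `m` is positive. With the
field of the plus boundary condition, `⟨σ_x σ_y⟩ʰ ≥ m ^ 2`, so that every site is connected to the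
field with a probability bounded below, whereas some finite set of sites has arbitrarily small mean
free correlation. With positive probability, this set meets three distinct clusters that are
connected to the field. At a bounded cost, pairs can be added inside a block around the set so that
the block becomes a trifurcation. As in the argument of Burton and Keane, the number of disjoint
trifurcations is at most the number of field terms, which in a box is of smaller order than the
volume, whereas the translates of the block have a positive density of trifurcations. Hence `m = 0`.

The effect of any boundary condition on the spins in a fixed set is dominated by that of the plus
boundary condition, so that two Gibbs states agree on all local events. A limit point of finite
volume Gibbs measures exists by compactness, and it is a Gibbs state because the couplings are
summable.
-/

namespace IsingZd

section Spin

@[simp] lemma spin_one : spin 1 = 1 := by simp [spin]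

@[simp] lemma spin_neg (a : ℤˣ) : spin (-a) = -spin a := by simp [spin]

@[simp] lemma spin_mul (a b : ℤˣ) : spin (a * b) = spin a * spin b := by simp [spin]

lemma spin_eq_one_or (a : ℤˣ) : spin a = 1 ∨ spin a = -1 := by
  rcases Int.units_eq_one_or a with rfl | rfl <;> simp

@[simp] lemma spin_mul_self (a : ℤˣ) : spin a * spin a = 1 := by
  rcases spin_eq_one_or a with h | h <;> simp [h]

@[simp] lemma abs_spin (a : ℤˣ) : |spin a| = 1 := by
  rcases spin_eq_one_or a with h | h <;> simp [h]

lemma spin_le_one (a : ℤˣ) : spin a ≤ 1 :=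
  (le_abs_self _).trans_eq (abs_spin a)

lemma spin_mul_spin_eq_ite (a b : ℤˣ) : spin a * spin b = if a = b then 1 else -1 := by
  rcases Int.units_eq_one_or a with rfl | rfl <;> rcases Int.units_eq_one_or b with rfl | rfl <;>
    simp

lemma exp_mul_spin (c : ℝ) (a : ℤˣ) :
    Real.exp (c * spin a) = Real.cosh c + Real.sinh c * spin a := by
  rcases spin_eq_one_or a with h | h <;> rw [h]
  · simp [Real.cosh_add_sinh]
  · simp [← Real.cosh_sub_sinh, sub_eq_add_neg]

end Spin

/-! ### Griffiths' inequalities -/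

section Griffiths

variable {G : Type*} [Group G]

lemma sum_eq_zero_of_mul_left_eq_neg [Fintype G] {f : G → ℝ} (t : G)
    (h : ∀ g, f (t * g) = -f g) : ∑ g, f g = 0 := by
  have hshift := Equiv.sum_comp (Equiv.mulLeft t) f
  simp only [Equiv.coe_mulLeft, h, Finset.sum_neg_distrib] at hshift
  linarith

/-- The cone of the functions on `G` that are polynomials with nonnegative coefficients in the
`±1`-valued characters of `G`; it is the class of observables to which Griffiths' first inequality
applies. -/
inductive GriffithsCone : (G → ℝ) → Prop
  | char (φ : G →* ℤˣ) : GriffithsCone fun g => spin (φ g)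
  | smul {c : ℝ} (hc : 0 ≤ c) {f : G → ℝ} (hf : GriffithsCone f) : GriffithsCone fun g => c * f g
  | add {f f' : G → ℝ} (hf : GriffithsCone f) (hf' : GriffithsCone f') :
      GriffithsCone fun g => f g + f' g
  | mul {f f' : G → ℝ} (hf : GriffithsCone f) (hf' : GriffithsCone f') :
      GriffithsCone fun g => f g * f' g

namespace GriffithsCone

lemma one : GriffithsCone fun _ : G => (1 : ℝ) := by
  simpa using char (1 : G →* ℤˣ)

lemma const {c : ℝ} (hc : 0 ≤ c) : GriffithsCone fun _ : G => c := by
  simpa using smul hc (one (G := G))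

lemma prod {ι : Type*} (s : Finset ι) {f : ι → G → ℝ} (hf : ∀ i ∈ s, GriffithsCone (f i)) :
    GriffithsCone fun g => ∏ i ∈ s, f i g := by
  classical
  induction s using Finset.induction_on with
  | empty => simpa using one
  | insert a s ha ih =>
    simp only [Finset.prod_insert ha]
    exact mul (hf a (by simp)) (ih fun i hi => hf i (by simp [hi]))

lemma exp_sub_one {c : ℝ} (hc : 0 ≤ c) (φ : G →* ℤˣ) :
    GriffithsCone fun g => Real.exp (c * spin (φ g)) - 1 := by
  have h : ∀ g, Real.exp (c * spin (φ g)) - 1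
      = (Real.cosh c - 1) + Real.sinh c * spin (φ g) := fun g => by
    rw [exp_mul_spin]; ring
  simp only [h]
  exact add (const (by linarith [Real.one_le_cosh c])) (smul (Real.sinh_nonneg_iff.2 hc) (char φ))

lemma exp {c : ℝ} (hc : 0 ≤ c) (φ : G →* ℤˣ) :
    GriffithsCone fun g => Real.exp (c * spin (φ g)) := by
  simpa using add (exp_sub_one hc φ) one

variable [Fintype G]

lemma sum_char_nonneg (φ : G →* ℤˣ) : 0 ≤ ∑ g, spin (φ g) := by
  by_cases h : ∀ g, φ g = 1
  · simp [h]
  · push Not at h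
    obtain ⟨t, ht⟩ := h
    have ht' : φ t = -1 := (Int.units_eq_one_or _).resolve_left ht
    exact (sum_eq_zero_of_mul_left_eq_neg t fun g => by simp [ht']).ge

-- The second factor `h` carries the other factors of a product through the induction.
lemma sum_char_mul_nonneg {f : G → ℝ} (hf : GriffithsCone f) {h : G → ℝ}
    (hh : ∀ φ : G →* ℤˣ, 0 ≤ ∑ g, spin (φ g) * h g) (φ : G →* ℤˣ) :
    0 ≤ ∑ g, spin (φ g) * (f g * h g) := by
  induction hf generalizing h φ with
  | char ψ => simpa only [MonoidHom.mul_apply, spin_mul, mul_assoc] using hh (φ * ψ)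
  | smul hc _ ih =>
    simpa only [Finset.mul_sum, mul_assoc, mul_left_comm] using mul_nonneg hc (ih hh φ)
  | add _ _ ih ih' =>
    simpa only [← Finset.sum_add_distrib, add_mul, mul_add] using add_nonneg (ih hh φ) (ih' hh φ)
  | mul _ _ ih ih' => simpa only [mul_assoc] using ih (ih' hh) φ

/-- **Griffiths' first inequality.** -/
lemma sum_nonneg {f : G → ℝ} (hf : GriffithsCone f) : 0 ≤ ∑ g, f g := by
  simpa using hf.sum_char_mul_nonneg (h := 1) (fun φ => by simpa using sum_char_nonneg φ) 1

end GriffithsCone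

variable {ι : Type*} [Fintype ι]

/-- The Boltzmann weight of the spin system on `G` with couplings `K` to the characters `χ`. -/
noncomputable def boltzmann (χ : ι → G →* ℤˣ) (K : ι → ℝ) (g : G) : ℝ :=
  Real.exp (∑ i, K i * spin (χ i g))

lemma boltzmann_pos (χ : ι → G →* ℤˣ) (K : ι → ℝ) (g : G) : 0 < boltzmann χ K g := Real.exp_pos _

lemma griffithsCone_boltzmann (χ : ι → G →* ℤˣ) {K : ι → ℝ} (hK : ∀ i, 0 ≤ K i) :
    GriffithsCone (boltzmann χ K) := by
  have h : boltzmann χ K = fun g => ∏ i, Real.exp (K i * spin (χ i g)) :=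
    funext fun g => Real.exp_sum _ _
  rw [h]
  exact GriffithsCone.prod _ fun i _ => GriffithsCone.exp (hK i) _

lemma boltzmann_mul_boltzmann_mul (χ : ι → G →* ℤˣ) (K K' : ι → ℝ) (g t : G) :
    boltzmann χ K g * boltzmann χ K' (g * t)
      = boltzmann χ (fun i => K i + K' i * spin (χ i t)) g := by
  rw [boltzmann, boltzmann, boltzmann, ← Real.exp_add, ← Finset.sum_add_distrib]
  congr 1
  refine Finset.sum_congr rfl fun i _ => ?_
  rw [map_mul, spin_mul]
  ring

variable [Fintype G]

/-- The expectation in the spin system on `G` with couplings `K` to the characters `χ`. -/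
noncomputable def expect (χ : ι → G →* ℤˣ) (K : ι → ℝ) (f : G → ℝ) : ℝ :=
  (∑ g, f g * boltzmann χ K g) / ∑ g, boltzmann χ K g

lemma sum_boltzmann_pos (χ : ι → G →* ℤˣ) (K : ι → ℝ) : 0 < ∑ g, boltzmann χ K g :=
  Finset.sum_pos (fun g _ => boltzmann_pos χ K g) ⟨1, Finset.mem_univ _⟩

lemma expect_char_nonneg (χ : ι → G →* ℤˣ) {K : ι → ℝ} (hK : ∀ i, 0 ≤ K i) (φ : G →* ℤˣ) :
    0 ≤ expect χ K fun g => spin (φ g) :=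
  div_nonneg ((GriffithsCone.char φ).mul (griffithsCone_boltzmann χ hK)).sum_nonneg
    (sum_boltzmann_pos χ K).le

-- Ginibre's duplicate variables: `t = g⁻¹ * g'` decouples from `g` in a pair `(g, g')` of copies.
lemma sum_mul_sum_boltzmann_sub_eq (χ : ι → G →* ℤˣ) (K K' : ι → ℝ) (φ ψ : G →* ℤˣ) :
    (∑ g, spin (φ g) * spin (ψ g) * boltzmann χ K g) * (∑ g, boltzmann χ K' g)
      - (∑ g, spin (ψ g) * boltzmann χ K g) * ∑ g, spin (φ g) * boltzmann χ K' g
      = ∑ t, (1 - spin (φ t)) *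
          ∑ g, spin ((ψ * φ) g) * boltzmann χ (fun i => K i + K' i * spin (χ i t)) g := by
  calc _ = ∑ g, ∑ g', spin (ψ g) * (spin (φ g) - spin (φ g')) *
        (boltzmann χ K g * boltzmann χ K' g') := by
        simp only [Finset.sum_mul_sum, ← Finset.sum_sub_distrib]
        exact Finset.sum_congr rfl fun g _ => Finset.sum_congr rfl fun g' _ => by ring
    _ = ∑ g, ∑ t, (1 - spin (φ t)) *
        (spin ((ψ * φ) g) * boltzmann χ (fun i => K i + K' i * spin (χ i t)) g) := by
        refine Finset.sum_congr rfl fun g _ => ?_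
        rw [← Equiv.sum_comp (Equiv.mulLeft g)]
        refine Finset.sum_congr rfl fun t _ => ?_
        rw [Equiv.coe_mulLeft, boltzmann_mul_boltzmann_mul, map_mul, spin_mul, MonoidHom.mul_apply,
          spin_mul]
        ring
    _ = _ := by
        rw [Finset.sum_comm]
        simp only [Finset.mul_sum]

lemma sum_mul_sum_boltzmann_le (χ : ι → G →* ℤˣ) {K K' : ι → ℝ} (hK : ∀ i, |K' i| ≤ K i)
    (φ ψ : G →* ℤˣ) :
    (∑ g, spin (ψ g) * boltzmann χ K g) * ∑ g, spin (φ g) * boltzmann χ K' g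
      ≤ (∑ g, spin (φ g) * spin (ψ g) * boltzmann χ K g) * ∑ g, boltzmann χ K' g := by
  rw [← sub_nonneg, sum_mul_sum_boltzmann_sub_eq]
  refine Finset.sum_nonneg fun t _ => mul_nonneg (by linarith [spin_le_one (φ t)]) ?_
  refine ((GriffithsCone.char _).mul (griffithsCone_boltzmann χ fun i => ?_)).sum_nonneg
  have hi : |K' i * spin (χ i t)| ≤ K i := by rw [abs_mul, abs_spin, mul_one]; exact hK i
  linarith [neg_abs_le (K' i * spin (χ i t))]

lemma expect_char_le_of_abs_le (χ : ι → G →* ℤˣ) {K K' : ι → ℝ} (hK : ∀ i, |K' i| ≤ K i)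
    (φ : G →* ℤˣ) : (expect χ K' fun g => spin (φ g)) ≤ expect χ K fun g => spin (φ g) := by
  have h := sum_mul_sum_boltzmann_le χ hK φ 1
  simp only [MonoidHom.one_apply, spin_one, one_mul, mul_one] at h
  rwa [expect, expect, div_le_div_iff₀ (sum_boltzmann_pos χ K') (sum_boltzmann_pos χ K), mul_comm]

/-- **Griffiths' second inequality.** -/
lemma expect_mul_expect_le (χ : ι → G →* ℤˣ) {K : ι → ℝ} (hK : ∀ i, 0 ≤ K i) (φ ψ : G →* ℤˣ) :
    (expect χ K fun g => spin (φ g)) * (expect χ K fun g => spin (ψ g))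
      ≤ expect χ K fun g => spin (φ g) * spin (ψ g) := by
  have h := sum_mul_sum_boltzmann_le χ (K := K) (K' := K) (fun i => (abs_of_nonneg (hK i)).le) φ ψ
  have hZ := sum_boltzmann_pos χ K
  rw [expect, expect, expect, div_mul_div_comm, div_le_div_iff₀ (mul_pos hZ hZ) hZ, ← mul_assoc,
    mul_comm (∑ g, spin (φ g) * _)]
  exact mul_le_mul_of_nonneg_right h hZ.le

end Griffiths

/-! ### High-temperature expansion -/

section Expansion

lemma sum_comp_union_le {α : Type*} [Fintype α] [DecidableEq α] {g : Finset α → ℝ}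
    (hg : ∀ ω, 0 ≤ g ω) (E : Finset α) : ∑ ω, g (ω ∪ E) ≤ 2 ^ E.card * ∑ ω, g ω := by
  rw [← Finset.sum_fiberwise Finset.univ (fun ω => ω ∪ E), Finset.mul_sum]
  refine Finset.sum_le_sum fun ω' _ => ?_
  rw [Finset.sum_congr rfl fun ω hω => by rw [(Finset.mem_filter.1 hω).2], Finset.sum_const,
    nsmul_eq_mul]
  refine mul_le_mul_of_nonneg_right ?_ (hg ω')
  have hcard : ({ω | ω ∪ E = ω'} : Finset (Finset α)).card ≤ E.powerset.card := by
    refine Finset.card_le_card_of_injOn (fun ω => ω ∩ E) (fun ω _ => by simp) ?_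
    intro ω₁ h₁ ω₂ h₂ h
    have hsplit (ω : Finset α) : ω = ((ω ∪ E) \ E) ∪ (ω ∩ E) := by
      ext a; simp only [Finset.mem_union, Finset.mem_sdiff, Finset.mem_inter]; tauto
    simp only [Finset.coe_filter, Finset.mem_univ, true_and, Set.mem_ofPred_eq] at h₁ h₂ h
    rw [hsplit ω₁, hsplit ω₂, h₁, h₂, h]
  rw [Finset.card_powerset] at hcard
  exact_mod_cast hcard

variable {G : Type*} [Group G] [Fintype G] {ι : Type*}

/-- The weight of the set `ω` of interaction terms in the expansion of the Boltzmann weight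
`∏ i, (1 + (exp (c i * χ i) - 1))`, summed over the configurations with the character `φ` inserted.
-/
noncomputable def expansionWeight (χ : ι → G →* ℤˣ) (c : ι → ℝ) (ω : Finset ι) (φ : G →* ℤˣ) : ℝ :=
  ∑ s, spin (φ s) * ∏ i ∈ ω, (Real.exp (c i * spin (χ i s)) - 1)

/-- The factor lost when a term with coupling `k` is added to a set of the expansion. -/
noncomputable def insertConst (k : ℝ) : ℝ := min 1 (Real.cosh k - 1)

/-- A factor that compensates for removing a character `χ i` with coupling `c i = k` from the
insertion and adding `i` to the set of the expansion; each summand handles one of the terms that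
occur in `le_sourceConst_mul`. -/
noncomputable def sourceConst (k : ℝ) : ℝ :=
  (Real.sinh k)⁻¹ + (Real.cosh k - 1) / Real.sinh k + Real.sinh k / (Real.cosh k - 1)

lemma insertConst_nonneg (k : ℝ) : 0 ≤ insertConst k :=
  le_min zero_le_one (by linarith [Real.one_le_cosh k])

lemma insertConst_pos {k : ℝ} (hk : 0 < k) : 0 < insertConst k :=
  lt_min one_pos (by linarith [Real.one_lt_cosh.2 hk.ne'])

lemma sourceConst_nonneg {k : ℝ} (hk : 0 < k) : 0 ≤ sourceConst k := by
  have hcosh : 0 < Real.cosh k - 1 := by linarith [Real.one_lt_cosh.2 hk.ne']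
  have hsinh : 0 < Real.sinh k := Real.sinh_pos_iff.2 hk
  exact add_nonneg (add_nonneg (inv_nonneg.2 hsinh.le) (div_nonneg hcosh.le hsinh.le))
    (div_nonneg hsinh.le hcosh.le)

lemma le_sourceConst_mul {k A B : ℝ} (hk : 0 < k) (hA : 0 ≤ A) (hB : 0 ≤ B) :
    B ≤ sourceConst k * ((Real.cosh k - 1) * A + Real.sinh k * B) ∧
      (Real.cosh k - 1) * B + Real.sinh k * A
        ≤ sourceConst k * ((Real.cosh k - 1) * A + Real.sinh k * B) := by
  have ha : 0 < Real.cosh k - 1 := by linarith [Real.one_lt_cosh.2 hk.ne']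
  have hb : 0 < Real.sinh k := Real.sinh_pos_iff.2 hk
  unfold sourceConst
  generalize Real.cosh k - 1 = a at ha
  generalize Real.sinh k = b at hb
  have hexpand : (b⁻¹ + a / b + b / a) * (a * A + b * B)
      = B + (a * B + b * A) + (a / b * A + a * (a / b) * A + b * (b / a) * B) := by
    field_simp; ring
  have hrest : 0 ≤ a / b * A + a * (a / b) * A + b * (b / a) * B := by positivity
  have hcross : 0 ≤ a * B + b * A := by positivity
  rw [hexpand]
  constructor <;> linarith

variable (χ : ι → G →* ℤˣ) {c : ι → ℝ}

lemma expansionWeight_nonneg (hc : ∀ i, 0 ≤ c i) (ω : Finset ι) (φ : G →* ℤˣ) :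
    0 ≤ expansionWeight χ c ω φ :=
  ((GriffithsCone.char φ).mul
    (GriffithsCone.prod ω fun i _ => GriffithsCone.exp_sub_one (hc i) (χ i))).sum_nonneg

variable [DecidableEq ι]

lemma expansionWeight_insert {ω : Finset ι} {i : ι} (hi : i ∉ ω) (φ : G →* ℤˣ) :
    expansionWeight χ c (insert i ω) φ = (Real.cosh (c i) - 1) * expansionWeight χ c ω φ
      + Real.sinh (c i) * expansionWeight χ c ω (φ * χ i) := by
  rw [expansionWeight, expansionWeight, expansionWeight, Finset.mul_sum, Finset.mul_sum,
    ← Finset.sum_add_distrib]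
  refine Finset.sum_congr rfl fun s _ => ?_
  rw [Finset.prod_insert hi, exp_mul_spin, MonoidHom.mul_apply, spin_mul]
  ring

lemma insertConst_mul_expansionWeight_le (hc : ∀ i, 0 ≤ c i) (ω : Finset ι) (i : ι)
    (φ : G →* ℤˣ) :
    insertConst (c i) * expansionWeight χ c ω φ ≤ expansionWeight χ c (insert i ω) φ := by
  have hφ := expansionWeight_nonneg χ hc ω φ
  by_cases hi : i ∈ ω
  · rw [Finset.insert_eq_of_mem hi]
    exact mul_le_of_le_one_left hφ (min_le_left _ _)
  · rw [expansionWeight_insert χ hi]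
    calc insertConst (c i) * expansionWeight χ c ω φ
        ≤ (Real.cosh (c i) - 1) * expansionWeight χ c ω φ :=
          mul_le_mul_of_nonneg_right (min_le_right _ _) hφ
      _ ≤ _ := le_add_of_nonneg_right (mul_nonneg (Real.sinh_nonneg_iff.2 (hc i))
          (expansionWeight_nonneg χ hc ω (φ * χ i)))

lemma expansionWeight_mul_char_le (hc : ∀ i, 0 ≤ c i) (ω : Finset ι) {i : ι} (hi : 0 < c i)
    (φ : G →* ℤˣ) :
    expansionWeight χ c ω (φ * χ i) ≤ sourceConst (c i) * expansionWeight χ c (insert i ω) φ := by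
  by_cases hmem : i ∈ ω
  · have hcancel : φ * χ i * χ i = φ := by
      ext s
      simp [mul_assoc]
    rw [Finset.insert_eq_of_mem hmem, ← Finset.insert_erase hmem,
      expansionWeight_insert χ (Finset.notMem_erase i ω),
      expansionWeight_insert χ (Finset.notMem_erase i ω), hcancel]
    exact (le_sourceConst_mul hi (expansionWeight_nonneg χ hc _ _)
      (expansionWeight_nonneg χ hc _ _)).2
  · rw [expansionWeight_insert χ hmem]
    exact (le_sourceConst_mul hi (expansionWeight_nonneg χ hc _ _)
      (expansionWeight_nonneg χ hc _ _)).1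

lemma expansionWeight_mul_prod_le (hc : ∀ i, 0 ≤ c i) (ω : Finset ι) {l : List ι}
    (hl : ∀ i ∈ l, 0 < c i) (φ : G →* ℤˣ) :
    expansionWeight χ c ω (φ * (l.map χ).prod)
      ≤ (l.map fun i => sourceConst (c i)).prod * expansionWeight χ c (ω ∪ l.toFinset) φ := by
  induction l generalizing φ with
  | nil => simp
  | cons i l ih =>
    have hl' : ∀ j ∈ l, 0 < c j := fun j hj => hl j (by simp [hj])
    have hprod : 0 ≤ (l.map fun i => sourceConst (c i)).prod :=
      List.prod_nonneg <| List.forall_mem_map.2 fun j hj => sourceConst_nonneg (hl' j hj)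
    rw [List.map_cons, List.prod_cons, ← mul_assoc, List.map_cons, List.prod_cons,
      List.toFinset_cons, Finset.union_insert]
    calc _ ≤ _ := ih hl' (φ * χ i)
      _ ≤ _ := mul_le_mul_of_nonneg_left
        (expansionWeight_mul_char_le χ hc (ω ∪ l.toFinset) (hl i (by simp)) φ) hprod
      _ = _ := by ring

end Expansion

/-! ### Ising models and clusters of bonds -/

section Clusters

/-- The interaction terms of an Ising model on `V`: the ordered pairs of sites and, for the
external field, the sites. -/
abbrev Bond (V : Type*) : Type _ := (V × V) ⊕ V

variable {V : Type*}

/-- The character of spin configurations given by the spin at `x`. -/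
def siteChar (x : V) : (V → ℤˣ) →* ℤˣ := Pi.evalMonoidHom (fun _ => ℤˣ) x

/-- The product of the spins that enter an interaction term. -/
def bondChar : Bond V → ((V → ℤˣ) →* ℤˣ)
  | Sum.inl p => siteChar p.1 * siteChar p.2
  | Sum.inr x => siteChar x

/-- The couplings of the interaction terms with pair interaction `K` and field `h`. A pair of
distinct sites contributes both `K x y` and `K y x`. -/
def bondCoupling (K : V → V → ℝ) (h : V → ℝ) : Bond V → ℝ
  | Sum.inl p => K p.1 p.2
  | Sum.inr x => h x

@[simp] lemma siteChar_apply (x : V) (s : V → ℤˣ) : siteChar x s = s x := rfl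

@[simp] lemma bondChar_inl_apply (p : V × V) (s : V → ℤˣ) :
    bondChar (Sum.inl p) s = s p.1 * s p.2 := rfl

@[simp] lemma bondChar_inr_apply (x : V) (s : V → ℤˣ) : bondChar (Sum.inr x) s = s x := rfl

@[simp] lemma bondCoupling_inl (K : V → V → ℝ) (h : V → ℝ) (p : V × V) :
    bondCoupling K h (Sum.inl p) = K p.1 p.2 := rfl

@[simp] lemma bondCoupling_inr (K : V → V → ℝ) (h : V → ℝ) (x : V) :
    bondCoupling K h (Sum.inr x) = h x := rfl

lemma bondCoupling_nonneg {K : V → V → ℝ} {h : V → ℝ} (hK : ∀ x y, 0 ≤ K x y)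
    (hh : ∀ x, 0 ≤ h x) : ∀ i, 0 ≤ bondCoupling K h i
  | Sum.inl p => hK p.1 p.2
  | Sum.inr x => hh x

/-- Connection of sites through the pairs in `ω`; its classes are the clusters of `ω`. -/
def Conn (ω : Finset (Bond V)) (x y : V) : Prop :=
  Relation.EqvGen (fun a b => Sum.inl (a, b) ∈ ω) x y

/-- Connection of a site, through the pairs in `ω`, to a site whose field term is in `ω`. -/
def ConnField (ω : Finset (Bond V)) (x : V) : Prop := ∃ v, Conn ω x v ∧ Sum.inr v ∈ ω

namespace Conn

variable {ω ω' : Finset (Bond V)} {x y z : V}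

lemma refl (x : V) : Conn ω x x := Relation.EqvGen.refl x

lemma symm (h : Conn ω x y) : Conn ω y x := Relation.EqvGen.symm _ _ h

lemma trans (h : Conn ω x y) (h' : Conn ω y z) : Conn ω x z := Relation.EqvGen.trans _ _ _ h h'

lemma of_mem (h : Sum.inl (x, y) ∈ ω) : Conn ω x y := Relation.EqvGen.rel _ _ h

lemma mono (h : ω ⊆ ω') (hxy : Conn ω x y) : Conn ω' x y :=
  Relation.EqvGen.mono (fun _ _ hab => h hab) _ _ hxy

end Conn

lemma ConnField.mono {ω ω' : Finset (Bond V)} (h : ω ⊆ ω') {x : V} (hx : ConnField ω x) :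
    ConnField ω' x :=
  let ⟨v, hv, hv'⟩ := hx
  ⟨v, hv.mono h, h hv'⟩

lemma apply_eq_of_eqvGen {α β : Type*} {r : α → α → Prop} {f : α → β}
    (hf : ∀ a b, r a b → f a = f b) {x y : α} (h : Relation.EqvGen r x y) : f x = f y := by
  induction h with
  | rel _ _ h => exact hf _ _ h
  | refl _ => rfl
  | symm _ _ _ ih => exact ih.symm
  | trans _ _ _ _ _ ih ih' => exact ih.trans ih'

/-- The indicator that `τ` agrees on the two sites of a pair; field terms impose no condition. -/
noncomputable def agreeAt (τ : V → ℤˣ) : Bond V → ℝ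
  | Sum.inl p => if τ p.1 = τ p.2 then 1 else 0
  | Sum.inr _ => 1

/-- The indicator that `τ` is constant on the clusters of `ω`. -/
noncomputable def agree (ω : Finset (Bond V)) (τ : V → ℤˣ) : ℝ := ∏ i ∈ ω, agreeAt τ i

lemma agreeAt_nonneg (τ : V → ℤˣ) (i : Bond V) : 0 ≤ agreeAt τ i := by
  rcases i with p | x <;> simp only [agreeAt]
  · split_ifs <;> norm_num
  · norm_num

lemma agree_nonneg (ω : Finset (Bond V)) (τ : V → ℤˣ) : 0 ≤ agree ω τ :=
  Finset.prod_nonneg fun i _ => agreeAt_nonneg τ i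

lemma eq_of_agree_ne_zero {ω : Finset (Bond V)} {τ : V → ℤˣ} (h : agree ω τ ≠ 0) {x y : V}
    (hxy : Conn ω x y) : τ x = τ y := by
  refine apply_eq_of_eqvGen (fun a b hab => ?_) hxy
  by_contra hne
  exact h (Finset.prod_eq_zero hab (by simp [agreeAt, hne]))

open Classical in
/-- The configuration whose multiplication flips the spins of the cluster of `x`. -/
noncomputable def clusterFlip (ω : Finset (Bond V)) (x : V) : V → ℤˣ :=
  fun v => if Conn ω x v then -1 else 1

lemma clusterFlip_of_conn {ω : Finset (Bond V)} {x y : V} (h : Conn ω x y) :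
    clusterFlip ω x y = -1 := if_pos h

lemma clusterFlip_of_not_conn {ω : Finset (Bond V)} {x y : V} (h : ¬ Conn ω x y) :
    clusterFlip ω x y = 1 := if_neg h

lemma clusterFlip_congr {ω : Finset (Bond V)} (x : V) {a b : V} (h : Sum.inl (a, b) ∈ ω) :
    clusterFlip ω x a = clusterFlip ω x b := by
  have hab : Conn ω x a ↔ Conn ω x b :=
    ⟨fun h' => h'.trans (Conn.of_mem h), fun h' => h'.trans (Conn.of_mem h).symm⟩
  by_cases ha : Conn ω x a
  · rw [clusterFlip_of_conn ha, clusterFlip_of_conn (hab.1 ha)]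
  · rw [clusterFlip_of_not_conn ha, clusterFlip_of_not_conn fun hb => ha (hab.2 hb)]

lemma agree_clusterFlip_mul (ω : Finset (Bond V)) (x : V) (τ : V → ℤˣ) :
    agree ω (clusterFlip ω x * τ) = agree ω τ := by
  refine Finset.prod_congr rfl fun i hi => ?_
  rcases i with p | v
  · simp only [agreeAt, Pi.mul_apply, clusterFlip_congr x hi, mul_right_inj]
  · rfl

lemma bondChar_clusterFlip {ω : Finset (Bond V)} {x : V} (hx : ¬ ConnField ω x) {i : Bond V}
    (hi : i ∈ ω) : bondChar i (clusterFlip ω x) = 1 := by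
  rcases i with p | v
  · rw [bondChar_inl_apply, clusterFlip_congr x hi, Int.units_mul_self]
  · exact clusterFlip_of_not_conn fun hv => hx ⟨v, hv, hi⟩

variable [Fintype V] [DecidableEq V]

/-- The sum of `g` over the configurations that are constant on the clusters of `ω`. -/
noncomputable def agreeSum (ω : Finset (Bond V)) (g : (V → ℤˣ) → ℝ) : ℝ :=
  ∑ τ, g τ * agree ω τ

lemma agreeSum_one_nonneg (ω : Finset (Bond V)) : 0 ≤ agreeSum ω 1 :=
  Finset.sum_nonneg fun τ _ => mul_nonneg zero_le_one (agree_nonneg ω τ)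

lemma agreeSum_pair_of_conn {ω : Finset (Bond V)} {x y : V} (h : Conn ω x y) :
    (agreeSum ω fun τ => spin (τ x) * spin (τ y)) = agreeSum ω 1 := by
  refine Finset.sum_congr rfl fun τ _ => ?_
  by_cases hτ : agree ω τ = 0
  · simp [hτ]
  · simp only [eq_of_agree_ne_zero hτ h, spin_mul_self, Pi.one_apply]

lemma agreeSum_pair_of_not_conn {ω : Finset (Bond V)} {x y : V} (h : ¬ Conn ω x y) :
    (agreeSum ω fun τ => spin (τ x) * spin (τ y)) = 0 :=
  sum_eq_zero_of_mul_left_eq_neg (clusterFlip ω x) fun τ => by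
    simp [agree_clusterFlip_mul, clusterFlip_of_conn (Conn.refl x), clusterFlip_of_not_conn h]

lemma agreeSum_pair_nonneg (ω : Finset (Bond V)) (x y : V) :
    0 ≤ agreeSum ω fun τ => spin (τ x) * spin (τ y) := by
  by_cases h : Conn ω x y
  · rw [agreeSum_pair_of_conn h]; exact agreeSum_one_nonneg ω
  · rw [agreeSum_pair_of_not_conn h]

-- Adding a pair merges at most two clusters, hence at most halves the number of configurations.
lemma agreeSum_le_two_mul_insert (ω : Finset (Bond V)) (i : Bond V) :
    agreeSum ω 1 ≤ 2 * agreeSum (insert i ω) 1 := by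
  by_cases hi : i ∈ ω
  · rw [Finset.insert_eq_of_mem hi]; linarith [agreeSum_one_nonneg ω]
  · rcases i with p | x
    · have hsplit : 2 * agreeSum (insert (Sum.inl p) ω) 1 = agreeSum ω 1 +
          agreeSum ω fun τ => spin (τ p.1) * spin (τ p.2) := by
        simp only [agreeSum, Finset.mul_sum, ← Finset.sum_add_distrib]
        refine Finset.sum_congr rfl fun τ _ => ?_
        rw [agree, Finset.prod_insert hi, agreeAt, spin_mul_spin_eq_ite, ← agree, Pi.one_apply]
        split_ifs <;> ring
      rw [hsplit]
      linarith [agreeSum_pair_nonneg ω p.1 p.2]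
    · have hfield : agreeSum (insert (Sum.inr x) ω) 1 = agreeSum ω 1 := by
        refine Finset.sum_congr rfl fun τ _ => ?_
        rw [agree, Finset.prod_insert hi, agreeAt, ← agree, one_mul]
      rw [hfield]; linarith [agreeSum_one_nonneg ω]

lemma agreeSum_le_union (ω E : Finset (Bond V)) :
    agreeSum ω 1 ≤ 2 ^ E.card * agreeSum (ω ∪ E) 1 := by
  induction E using Finset.induction_on with
  | empty => simp
  | insert i E hi ih =>
    rw [Finset.card_insert_of_notMem hi, Finset.union_insert, pow_succ, mul_assoc]
    exact ih.trans (mul_le_mul_of_nonneg_left (agreeSum_le_two_mul_insert _ i) (by positivity))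

lemma expansionWeight_eq_zero {c : Bond V → ℝ} {ω : Finset (Bond V)} {x y : V}
    (hxy : ¬ Conn ω x y) (hx : ¬ ConnField ω x) :
    expansionWeight bondChar c ω (siteChar x * siteChar y) = 0 := by
  refine sum_eq_zero_of_mul_left_eq_neg (clusterFlip ω x) fun s => ?_
  rw [Finset.prod_congr rfl fun i hi => by
    rw [map_mul (bondChar i), bondChar_clusterFlip hx hi, one_mul]]
  simp [clusterFlip_of_conn (Conn.refl x), clusterFlip_of_not_conn hxy]

/-- The expectation in the Ising model with pair interaction `K` and field `h`. -/
noncomputable def isingExpect (K : V → V → ℝ) (h : V → ℝ) (f : (V → ℤˣ) → ℝ) : ℝ :=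
  expect bondChar (bondCoupling K h) f

/-- The pair correlation `⟨σ_x σ_y⟩` in the Ising model with pair interaction `K` and field `h`. -/
noncomputable def pairCorr (K : V → V → ℝ) (h : V → ℝ) (x y : V) : ℝ :=
  isingExpect K h fun σ => spin (σ x) * spin (σ y)

lemma pairCorr_le_one (K : V → V → ℝ) (h : V → ℝ) (x y : V) : pairCorr K h x y ≤ 1 := by
  rw [pairCorr, isingExpect, expect, div_le_one (sum_boltzmann_pos _ _)]
  refine Finset.sum_le_sum fun σ _ => mul_le_of_le_one_left (boltzmann_pos _ _ _).le ?_
  rw [← spin_mul]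
  exact spin_le_one _

lemma pairCorr_nonneg {K : V → V → ℝ} {h : V → ℝ} (hK : ∀ x y, 0 ≤ K x y) (hh : ∀ x, 0 ≤ h x)
    (x y : V) : 0 ≤ pairCorr K h x y := by
  simpa [pairCorr, isingExpect] using
    expect_char_nonneg bondChar (bondCoupling_nonneg hK hh) (siteChar x * siteChar y)

end Clusters

/-! ### The duplicated model -/

section Duplicated

variable {V : Type*} {K : V → V → ℝ} {h : V → ℝ}

/-- The couplings that remain in the pair of an Ising model without field and one with field `h`
once the product of the two configurations is constant on clusters. -/
def doubleCoupling (K : V → V → ℝ) (h : V → ℝ) : Bond V → ℝ :=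
  bondCoupling (fun x y => 2 * K x y) h

lemma doubleCoupling_nonneg (hK : ∀ x y, 0 ≤ K x y) (hh : ∀ x, 0 ≤ h x) (i : Bond V) :
    0 ≤ doubleCoupling K h i :=
  bondCoupling_nonneg (fun x y => mul_nonneg zero_le_two (hK x y)) hh i

/-- The factor in `pairCorr_sub_pairCorr_zero_le_pathConst_mul`, for the path `w 0, …, w n`. -/
noncomputable def pathConst (K : V → V → ℝ) (w : ℕ → V) (n : ℕ) : ℝ :=
  4 ^ n * ∏ i ∈ Finset.range n, sourceConst (2 * K (w i) (w (i + 1)))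

lemma pathConst_nonneg {K : V → V → ℝ} {w : ℕ → V} {n : ℕ}
    (hw : ∀ i < n, 0 < K (w i) (w (i + 1))) : 0 ≤ pathConst K w n :=
  mul_nonneg (by positivity) <| Finset.prod_nonneg fun i hi =>
    sourceConst_nonneg (mul_pos two_pos (hw i (Finset.mem_range.1 hi)))

/-- The pairs of consecutive sites of the path `w 0, …, w n`, as interaction terms. -/
def pathBonds (w : ℕ → V) (n : ℕ) : List (Bond V) :=
  (List.range n).map fun i => Sum.inl (w i, w (i + 1))

lemma prod_bondChar_pathBonds (w : ℕ → V) (n : ℕ) :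
    ((pathBonds w n).map bondChar).prod = siteChar (w 0) * siteChar (w n) := by
  refine MonoidHom.ext fun s => ?_
  rw [pathBonds, List.map_map]
  induction n with
  | zero => simp
  | succ n ih =>
    rw [List.prod_range_succ, MonoidHom.mul_apply, ih]
    simp [mul_assoc, ← mul_assoc (s (w n)) (s (w n))]

variable [Fintype V]

lemma boltzmann_mul_boltzmann_eq_sum (K : V → V → ℝ) (h : V → ℝ) (s τ : V → ℤˣ) :
    boltzmann bondChar (bondCoupling K 0) (s * τ) * boltzmann bondChar (bondCoupling K h) s
      = ∑ ω, agree ω τ *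
        ∏ i ∈ ω, (Real.exp (doubleCoupling K h i * spin (bondChar i s)) - 1) := by
  rw [boltzmann, boltzmann, ← Real.exp_add, ← Finset.sum_add_distrib, Real.exp_sum]
  simp only [agree, ← Finset.prod_mul_distrib]
  rw [← Finset.powerset_univ, ← Finset.prod_one_add]
  refine Finset.prod_congr rfl fun i _ => ?_
  rcases i with ⟨x, y⟩ | x
  · have hexp : bondCoupling K 0 (Sum.inl (x, y)) * spin (bondChar (Sum.inl (x, y)) (s * τ)) +
        bondCoupling K h (Sum.inl (x, y)) * spin (bondChar (Sum.inl (x, y)) s)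
          = K x y * (spin (s x) * spin (s y)) * (spin (τ x) * spin (τ y) + 1) := by
      simp; ring
    rw [hexp, spin_mul_spin_eq_ite (τ x)]
    by_cases hτ : τ x = τ y
    · simp [hτ, agreeAt, doubleCoupling]; ring_nf
    · simp [hτ, agreeAt]
  · simp [doubleCoupling, agreeAt]

variable [DecidableEq V]

/-- The weight of `ω` in the expansion of the partition function of the duplicated model. -/
noncomputable def mass (c : Bond V → ℝ) (ω : Finset (Bond V)) : ℝ :=
  agreeSum ω 1 * expansionWeight bondChar c ω 1

lemma mass_nonneg {c : Bond V → ℝ} (hc : ∀ i, 0 ≤ c i) (ω : Finset (Bond V)) : 0 ≤ mass c ω :=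
  mul_nonneg (agreeSum_one_nonneg ω) (expansionWeight_nonneg _ hc ω 1)

lemma insertConst_div_two_mul_mass_le {c : Bond V → ℝ} (hc : ∀ i, 0 ≤ c i) (ω : Finset (Bond V))
    (i : Bond V) : insertConst (c i) / 2 * mass c ω ≤ mass c (insert i ω) := by
  have hmul := mul_le_mul (agreeSum_le_two_mul_insert ω i)
    (insertConst_mul_expansionWeight_le bondChar hc ω i 1)
    (mul_nonneg (insertConst_nonneg _) (expansionWeight_nonneg _ hc _ _))
    (mul_nonneg zero_le_two (agreeSum_one_nonneg _))
  unfold mass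
  linarith

lemma prod_insertConst_mul_mass_le {c : Bond V → ℝ} (hc : ∀ i, 0 ≤ c i) (ω E : Finset (Bond V)) :
    (∏ i ∈ E, insertConst (c i) / 2) * mass c ω ≤ mass c (ω ∪ E) := by
  induction E using Finset.induction_on with
  | empty => simp
  | insert i E hi ih =>
    rw [Finset.prod_insert hi, Finset.union_insert, mul_assoc]
    exact (mul_le_mul_of_nonneg_left ih 
      (div_nonneg (insertConst_nonneg _) zero_le_two)).trans
      (insertConst_div_two_mul_mass_le hc _ i)

/-- The partition function of the duplicated model. -/
noncomputable def duplicateZ (K : V → V → ℝ) (h : V → ℝ) : ℝ :=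
  (∑ σ, boltzmann bondChar (bondCoupling K 0) σ) * ∑ s, boltzmann bondChar (bondCoupling K h) s

lemma duplicateZ_pos (K : V → V → ℝ) (h : V → ℝ) : 0 < duplicateZ K h :=
  mul_pos (sum_boltzmann_pos _ _) (sum_boltzmann_pos _ _)

lemma sum_duplicate_eq (K : V → V → ℝ) (h : V → ℝ) (g : (V → ℤˣ) → ℝ) (φ : (V → ℤˣ) →* ℤˣ) :
    ∑ s, ∑ σ, g (s * σ) * spin (φ s) * (boltzmann bondChar (bondCoupling K 0) σ *
      boltzmann bondChar (bondCoupling K h) s)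
      = ∑ ω, agreeSum ω g * expansionWeight bondChar (doubleCoupling K h) ω φ := by
  have hinner (s : V → ℤˣ) : ∑ σ, g (s * σ) * spin (φ s) *
      (boltzmann bondChar (bondCoupling K 0) σ * boltzmann bondChar (bondCoupling K h) s)
      = ∑ ω, ∑ τ, (g τ * agree ω τ) * (spin (φ s) *
        ∏ i ∈ ω, (Real.exp (doubleCoupling K h i * spin (bondChar i s)) - 1)) := by
    rw [← Equiv.sum_comp (Equiv.mulLeft s), Finset.sum_comm]
    refine Finset.sum_congr rfl fun τ _ => ?_
    have hs : s * (s * τ) = τ := by ext v; simp [← mul_assoc]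
    rw [Equiv.coe_mulLeft, hs, boltzmann_mul_boltzmann_eq_sum, Finset.mul_sum]
    exact Finset.sum_congr rfl fun ω _ => by ring
  rw [Finset.sum_congr rfl fun s _ => hinner s, Finset.sum_comm]
  refine Finset.sum_congr rfl fun ω _ => ?_
  rw [agreeSum, expansionWeight, Finset.sum_mul_sum, Finset.sum_comm]

lemma sum_mass (K : V → V → ℝ) (h : V → ℝ) :
    ∑ ω, mass (doubleCoupling K h) ω = duplicateZ K h := by
  have hdup := sum_duplicate_eq K h 1 1
  simp only [MonoidHom.one_apply, spin_one, Pi.one_apply, one_mul] at hdup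
  simp only [mass, ← hdup, duplicateZ]
  rw [mul_comm, Finset.sum_mul_sum]
  exact Finset.sum_congr rfl fun s _ => Finset.sum_congr rfl fun σ _ => mul_comm _ _

/-- The expectation of a function of the random set of interaction terms whose law is proportional
to `mass`. -/
noncomputable def clusterExpect (K : V → V → ℝ) (h : V → ℝ) :
    (Finset (Bond V) → ℝ) →ₗ[ℝ] ℝ where
  toFun f := (∑ ω, f ω * mass (doubleCoupling K h) ω) / duplicateZ K h
  map_add' f g := by simp only [Pi.add_apply, add_mul, Finset.sum_add_distrib, add_div]
  map_smul' a f := by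
    simp only [Pi.smul_apply, smul_eq_mul, mul_assoc, ← Finset.mul_sum, mul_div_assoc,
      RingHom.id_apply]

/-- The probability of an event under the law of `clusterExpect`. -/
noncomputable def clusterProb (K : V → V → ℝ) (h : V → ℝ) (A : Set (Finset (Bond V))) : ℝ :=
  clusterExpect K h (A.indicator 1)

lemma clusterExpect_apply (K : V → V → ℝ) (h : V → ℝ) (f : Finset (Bond V) → ℝ) :
    clusterExpect K h f = (∑ ω, f ω * mass (doubleCoupling K h) ω) / duplicateZ K h := rfl

lemma clusterExpect_one (K : V → V → ℝ) (h : V → ℝ) : clusterExpect K h 1 = 1 := by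
  simp [clusterExpect_apply, sum_mass, (duplicateZ_pos K h).ne']

lemma clusterExpect_mono (hK : ∀ x y, 0 ≤ K x y) (hh : ∀ x, 0 ≤ h x)
    {f g : Finset (Bond V) → ℝ} (hfg : f ≤ g) : clusterExpect K h f ≤ clusterExpect K h g :=
  div_le_div_of_nonneg_right (Finset.sum_le_sum fun ω _ =>
    mul_le_mul_of_nonneg_right (hfg ω) (mass_nonneg (doubleCoupling_nonneg hK hh) ω))
    (duplicateZ_pos K h).le

lemma clusterProb_nonneg (hK : ∀ x y, 0 ≤ K x y) (hh : ∀ x, 0 ≤ h x)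
    (A : Set (Finset (Bond V))) : 0 ≤ clusterProb K h A := by
  rw [clusterProb, ← map_zero (clusterExpect K h)]
  exact clusterExpect_mono hK hh fun ω => Set.indicator_nonneg (fun _ _ => zero_le_one) ω

lemma clusterProb_conn (K : V → V → ℝ) (h : V → ℝ) (x y : V) :
    clusterProb K h {ω | Conn ω x y} = pairCorr K 0 x y * pairCorr K h x y := by
  have hmass (ω : Finset (Bond V)) :
      Set.indicator {ω | Conn ω x y} 1 ω * mass (doubleCoupling K h) ω
        = (agreeSum ω fun τ => spin (τ x) * spin (τ y))
          * expansionWeight bondChar (doubleCoupling K h) ω 1 := by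
    by_cases hxy : Conn ω x y
    · simp [hxy, agreeSum_pair_of_conn hxy, mass]
    · simp [hxy, agreeSum_pair_of_not_conn hxy]
  rw [clusterProb, clusterExpect_apply, Finset.sum_congr rfl fun ω _ => hmass ω,
    ← sum_duplicate_eq, duplicateZ, pairCorr, pairCorr, isingExpect, isingExpect, expect, expect,
    div_mul_div_comm]
  congr 1
  rw [Finset.sum_mul_sum, Finset.sum_comm]
  refine Finset.sum_congr rfl fun s _ => Finset.sum_congr rfl fun σ _ => ?_
  simp only [MonoidHom.one_apply, spin_one, Pi.mul_apply, spin_mul]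
  ring

lemma pairCorr_sub_pairCorr_zero_mul (K : V → V → ℝ) (h : V → ℝ) (x y : V) :
    (pairCorr K h x y - pairCorr K 0 x y) * duplicateZ K h
      = ∑ ω, (agreeSum ω fun τ => 1 - spin (τ x) * spin (τ y)) *
        expansionWeight bondChar (doubleCoupling K h) ω (siteChar x * siteChar y) := by
  have hZ := sum_boltzmann_pos bondChar (bondCoupling K 0)
  have hZ' := sum_boltzmann_pos bondChar (bondCoupling K h)
  have hdiff : (pairCorr K h x y - pairCorr K 0 x y) * duplicateZ K h
      = (∑ s, spin (s x) * spin (s y) * boltzmann bondChar (bondCoupling K h) s) *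
          (∑ σ, boltzmann bondChar (bondCoupling K 0) σ)
        - (∑ s, boltzmann bondChar (bondCoupling K h) s) *
          ∑ σ, spin (σ x) * spin (σ y) * boltzmann bondChar (bondCoupling K 0) σ := by
    rw [duplicateZ, pairCorr, pairCorr, isingExpect, isingExpect, expect, expect]
    field_simp
  rw [← sum_duplicate_eq, hdiff, Finset.sum_mul_sum, Finset.sum_mul_sum,
    ← Finset.sum_sub_distrib]
  refine Finset.sum_congr rfl fun s _ => ?_
  rw [← Finset.sum_sub_distrib]
  refine Finset.sum_congr rfl fun σ _ => ?_
  simp only [MonoidHom.mul_apply, siteChar_apply, Pi.mul_apply, spin_mul]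
  linear_combination (spin (σ x) * spin (σ y) * boltzmann bondChar (bondCoupling K 0) σ *
      boltzmann bondChar (bondCoupling K h) s) * ((spin (s x) * spin (s x)) * spin_mul_self (s y) +
        spin_mul_self (s x))

-- Only the sets that connect `x` to the field but not to `y` contribute to the difference.
lemma pairCorr_sub_pairCorr_zero_le (hK : ∀ x y, 0 ≤ K x y) (hh : ∀ x, 0 ≤ h x) (x y : V) :
    (pairCorr K h x y - pairCorr K 0 x y) * duplicateZ K h
      ≤ ∑ ω, Set.indicator {ω | ConnField ω x} (fun ω => agreeSum ω 1 *
        expansionWeight bondChar (doubleCoupling K h) ω (siteChar x * siteChar y)) ω := by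
  rw [pairCorr_sub_pairCorr_zero_mul]
  refine Finset.sum_le_sum fun ω _ => ?_
  have hsub : (agreeSum ω fun τ => 1 - spin (τ x) * spin (τ y))
      = agreeSum ω 1 - agreeSum ω fun τ => spin (τ x) * spin (τ y) := by
    simp only [agreeSum, ← Finset.sum_sub_distrib, sub_mul, Pi.one_apply]
  have hweight := expansionWeight_nonneg bondChar (doubleCoupling_nonneg hK hh) ω
    (siteChar x * siteChar y)
  by_cases hx : ConnField ω x
  · rw [Set.indicator_of_mem (show ω ∈ {ω | ConnField ω x} from hx), hsub]
    exact mul_le_mul_of_nonneg_right (sub_le_self _ (agreeSum_pair_nonneg ω x y)) hweight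
  · rw [Set.indicator_of_notMem (show ω ∉ {ω | ConnField ω x} from hx), hsub]
    by_cases hxy : Conn ω x y
    · rw [agreeSum_pair_of_conn hxy, sub_self, zero_mul]
    · rw [expansionWeight_eq_zero hxy hx, mul_zero]

lemma prod_insertConst_mul_clusterProb_le (hK : ∀ x y, 0 ≤ K x y) (hh : ∀ x, 0 ≤ h x)
    {A B : Set (Finset (Bond V))} (E : Finset (Bond V)) (hAB : ∀ ω ∈ A, ω ∪ E ∈ B) :
    (∏ i ∈ E, insertConst (doubleCoupling K h i) / 4) * clusterProb K h A
      ≤ clusterProb K h B := by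
  have hc := doubleCoupling_nonneg hK hh
  have hquarter : ∏ i ∈ E, insertConst (doubleCoupling K h i) / 2
      = 2 ^ E.card * ∏ i ∈ E, insertConst (doubleCoupling K h i) / 4 := by
    rw [← Finset.prod_const, ← Finset.prod_mul_distrib]
    exact Finset.prod_congr rfl fun i _ => by ring
  have hpoint (ω : Finset (Bond V)) :
      (∏ i ∈ E, insertConst (doubleCoupling K h i) / 2) *
        (A.indicator 1 ω * mass (doubleCoupling K h) ω)
      ≤ B.indicator 1 (ω ∪ E) * mass (doubleCoupling K h) (ω ∪ E) := by
    by_cases hω : ω ∈ A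
    · simpa [hω, hAB ω hω] using prod_insertConst_mul_mass_le hc ω E
    · rw [Set.indicator_of_notMem hω, zero_mul, mul_zero]
      exact mul_nonneg (Set.indicator_nonneg (fun _ _ => zero_le_one) _) (mass_nonneg hc _)
  rw [clusterProb, clusterProb, clusterExpect_apply, clusterExpect_apply, ← mul_div_assoc]
  refine div_le_div_of_nonneg_right ?_ (duplicateZ_pos K h).le
  refine le_of_mul_le_mul_left ?_ (pow_pos two_pos E.card)
  rw [← mul_assoc, ← hquarter, Finset.mul_sum]
  exact (Finset.sum_le_sum fun ω _ => hpoint ω).trans <| sum_comp_union_le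
    (fun ω => mul_nonneg (Set.indicator_nonneg (fun _ _ => zero_le_one) ω) (mass_nonneg hc ω)) E

lemma boltzmann_update_zero (K : V → V → ℝ) (h : V → ℝ) (x : V) (s : V → ℤˣ) :
    boltzmann bondChar (bondCoupling K (Function.update h x 0)) s
      = Real.exp (-(h x * spin (s x))) * boltzmann bondChar (bondCoupling K h) s := by
  have hupdate : bondCoupling K (Function.update h x 0)
      = bondCoupling K h - Pi.single (Sum.inr x) (h x) := by
    ext (p | v)
    · simp
    · rcases eq_or_ne v x with rfl | hv <;> simp [*]
  rw [boltzmann, boltzmann, ← Real.exp_add, hupdate]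
  simp only [Pi.sub_apply, sub_mul, Finset.sum_sub_distrib, Pi.single_apply, ite_mul, zero_mul,
    Finset.sum_ite_eq', Finset.mem_univ, if_true, bondChar_inr_apply]
  rw [neg_add_eq_sub]

-- Setting `h x` to `0` removes exactly the sets that contain the field term of `x`.
lemma clusterProb_inr_mem_le (hh : ∀ x, 0 ≤ h x) (x : V) :
    clusterProb K h {ω | Sum.inr x ∈ ω} ≤ h x := by
  have hmass (ω : Finset (Bond V)) : mass (doubleCoupling K (Function.update h x 0)) ω
      = mass (doubleCoupling K h) ω
        - Set.indicator {ω | Sum.inr x ∈ ω} 1 ω * mass (doubleCoupling K h) ω := by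
    by_cases hx : Sum.inr x ∈ ω
    · simp [hx, mass, expansionWeight, Finset.prod_eq_zero hx, doubleCoupling]
    · have : ∀ i ∈ ω, doubleCoupling K (Function.update h x 0) i = doubleCoupling K h i := by
        rintro (p | v) hi
        · rfl
        · exact Function.update_of_ne (fun hv : v = x => hx (hv ▸ hi)) 0 h
      simp only [mass, expansionWeight]
      rw [Finset.sum_congr rfl fun s _ => by rw [Finset.prod_congr rfl fun i hi => by
        rw [this i hi]]]
      simp [hx]
  have hZ : (1 - h x) * duplicateZ K h ≤ duplicateZ K (Function.update h x 0) := by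
    rw [duplicateZ, duplicateZ, mul_left_comm, Finset.mul_sum]
    refine mul_le_mul_of_nonneg_left (Finset.sum_le_sum fun s _ => ?_) (sum_boltzmann_pos _ _).le
    rw [boltzmann_update_zero]
    refine mul_le_mul_of_nonneg_right ?_ (boltzmann_pos _ _ _).le
    have hexp := Real.add_one_le_exp (-(h x * spin (s x)))
    linarith [mul_le_of_le_one_right (hh x) (spin_le_one (s x))]
  rw [← sum_mass, ← sum_mass, Finset.sum_congr rfl fun ω _ => hmass ω, Finset.sum_sub_distrib,
    sum_mass] at hZ
  rw [clusterProb, clusterExpect_apply, div_le_iff₀ (duplicateZ_pos K h)]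
  linarith

-- Adding the pairs of the path removes the sources at its end points.
lemma agreeSum_mul_expansionWeight_path_le (hK : ∀ x y, 0 ≤ K x y) (hh : ∀ x, 0 ≤ h x)
    {w : ℕ → V} {n : ℕ} (hw : ∀ i < n, 0 < K (w i) (w (i + 1))) (ω : Finset (Bond V)) :
    2 ^ n * (agreeSum ω 1 * expansionWeight bondChar (doubleCoupling K h) ω
        (siteChar (w 0) * siteChar (w n)))
      ≤ pathConst K w n * mass (doubleCoupling K h) (ω ∪ (pathBonds w n).toFinset) := by
  have hc := doubleCoupling_nonneg hK hh
  have hcard : (2 : ℝ) ^ (pathBonds w n).toFinset.card ≤ 2 ^ n :=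
    pow_le_pow_right₀ one_le_two ((pathBonds w n).toFinset_card_le.trans (by simp [pathBonds]))
  have hagree := (agreeSum_le_union ω (pathBonds w n).toFinset).trans
    (mul_le_mul_of_nonneg_right hcard (agreeSum_one_nonneg _))
  have hweight := expansionWeight_mul_prod_le bondChar hc ω (l := pathBonds w n)
    (by simpa [pathBonds, doubleCoupling] using hw) 1
  have hprod : ((pathBonds w n).map fun i => sourceConst (doubleCoupling K h i)).prod
      = ∏ i ∈ Finset.range n, sourceConst (2 * K (w i) (w (i + 1))) := by
    rw [pathBonds, List.map_map]; rfl
  rw [prod_bondChar_pathBonds, one_mul, hprod] at hweight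
  have hmul := mul_le_mul hagree hweight (expansionWeight_nonneg _ hc _ _)
    (mul_nonneg (by positivity) (agreeSum_one_nonneg _))
  refine (mul_le_mul_of_nonneg_left hmul (pow_nonneg zero_le_two n)).trans_eq ?_
  rw [pathConst, mass, show (4 : ℝ) = 2 * 2 by norm_num, mul_pow]
  ring

lemma pairCorr_sub_pairCorr_zero_le_pathConst_mul (hK : ∀ x y, 0 ≤ K x y) (hh : ∀ x, 0 ≤ h x)
    {w : ℕ → V} {n : ℕ} (hw : ∀ i < n, 0 < K (w i) (w (i + 1))) :
    pairCorr K h (w 0) (w n) - pairCorr K 0 (w 0) (w n)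
      ≤ pathConst K w n * clusterProb K h {ω | ConnField ω (w 0)} := by
  have hc := doubleCoupling_nonneg hK hh
  set E := (pathBonds w n).toFinset
  have hE : (2 : ℝ) ^ E.card ≤ 2 ^ n :=
    pow_le_pow_right₀ one_le_two ((pathBonds w n).toFinset_card_le.trans (by simp [pathBonds]))
  have hconst := pathConst_nonneg hw
  have hpos (ω : Finset (Bond V)) : 0 ≤
      Set.indicator {ω | ConnField ω (w 0)} 1 ω * mass (doubleCoupling K h) ω :=
    mul_nonneg (Set.indicator_nonneg (fun _ _ => zero_le_one) ω) (mass_nonneg hc ω)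
  have hpoint (ω : Finset (Bond V)) : 2 ^ n * Set.indicator {ω | ConnField ω (w 0)} (fun ω =>
      agreeSum ω 1 * expansionWeight bondChar (doubleCoupling K h) ω
        (siteChar (w 0) * siteChar (w n))) ω
      ≤ pathConst K w n * (Set.indicator {ω | ConnField ω (w 0)} 1 (ω ∪ E) *
        mass (doubleCoupling K h) (ω ∪ E)) := by
    by_cases hω : ω ∈ {ω | ConnField ω (w 0)}
    · have hmem : ω ∪ E ∈ {ω | ConnField ω (w 0)} := hω.mono Finset.subset_union_left
      rw [Set.indicator_of_mem hω, Set.indicator_of_mem hmem, Pi.one_apply, one_mul]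
      exact agreeSum_mul_expansionWeight_path_le hK hh hw ω
    · rw [Set.indicator_of_notMem hω, mul_zero]
      exact mul_nonneg hconst (hpos _)
  refine le_of_mul_le_mul_right ?_ (duplicateZ_pos K h)
  refine (pairCorr_sub_pairCorr_zero_le hK hh _ _).trans <|
    le_of_mul_le_mul_left ?_ (pow_pos two_pos n : (0 : ℝ) < 2 ^ n)
  calc
    _ ≤ pathConst K w n * ∑ ω, Set.indicator {ω | ConnField ω (w 0)} 1 (ω ∪ E) *
        mass (doubleCoupling K h) (ω ∪ E) := by
      rw [Finset.mul_sum, Finset.mul_sum]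
      exact Finset.sum_le_sum fun ω _ => hpoint ω
    _ ≤ pathConst K w n * (2 ^ n * ∑ ω, Set.indicator {ω | ConnField ω (w 0)} 1 ω *
        mass (doubleCoupling K h) ω) :=
      mul_le_mul_of_nonneg_left ((sum_comp_union_le hpos E).trans
        (mul_le_mul_of_nonneg_right hE (Finset.sum_nonneg fun ω _ => hpos ω))) hconst
    _ = _ := by
      have hZ := (duplicateZ_pos K h).ne'
      rw [clusterProb, clusterExpect_apply]
      field_simp

end Duplicated

/-! ### Trifurcations -/

section Trifurcations

variable {V : Type*} {ω : Finset (Bond V)}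

/-- The set `S` meets three distinct clusters of `ω` that are connected to the field. -/
def MeetsThree (ω : Finset (Bond V)) (S : Finset V) : Prop :=
  ∃ x₁ ∈ S, ∃ x₂ ∈ S, ∃ x₃ ∈ S, ¬ Conn ω x₁ x₂ ∧ ¬ Conn ω x₁ x₃ ∧ ¬ Conn ω x₂ x₃ ∧
    ConnField ω x₁ ∧ ConnField ω x₂ ∧ ConnField ω x₃

lemma MeetsThree.mono {S B : Finset V} (hSB : S ⊆ B) : MeetsThree ω S → MeetsThree ω B := by
  rintro ⟨x₁, h₁, x₂, h₂, x₃, h₃, h⟩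
  exact ⟨x₁, hSB h₁, x₂, hSB h₂, x₃, hSB h₃, h⟩

/-- The pairs of sites of `B`. -/
def blockPairs (B : Finset V) : Finset (Bond V) := (B ×ˢ B).map Function.Embedding.inl

@[simp] lemma inl_mem_blockPairs {B : Finset V} {x y : V} :
    Sum.inl (x, y) ∈ blockPairs B ↔ x ∈ B ∧ y ∈ B := by
  simp [blockPairs]

@[simp] lemma inr_notMem_blockPairs (B : Finset V) (x : V) : Sum.inr x ∉ blockPairs B := by
  simp [blockPairs]

/-- A site of the cluster of `x`, the same for all sites of the cluster. -/
noncomputable def clusterRoot (ω : Finset (Bond V)) (x : V) : V :=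
  (Quotient.mk (Relation.EqvGen.setoid fun a b => Sum.inl (a, b) ∈ ω) x).out

lemma conn_clusterRoot (ω : Finset (Bond V)) (x : V) : Conn ω x (clusterRoot ω x) :=
  Conn.symm (Quotient.mk_out (s := Relation.EqvGen.setoid fun a b => Sum.inl (a, b) ∈ ω) x)

lemma Conn.clusterRoot_eq {x y : V} (h : Conn ω x y) : clusterRoot ω x = clusterRoot ω y :=
  congrArg Quotient.out
    (Quotient.sound (s := Relation.EqvGen.setoid fun a b => Sum.inl (a, b) ∈ ω) h)

section Blocks

variable [DecidableEq V] {B Bs Bt : Finset V}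

/-- The block `B` is a trifurcation of `ω`: its sites are connected inside `B`, and without the
pairs inside `B` it meets three distinct clusters that are connected to the field. -/
def Trifurcation (ω : Finset (Bond V)) (B : Finset V) : Prop :=
  (∀ x ∈ B, ∀ y ∈ B, Conn (ω ∩ blockPairs B) x y) ∧ MeetsThree (ω \ blockPairs B) B

lemma inter_blockPairs_subset (hdisj : Disjoint Bs Bt) :
    ω ∩ blockPairs Bs ⊆ ω \ blockPairs Bt := by
  rintro (⟨x, y⟩ | x) hi
  · simp only [Finset.mem_inter, inl_mem_blockPairs, Finset.mem_sdiff, not_and] at hi ⊢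
    exact ⟨hi.1, fun hx => absurd hx (Finset.disjoint_left.1 hdisj hi.2.1)⟩
  · simp at hi

lemma Conn.sdiff_of_away {a v : V} (haway : ∀ b ∈ Bt, ¬ Conn (ω \ blockPairs Bs) a b)
    (h : Conn (ω \ blockPairs Bs) a v) : Conn (ω \ blockPairs Bt) a v := by
  suffices hmain : ∀ u w, Conn (ω \ blockPairs Bs) u w → Conn (ω \ blockPairs Bs) a u →
      Conn (ω \ blockPairs Bt) u w from hmain a v h (Conn.refl a)
  intro u w huw
  induction huw with
  | rel u w huw =>
    intro hau
    refine Conn.of_mem (Finset.mem_sdiff.2 ⟨(Finset.mem_sdiff.1 huw).1, fun hmem => ?_⟩)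
    exact haway u (inl_mem_blockPairs.1 hmem).1 hau
  | refl u => exact fun _ => Conn.refl u
  | symm u w huw ih => exact fun haw => (ih (haw.trans (Conn.symm huw))).symm
  | trans u w z huw _ ih ih' => exact fun hau => (ih hau).trans (ih' (hau.trans huw))

lemma exists_conn_sdiff {x v : V} (hx : x ∈ B) (h : Conn ω x v) :
    ∃ y ∈ B, Conn (ω \ blockPairs B) y v := by
  refine (apply_eq_of_eqvGen (f := fun v => ∃ y ∈ B, Conn (ω \ blockPairs B) y v)
    (fun a b hab => ?_) h).mp ⟨x, hx, Conn.refl x⟩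
  by_cases hmem : Sum.inl (a, b) ∈ blockPairs B
  · have hB := inl_mem_blockPairs.1 hmem
    exact propext (iff_of_true ⟨a, hB.1, Conn.refl a⟩ ⟨b, hB.2, Conn.refl b⟩)
  · have hconn : Conn (ω \ blockPairs B) a b := Conn.of_mem (Finset.mem_sdiff.2 ⟨hab, hmem⟩)
    exact propext ⟨fun ⟨y, hy, hya⟩ => ⟨y, hy, hya.trans hconn⟩,
      fun ⟨y, hy, hyb⟩ => ⟨y, hy, hyb.trans hconn.symm⟩⟩

-- The last block visited by a path from `b` to `r` is left for good.
lemma exists_conn_sdiff_or {b r : V} (hb : b ∈ Bt) (h : Conn ω b r) :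
    (∃ u ∈ Bt, Conn (ω \ blockPairs Bs) u r) ∨ ∃ u ∈ Bs, Conn (ω \ blockPairs Bt) u r := by
  refine (apply_eq_of_eqvGen (f := fun r => (∃ u ∈ Bt, Conn (ω \ blockPairs Bs) u r) ∨
    ∃ u ∈ Bs, Conn (ω \ blockPairs Bt) u r) (fun x y hxy => ?_) h).mp (Or.inl ⟨b, hb, Conn.refl b⟩)
  by_cases hs : Sum.inl (x, y) ∈ blockPairs Bs
  · have hB := inl_mem_blockPairs.1 hs
    exact propext (iff_of_true (Or.inr ⟨x, hB.1, Conn.refl x⟩) (Or.inr ⟨y, hB.2, Conn.refl y⟩))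
  by_cases ht : Sum.inl (x, y) ∈ blockPairs Bt
  · have hB := inl_mem_blockPairs.1 ht
    exact propext (iff_of_true (Or.inl ⟨x, hB.1, Conn.refl x⟩) (Or.inl ⟨y, hB.2, Conn.refl y⟩))
  have hconn_s : Conn (ω \ blockPairs Bs) x y := Conn.of_mem (Finset.mem_sdiff.2 ⟨hxy, hs⟩)
  have hconn_t : Conn (ω \ blockPairs Bt) x y := Conn.of_mem (Finset.mem_sdiff.2 ⟨hxy, ht⟩)
  exact propext (or_congr
    ⟨fun ⟨u, hu, h⟩ => ⟨u, hu, h.trans hconn_s⟩, fun ⟨u, hu, h⟩ => ⟨u, hu, h.trans hconn_s.symm⟩⟩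
    ⟨fun ⟨u, hu, h⟩ => ⟨u, hu, h.trans hconn_t⟩, fun ⟨u, hu, h⟩ => ⟨u, hu, h.trans hconn_t.symm⟩⟩)

/-- The cluster of `y`, without the pairs inside the block `B`, is a branch at `B`: it is connected
to the field and does not contain the root of the whole cluster. -/
structure IsBranch (ω : Finset (Bond V)) (B : Finset V) (y : V) : Prop where
  mem : y ∈ B
  connField : ConnField (ω \ blockPairs B) y
  not_conn_root : ¬ Conn (ω \ blockPairs B) y (clusterRoot ω y)

lemma Trifurcation.exists_branches (h : Trifurcation ω B) :
    ∃ y : Bool → V, (∀ i, IsBranch ω B (y i)) ∧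
      ¬ Conn (ω \ blockPairs B) (y true) (y false) := by
  obtain ⟨hconn, x₁, h₁, x₂, h₂, x₃, h₃, h₁₂, h₁₃, h₂₃, f₁, f₂, f₃⟩ := h
  have hroot {x : V} (hx : x ∈ B) : clusterRoot ω x = clusterRoot ω x₁ :=
    ((hconn x hx x₁ h₁).mono Finset.inter_subset_left).clusterRoot_eq
  have hbranch {a b : V} (ha : a ∈ B) (hb : b ∈ B) (hab : ¬ Conn (ω \ blockPairs B) a b)
      (fa : ConnField (ω \ blockPairs B) a) (fb : ConnField (ω \ blockPairs B) b)
      (ra : ¬ Conn (ω \ blockPairs B) a (clusterRoot ω x₁))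
      (rb : ¬ Conn (ω \ blockPairs B) b (clusterRoot ω x₁)) :
      ∃ y : Bool → V, (∀ i, IsBranch ω B (y i)) ∧
        ¬ Conn (ω \ blockPairs B) (y true) (y false) := by
    rw [← hroot ha] at ra
    rw [← hroot hb] at rb
    exact ⟨fun i => cond i a b, Bool.forall_bool.2 ⟨⟨hb, fb, rb⟩, ⟨ha, fa, ra⟩⟩, hab⟩
  by_cases r₁ : Conn (ω \ blockPairs B) x₁ (clusterRoot ω x₁)
  · exact hbranch h₂ h₃ h₂₃ f₂ f₃ (fun r₂ => h₁₂ (r₁.trans r₂.symm))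
      fun r₃ => h₁₃ (r₁.trans r₃.symm)
  by_cases r₂ : Conn (ω \ blockPairs B) x₂ (clusterRoot ω x₁)
  · exact hbranch h₁ h₃ h₁₃ f₁ f₃ r₁ fun r₃ => h₂₃ (r₂.trans r₃.symm)
  · exact hbranch h₁ h₂ h₁₂ f₁ f₂ r₁ r₂

lemma IsBranch.away_or_away (hs : Trifurcation ω Bs) (ht : Trifurcation ω Bt)
    (hdisj : Disjoint Bs Bt) {y z : V} (hy : IsBranch ω Bs y) (hz : IsBranch ω Bt z) :
    (∀ b ∈ Bt, ¬ Conn (ω \ blockPairs Bs) y b) ∨ ∀ b ∈ Bs, ¬ Conn (ω \ blockPairs Bt) z b := by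
  by_contra! ⟨⟨b, hb, hyb⟩, ⟨b', hb', hzb'⟩⟩
  have hroot_y : clusterRoot ω y = clusterRoot ω b :=
    (hyb.mono Finset.sdiff_subset).clusterRoot_eq
  have hroot_z : clusterRoot ω z = clusterRoot ω b :=
    ((ht.1 z hz.mem b hb).mono Finset.inter_subset_left).clusterRoot_eq
  rcases exists_conn_sdiff_or (Bs := Bs) hb (conn_clusterRoot ω b) with
    ⟨u, hu, hur⟩ | ⟨u, hu, hur⟩
  · refine hy.not_conn_root (hroot_y ▸ hyb.trans (Conn.trans ?_ hur))
    exact (ht.1 b hb u hu).mono (inter_blockPairs_subset hdisj.symm)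
  · refine hz.not_conn_root (hroot_z ▸ hzb'.trans (Conn.trans ?_ hur))
    exact (hs.1 b' hb' u hu).mono (inter_blockPairs_subset hdisj)

end Blocks

lemma card_le_of_pairwise_orthogonal {β : Type*} {T : Finset β} {S : Finset V} {f : β → V → ℝ}
    (hne : ∀ t ∈ T, ∃ v ∈ S, f t v ≠ 0)
    (horth : ∀ s ∈ T, ∀ t ∈ T, s ≠ t → ∑ v ∈ S, f s v * f t v = 0) : T.card ≤ S.card := by
  have hli : LinearIndependent ℝ fun t : T => WithLp.toLp 2 fun v : S => f t v := by
    refine linearIndependent_of_ne_zero_of_inner_eq_zero (𝕜 := ℝ) (fun t hzero => ?_)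
      fun s t hst => ?_
    · obtain ⟨v, hv, hfv⟩ := hne t t.2
      exact hfv (congrArg (fun g : EuclideanSpace ℝ S => g ⟨v, hv⟩) hzero)
    · change inner ℝ _ _ = (0 : ℝ)
      rw [PiLp.inner_apply]
      simpa [← Finset.sum_coe_sort S] using
        horth t t.2 s s.2 fun hts => hst (Subtype.ext hts.symm)
  simpa using hli.fintype_card_le_finrank

section BranchDiff

open Classical in
/-- The sites whose field term is in `ω`. -/
noncomputable def fieldSites [Fintype V] (ω : Finset (Bond V)) : Finset V := {v | Sum.inr v ∈ ω}

variable [Fintype V] {y : Bool → V} {v w : V}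

lemma mem_fieldSites : v ∈ fieldSites ω ↔ Sum.inr v ∈ ω := by simp [fieldSites]

lemma fieldSites_sdiff_blockPairs [DecidableEq V] (ω : Finset (Bond V)) (B : Finset V) :
    fieldSites (ω \ blockPairs B) = fieldSites ω := by
  ext v; simp [mem_fieldSites]

open Classical in
/-- The uniform distribution on the field sites in the cluster of `y true`, minus the one for
`y false`. -/
noncomputable def branchDiff (ω : Finset (Bond V)) (y : Bool → V) (v : V) : ℝ :=
  (if Conn ω (y true) v then 1 else 0) / ({w ∈ fieldSites ω | Conn ω (y true) w} : Finset V).card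
    - (if Conn ω (y false) v then 1 else 0) /
      ({w ∈ fieldSites ω | Conn ω (y false) w} : Finset V).card

open Classical in
lemma ConnField.card_filter_ne_zero {x : V} (h : ConnField ω x) :
    (({w ∈ fieldSites ω | Conn ω x w} : Finset V).card : ℝ) ≠ 0 := by
  obtain ⟨v, hv, hv'⟩ := h
  exact Nat.cast_ne_zero.2 (Finset.card_ne_zero_of_mem
    (Finset.mem_filter.2 ⟨mem_fieldSites.2 hv', hv⟩))

lemma sum_branchDiff (hy : ∀ i, ConnField ω (y i)) : ∑ v ∈ fieldSites ω, branchDiff ω y v = 0 := by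
  simp only [branchDiff, Finset.sum_sub_distrib, ← Finset.sum_div, Finset.sum_boole]
  rw [div_self (hy true).card_filter_ne_zero, div_self (hy false).card_filter_ne_zero, sub_self]

lemma exists_branchDiff_ne_zero (hy : ConnField ω (y true)) (hne : ¬ Conn ω (y true) (y false)) :
    ∃ v ∈ fieldSites ω, branchDiff ω y v ≠ 0 := by
  obtain ⟨v, hv, hv'⟩ := id hy
  have hfalse : ¬ Conn ω (y false) v := fun h => hne (hv.trans h.symm)
  refine ⟨v, mem_fieldSites.2 hv', ?_⟩
  rw [branchDiff, if_pos hv, if_neg hfalse, zero_div, sub_zero]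
  exact one_div_ne_zero hy.card_filter_ne_zero

open Classical in
lemma Conn.branchDiff_eq (h : Conn ω v w) : branchDiff ω y v = branchDiff ω y w := by
  have hiff (i : Bool) : Conn ω (y i) v ↔ Conn ω (y i) w :=
    ⟨fun h' => h'.trans h, fun h' => h'.trans h.symm⟩
  simp only [branchDiff, if_congr (hiff _) rfl rfl]

lemma sum_branchDiff_mul_eq_zero (hy : ∀ i, ConnField ω (y i)) {g : V → ℝ} {a : ℝ}
    (hg : ∀ i v, Conn ω (y i) v → g v = a) :
    ∑ v ∈ fieldSites ω, branchDiff ω y v * g v = 0 := by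
  have hconst (v : V) : branchDiff ω y v * g v = branchDiff ω y v * a := by
    by_cases hv : ∃ i, Conn ω (y i) v
    · obtain ⟨i, hi⟩ := hv
      rw [hg i v hi]
    · push Not at hv
      simp [branchDiff, hv]
  rw [Finset.sum_congr rfl fun v _ => hconst v, ← Finset.sum_mul, sum_branchDiff hy, zero_mul]

-- Seen from the second block, the branches at the first block belong to the same cluster.
lemma sum_branchDiff_mul_branchDiff_eq_zero [DecidableEq V] {Bs Bt : Finset V}
    (hs : Trifurcation ω Bs) (hdisj : Disjoint Bs Bt) (hy : ∀ i, IsBranch ω Bs (y i))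
    (haway : ∀ i, ∀ b ∈ Bt, ¬ Conn (ω \ blockPairs Bs) (y i) b) (z : Bool → V) :
    ∑ v ∈ fieldSites ω, branchDiff (ω \ blockPairs Bs) y v * branchDiff (ω \ blockPairs Bt) z v
      = 0 := by
  rw [← fieldSites_sdiff_blockPairs ω Bs]
  refine sum_branchDiff_mul_eq_zero (fun i => (hy i).connField)
    (a := branchDiff (ω \ blockPairs Bt) z (y true)) fun i v hv => (Conn.branchDiff_eq ?_).symm
  exact ((hs.1 _ (hy true).mem _ (hy i).mem).mono (inter_blockPairs_subset hdisj)).trans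
    (hv.sdiff_of_away (haway i))

lemma card_le_card_fieldSites_of_trifurcation [DecidableEq V] {β : Type*} {T : Finset β}
    {B : β → Finset V} (hdisj : (T : Set β).PairwiseDisjoint B)
    (htri : ∀ t ∈ T, Trifurcation ω (B t)) : T.card ≤ (fieldSites ω).card := by
  rcases T.eq_empty_or_nonempty with rfl | ⟨t₀, ht₀⟩
  · simp
  have : Nonempty V := (htri t₀ ht₀).exists_branches.nonempty.map (· true)
  choose! y hy hne using fun t ht => (htri t ht).exists_branches
  refine card_le_of_pairwise_orthogonal
    (f := fun t => branchDiff (ω \ blockPairs (B t)) (y t)) (fun t ht => ?_)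
    fun s hs t ht hst => ?_
  · rw [← fieldSites_sdiff_blockPairs ω (B t)]
    exact exists_branchDiff_ne_zero (hy t ht true).connField (hne t ht)
  have haway : (∀ i, ∀ b ∈ B t, ¬ Conn (ω \ blockPairs (B s)) (y s i) b) ∨
      ∀ j, ∀ b ∈ B s, ¬ Conn (ω \ blockPairs (B t)) (y t j) b := by
    by_contra! ⟨⟨i, b, hb, hib⟩, ⟨j, b', hb', hjb'⟩⟩
    rcases IsBranch.away_or_away (htri s hs) (htri t ht) (hdisj hs ht hst) (hy s hs i)
      (hy t ht j) with h | h
    · exact h b hb hib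
    · exact h b' hb' hjb'
  rcases haway with haway | haway
  · exact sum_branchDiff_mul_branchDiff_eq_zero (htri s hs) (hdisj hs ht hst) (hy s hs) haway _
  · simp only [mul_comm (branchDiff (ω \ blockPairs (B s)) _ _)]
    exact sum_branchDiff_mul_branchDiff_eq_zero (htri t ht) (hdisj ht hs hst.symm) (hy t ht) haway _

end BranchDiff

end Trifurcations

section Blocks

variable {V : Type*}

/-- The sites of the block `B` are connected inside `B` along positive couplings. -/
def BlockConnected (K : V → V → ℝ) (B : Finset V) : Prop :=
  ∀ x ∈ B, ∀ y ∈ B, Relation.EqvGen (fun a b => a ∈ B ∧ b ∈ B ∧ 0 < K a b) x y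

/-- The factor lost in probability when all the pairs inside the block `B` with a positive coupling
are added. -/
noncomputable def blockConst (K : V → V → ℝ) (B : Finset V) : ℝ :=
  ∏ x ∈ B, ∏ y ∈ B, if 0 < K x y then insertConst (2 * K x y) / 4 else 1

lemma blockConst_pos (K : V → V → ℝ) (B : Finset V) : 0 < blockConst K B :=
  Finset.prod_pos fun x _ => Finset.prod_pos fun y _ => by
    split_ifs with hK
    · exact div_pos (insertConst_pos (mul_pos two_pos hK)) four_pos
    · exact one_pos

/-- The pairs inside the block `B` with a positive coupling. -/
noncomputable def blockBonds (K : V → V → ℝ) (B : Finset V) : Finset (Bond V) :=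
  {i ∈ blockPairs B | 0 < bondCoupling K 0 i}

lemma prod_blockBonds (K : V → V → ℝ) (h : V → ℝ) (B : Finset V) :
    ∏ i ∈ blockBonds K B, insertConst (doubleCoupling K h i) / 4 = blockConst K B := by
  rw [blockBonds, blockPairs, Finset.prod_filter, Finset.prod_map, Finset.prod_product]
  rfl

variable [DecidableEq V]

lemma MeetsThree.trifurcation {K : V → V → ℝ} {ω : Finset (Bond V)} {S B : Finset V}
    (h : MeetsThree ω S) (hSB : S ⊆ B) (hB : BlockConnected K B) :
    Trifurcation (ω ∪ blockBonds K B) B := by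
  refine ⟨fun x hx y hy => Relation.EqvGen.mono (fun a b hab => ?_) _ _ (hB x hx y hy), ?_⟩
  · simp [blockBonds, hab]
  have hsub : blockBonds K B ⊆ blockPairs B := Finset.filter_subset _ _
  rw [Finset.union_sdiff_distrib, Finset.sdiff_eq_empty_iff_subset.2 hsub, Finset.union_empty]
  have hbranch : ∀ x ∈ B, ConnField ω x → ∃ y ∈ B, ConnField (ω \ blockPairs B) y ∧ Conn ω x y := by
    rintro x hx ⟨v, hv, hv'⟩
    obtain ⟨y, hy, hyv⟩ := exists_conn_sdiff hx hv
    exact ⟨y, hy, ⟨v, hyv, Finset.mem_sdiff.2 ⟨hv', inr_notMem_blockPairs B v⟩⟩,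
      hv.trans (hyv.mono Finset.sdiff_subset).symm⟩
  have hne {a b a' b' : V} (ha : Conn ω a a') (hb : Conn ω b b') (hab : ¬ Conn ω a b) :
      ¬ Conn (ω \ blockPairs B) a' b' := fun h' =>
    hab (ha.trans ((h'.mono Finset.sdiff_subset).trans hb.symm))
  obtain ⟨x₁, h₁, x₂, h₂, x₃, h₃, h₁₂, h₁₃, h₂₃, f₁, f₂, f₃⟩ := h.mono hSB
  obtain ⟨y₁, b₁, g₁, c₁⟩ := hbranch x₁ h₁ f₁
  obtain ⟨y₂, b₂, g₂, c₂⟩ := hbranch x₂ h₂ f₂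
  obtain ⟨y₃, b₃, g₃, c₃⟩ := hbranch x₃ h₃ f₃
  exact ⟨y₁, b₁, y₂, b₂, y₃, b₃, hne c₁ c₂ h₁₂, hne c₁ c₃ h₁₃, hne c₂ c₃ h₂₃, g₁, g₂, g₃⟩

end Blocks

section MeetsThree

open Classical in
lemma sq_card_le_of_not_three {V : Type*} {r : V → V → Prop} (hr : Equivalence r) {N : Finset V}
    (h : ¬ ∃ x₁ ∈ N, ∃ x₂ ∈ N, ∃ x₃ ∈ N, ¬ r x₁ x₂ ∧ ¬ r x₁ x₃ ∧ ¬ r x₂ x₃) :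
    N.card ^ 2 ≤ 2 * ({p ∈ N ×ˢ N | r p.1 p.2} : Finset (V × V)).card := by
  rcases N.eq_empty_or_nonempty with rfl | ⟨x, hx⟩
  · simp
  set A := {y ∈ N | r x y}
  set A' := {y ∈ N | ¬ r x y}
  have hdisj : Disjoint (A ×ˢ A) (A' ×ˢ A') :=
    Finset.disjoint_product.2 (Or.inl (Finset.disjoint_filter_filter_not N N _))
  have hsub : A ×ˢ A ∪ A' ×ˢ A' ⊆ ({p ∈ N ×ˢ N | r p.1 p.2} : Finset (V × V)) := by
    rintro ⟨a, b⟩ hab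
    simp only [A, A', Finset.mem_union, Finset.mem_product, Finset.mem_filter] at hab ⊢
    rcases hab with ⟨⟨ha, hxa⟩, hb, hxb⟩ | ⟨⟨ha, hxa⟩, hb, hxb⟩
    · exact ⟨⟨ha, hb⟩, hr.trans (hr.symm hxa) hxb⟩
    · exact ⟨⟨ha, hb⟩, by_contra fun hab => h ⟨x, hx, a, ha, b, hb, hxa, hxb, hab⟩⟩
  calc N.card ^ 2 = (A.card + A'.card) ^ 2 := by
        rw [Finset.card_filter_add_card_filter_not]
    _ ≤ 2 * (A.card ^ 2 + A'.card ^ 2) := add_sq_le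
    _ = 2 * (A ×ˢ A ∪ A' ×ˢ A').card := by
        rw [Finset.card_union_of_disjoint hdisj, Finset.card_product, Finset.card_product, sq, sq]
    _ ≤ _ := Nat.mul_le_mul_left 2 (Finset.card_le_card hsub)

variable {V : Type*}

-- `N ≤ a / 2 + Q / a` follows from `N ^ 2 ≤ 2 * Q`, for the number `N` of sites of `S` connected
-- to the field and the number `Q` of connected pairs of sites of `S`.
lemma sum_indicator_connField_le (ω : Finset (Bond V)) (S : Finset V) {a : ℝ} (ha : 0 < a) :
    ∑ x ∈ S, Set.indicator {ω | ConnField ω x} (1 : Finset (Bond V) → ℝ) ω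
      ≤ S.card * Set.indicator {ω | MeetsThree ω S} 1 ω + a / 2
        + a⁻¹ * ∑ x ∈ S, ∑ y ∈ S, Set.indicator {ω | Conn ω x y} 1 ω := by
  classical
  set N : Finset V := {x ∈ S | ConnField ω x} with hN_def
  set Q : Finset (V × V) := {p ∈ S ×ˢ S | Conn ω p.1 p.2} with hQ_def
  have hN : ∑ x ∈ S, Set.indicator {ω | ConnField ω x} (1 : Finset (Bond V) → ℝ) ω = N.card := by
    simp [Set.indicator_apply, hN_def]
  have hQ : ∑ x ∈ S, ∑ y ∈ S, Set.indicator {ω | Conn ω x y} (1 : Finset (Bond V) → ℝ) ω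
      = Q.card := by
    rw [← Finset.sum_product', hQ_def]
    simp [Set.indicator_apply]
  rw [hN, hQ]
  by_cases hthree : MeetsThree ω S
  · have hle : (N.card : ℝ) ≤ S.card := Nat.cast_le.2 (Finset.card_filter_le _ _)
    rw [Set.indicator_of_mem (show ω ∈ {ω | MeetsThree ω S} from hthree), Pi.one_apply, mul_one,
      add_assoc]
    exact le_add_of_le_of_nonneg hle (by positivity)
  · have hnot : ¬ ∃ x₁ ∈ N, ∃ x₂ ∈ N, ∃ x₃ ∈ N,
        ¬ Conn ω x₁ x₂ ∧ ¬ Conn ω x₁ x₃ ∧ ¬ Conn ω x₂ x₃ := by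
      rintro ⟨x₁, h₁, x₂, h₂, x₃, h₃, h₁₂, h₁₃, h₂₃⟩
      simp only [hN_def, Finset.mem_filter] at h₁ h₂ h₃
      exact hthree ⟨x₁, h₁.1, x₂, h₂.1, x₃, h₃.1, h₁₂, h₁₃, h₂₃, h₁.2, h₂.2, h₃.2⟩
    have hsq := sq_card_le_of_not_three ⟨Conn.refl, Conn.symm, Conn.trans⟩ hnot
    have hsub : ({p ∈ N ×ˢ N | Conn ω p.1 p.2} : Finset (V × V)).card ≤ Q.card :=
      Finset.card_le_card (Finset.filter_subset_filter _
        (Finset.product_subset_product (Finset.filter_subset _ _) (Finset.filter_subset _ _)))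
    have hNQ : (N.card : ℝ) ^ 2 ≤ 2 * Q.card := by exact_mod_cast hsq.trans (by omega)
    rw [Set.indicator_of_notMem (show ω ∉ {ω | MeetsThree ω S} from hthree), mul_zero, zero_add,
      div_add' _ _ _ two_ne_zero, le_div_iff₀ two_pos, ← mul_le_mul_iff_left₀ ha]
    have hcancel : a⁻¹ * Q.card * 2 * a = 2 * Q.card := by field_simp
    nlinarith [sq_nonneg (N.card - a)]

variable [Fintype V] [DecidableEq V] {K : V → V → ℝ} {h : V → ℝ}

lemma clusterProb_meetsThree_ge (hK : ∀ x y, 0 ≤ K x y) (hh : ∀ x, 0 ≤ h x) {S : Finset V}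
    (hS : S.Nonempty) {p : ℝ} (hp : 0 < p)
    (hperc : ∀ x ∈ S, p ≤ clusterProb K h {ω | ConnField ω x})
    (hpair : ∑ x ∈ S, ∑ y ∈ S, pairCorr K 0 x y ≤ p ^ 2 / 4 * (S.card : ℝ) ^ 2) :
    p / 4 ≤ clusterProb K h {ω | MeetsThree ω S} := by
  have hcard : (0 : ℝ) < S.card := Nat.cast_pos.2 hS.card_pos
  have hmean := clusterExpect_mono hK hh
    (f := ∑ x ∈ S, Set.indicator {ω | ConnField ω x} 1)
    (g := (S.card : ℝ) • Set.indicator {ω | MeetsThree ω S} 1 + (p * S.card / 2) • 1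
      + (p * S.card)⁻¹ • ∑ x ∈ S, ∑ y ∈ S, Set.indicator {ω | Conn ω x y} 1) fun ω => by
    simpa [Finset.sum_apply] using sum_indicator_connField_le ω S (mul_pos hp hcard)
  simp only [map_add, map_smul, map_sum, clusterExpect_one, smul_eq_mul] at hmean
  have hprob (A : Set (Finset (Bond V))) : clusterExpect K h (A.indicator 1) = clusterProb K h A :=
    rfl
  simp only [hprob, clusterProb_conn] at hmean
  have hN : S.card * p ≤ ∑ x ∈ S, clusterProb K h {ω | ConnField ω x} := by
    simpa using Finset.card_nsmul_le_sum S _ p hperc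
  have hQ : ∑ x ∈ S, ∑ y ∈ S, pairCorr K 0 x y * pairCorr K h x y
      ≤ p ^ 2 / 4 * (S.card : ℝ) ^ 2 :=
    (Finset.sum_le_sum fun x _ => Finset.sum_le_sum fun y _ => mul_le_of_le_one_right
      (pairCorr_nonneg hK (fun _ => le_rfl) x y) (pairCorr_le_one K h x y)).trans hpair
  have hQ' := mul_le_mul_of_nonneg_left hQ (inv_nonneg.2 (mul_pos hp hcard).le)
  have hcancel : (p * S.card : ℝ)⁻¹ * (p ^ 2 / 4 * (S.card : ℝ) ^ 2) = S.card * (p / 4) := by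
    field_simp
  refine le_of_mul_le_mul_left ?_ hcard
  linarith

lemma sum_clusterProb_trifurcation_le (hK : ∀ x y, 0 ≤ K x y) (hh : ∀ x, 0 ≤ h x) {β : Type*}
    {T : Finset β} {B : β → Finset V} (hdisj : (T : Set β).PairwiseDisjoint B) :
    ∑ t ∈ T, clusterProb K h {ω | Trifurcation ω (B t)} ≤ ∑ x, h x := by
  classical
  have hpoint : ∑ t ∈ T, Set.indicator {ω | Trifurcation ω (B t)} (1 : Finset (Bond V) → ℝ)
      ≤ ∑ x, Set.indicator {ω | Sum.inr x ∈ ω} 1 := by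
    intro ω
    have hcard := card_le_card_fieldSites_of_trifurcation (ω := ω)
      (T := {t ∈ T | Trifurcation ω (B t)}) (B := B)
      (hdisj.subset fun t ht => (Finset.mem_filter.1 ht).1)
      fun t ht => (Finset.mem_filter.1 ht).2
    simp only [Finset.sum_apply, Set.indicator_apply, Set.mem_ofPred_eq, Pi.one_apply,
      Finset.sum_boole]
    exact Nat.cast_le.2 (hcard.trans_eq (congrArg Finset.card (by ext; simp [mem_fieldSites])))
  have hmean := clusterExpect_mono hK hh hpoint
  simp only [map_sum] at hmean
  exact hmean.trans (Finset.sum_le_sum fun x _ => clusterProb_inr_mem_le hh x)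

lemma card_mul_le_sum_field (hK : ∀ x y, 0 ≤ K x y) (hh : ∀ x, 0 ≤ h x) {β : Type*}
    {T : Finset β} {S B : β → Finset V} (hSB : ∀ t ∈ T, S t ⊆ B t)
    (hS : ∀ t ∈ T, (S t).Nonempty) (hconn : ∀ t ∈ T, BlockConnected K (B t))
    (hdisj : (T : Set β).PairwiseDisjoint B) {q p : ℝ} (hq : ∀ t ∈ T, q ≤ blockConst K (B t))
    (hp : 0 < p) (hperc : ∀ t ∈ T, ∀ x ∈ S t, p ≤ clusterProb K h {ω | ConnField ω x})
    (hpair : ∀ t ∈ T, ∑ x ∈ S t, ∑ y ∈ S t, pairCorr K 0 x y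
      ≤ p ^ 2 / 4 * ((S t).card : ℝ) ^ 2) :
    T.card * (q * (p / 4)) ≤ ∑ x, h x := by
  have htri : ∀ t ∈ T, q * (p / 4) ≤ clusterProb K h {ω | Trifurcation ω (B t)} := fun t ht =>
    calc q * (p / 4) ≤ blockConst K (B t) * clusterProb K h {ω | MeetsThree ω (S t)} :=
          mul_le_mul (hq t ht) (clusterProb_meetsThree_ge hK hh (hS t ht) hp (hperc t ht)
            (hpair t ht)) (by positivity) (blockConst_pos K _).le
      _ ≤ _ := by
          rw [← prod_blockBonds K h]
          exact prod_insertConst_mul_clusterProb_le hK hh _ fun ω hω =>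
            MeetsThree.trifurcation hω (hSB t ht) (hconn t ht)
  calc T.card * (q * (p / 4)) = ∑ t ∈ T, q * (p / 4) := by simp
    _ ≤ _ := Finset.sum_le_sum htri
    _ ≤ _ := sum_clusterProb_trifurcation_le hK hh hdisj

end MeetsThree

/-! ### Finite volumes -/

section FiniteVolume

variable {d : ℕ} {J : Site d → Site d → ℝ}

lemma Admissible.summable_right (hJ : Admissible J) (x : Site d) : Summable fun y => J x y := by
  have hshift : (fun y => J x y) = (fun y => J 0 y) ∘ Equiv.subRight x := by
    ext y; simp [hJ.transl x y]
  rw [hshift]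
  exact (Equiv.subRight x).summable_iff.2 hJ.summable

lemma Admissible.add_right (hJ : Admissible J) (x y t : Site d) : J (x + t) (y + t) = J x y := by
  rw [hJ.transl (x + t), hJ.transl x]; simp

/-- The pair coupling of `x` and `y` at inverse temperature `β`. It is half of the coupling of the
unordered pair, as the interaction terms are indexed by ordered pairs. -/
noncomputable def pairCoupling (J : Site d → Site d → ℝ) (β : ℝ) (x y : Site d) : ℝ :=
  if x = y then 0 else β / 2 * J x y

/-- The pair couplings between the sites of the volume `Λ`. -/
noncomputable def volumePair (J : Site d → Site d → ℝ) (β : ℝ) (Λ : Finset (Site d)) (x y : Λ) :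
    ℝ :=
  pairCoupling J β x y

/-- The field produced in the volume `Λ` by the boundary condition `τ`. -/
noncomputable def volumeField (J : Site d → Site d → ℝ) (β : ℝ) (Λ : Finset (Site d))
    (τ : Site d → ℝ) (x : Λ) : ℝ :=
  β * ∑' y : {y : Site d // y ∉ Λ}, J x y * τ y

lemma pairCoupling_nonneg (hJ : Admissible J) {β : ℝ} (hβ : 0 ≤ β) (x y : Site d) :
    0 ≤ pairCoupling J β x y := by
  rw [pairCoupling]
  split_ifs
  · exact le_rfl
  · exact mul_nonneg (by linarith) (hJ.ferro _ _)

lemma pairCoupling_pos {β : ℝ} (hβ : 0 < β) {x y : Site d} (hxy : x ≠ y) (hJ : 0 < J x y) :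
    0 < pairCoupling J β x y := by
  rw [pairCoupling, if_neg hxy]
  positivity

lemma pairCoupling_add_right (hJ : Admissible J) (β : ℝ) (x y t : Site d) :
    pairCoupling J β (x + t) (y + t) = pairCoupling J β x y := by
  simp only [pairCoupling, add_left_inj, hJ.add_right]

lemma volumePair_nonneg (hJ : Admissible J) {β : ℝ} (hβ : 0 ≤ β) (Λ : Finset (Site d)) (x y : Λ) :
    0 ≤ volumePair J β Λ x y := pairCoupling_nonneg hJ hβ x y

lemma abs_volumeField_le (hJ : Admissible J) {β : ℝ} (hβ : 0 ≤ β) (Λ : Finset (Site d))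
    {τ : Site d → ℝ} (hτ : ∀ y, |τ y| ≤ 1) (x : Λ) :
    |volumeField J β Λ τ x| ≤ volumeField J β Λ (fun _ => 1) x := by
  rw [volumeField, volumeField, abs_mul, abs_of_nonneg hβ]
  refine mul_le_mul_of_nonneg_left ?_ hβ
  have hsum : Summable fun y : {y : Site d // y ∉ Λ} => J x y * 1 := by
    simp only [mul_one]
    exact (hJ.summable_right (x : Site d)).subtype fun y => y ∉ Λ
  refine tsum_of_norm_bounded (f := fun y : {y : Site d // y ∉ Λ} => J x y * τ y) hsum.hasSum
    fun y => ?_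
  rw [Real.norm_eq_abs, abs_mul, abs_of_nonneg (hJ.ferro _ _)]
  exact mul_le_mul_of_nonneg_left (hτ y) (hJ.ferro _ _)

lemma volumeField_one_nonneg (hJ : Admissible J) {β : ℝ} (hβ : 0 ≤ β) (Λ : Finset (Site d))
    (x : Λ) : 0 ≤ volumeField J β Λ (fun _ => 1) x :=
  (abs_nonneg _).trans (abs_volumeField_le hJ hβ Λ (τ := fun _ => 1) (by simp) x)

lemma volumeField_zero (J : Site d → Site d → ℝ) (β : ℝ) (Λ : Finset (Site d)) :
    volumeField J β Λ (fun _ => 0) = 0 := by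
  ext x; simp [volumeField]

lemma boltzmann_volume (J : Site d → Site d → ℝ) (β : ℝ) (Λ : Finset (Site d)) (τ : Site d → ℝ)
    (σ : Λ → ℤˣ) : boltzmann bondChar (bondCoupling (volumePair J β Λ) (volumeField J β Λ τ)) σ
      = Real.exp (-β * hamiltonian J Λ τ σ) := by
  have hpair : ∑ x : Λ, ∑ y : Λ, volumePair J β Λ x y * spin (σ x * σ y)
      = β * ((1 / 2 : ℝ) * ∑ x : Λ, ∑ y : Λ,
        if x = y then 0 else J x y * spin (σ x) * spin (σ y)) := by
    simp only [Finset.mul_sum]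
    refine Finset.sum_congr rfl fun x _ => Finset.sum_congr rfl fun y _ => ?_
    simp only [volumePair, pairCoupling, ← Subtype.ext_iff, spin_mul]
    split_ifs
    · simp
    · ring
  have hfield : ∑ x : Λ, volumeField J β Λ τ x * spin (σ x)
      = β * ∑ x : Λ, ∑' y : {y : Site d // y ∉ Λ}, J x y * spin (σ x) * τ y := by
    rw [Finset.mul_sum]
    refine Finset.sum_congr rfl fun x _ => ?_
    rw [volumeField, mul_assoc, ← tsum_mul_right]
    simp only [mul_right_comm]
  rw [boltzmann, Fintype.sum_sum_type, Fintype.sum_prod_type]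
  simp only [bondCoupling_inl, bondCoupling_inr, bondChar_inl_apply, bondChar_inr_apply]
  rw [hpair, hfield, hamiltonian]
  ring_nf

lemma gibbsExp_eq_isingExpect (J : Site d → Site d → ℝ) (β : ℝ) (Λ : Finset (Site d))
    (τ : Site d → ℝ) (f : (Λ → ℤˣ) → ℝ) :
    gibbsExp J β Λ τ f = isingExpect (volumePair J β Λ) (volumeField J β Λ τ) f := by
  simp only [gibbsExp, isingExpect, expect, boltzmann_volume]

/-- The probability of `σ` in the finite volume Gibbs state in `Λ` with boundary condition `τ`. -/
noncomputable def gibbsProb (J : Site d → Site d → ℝ) (β : ℝ) (Λ : Finset (Site d))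
    (τ : Site d → ℝ) (σ : Λ → ℤˣ) : ℝ :=
  Real.exp (-β * hamiltonian J Λ τ σ) / ∑ ρ : Λ → ℤˣ, Real.exp (-β * hamiltonian J Λ τ ρ)

section GibbsExp

variable (J : Site d → Site d → ℝ) (β : ℝ) (Λ : Finset (Site d)) (τ : Site d → ℝ)

lemma partition_pos : 0 < ∑ σ : Λ → ℤˣ, Real.exp (-β * hamiltonian J Λ τ σ) :=
  Finset.sum_pos (fun _ _ => Real.exp_pos _) ⟨1, Finset.mem_univ _⟩

lemma gibbsProb_nonneg (σ : Λ → ℤˣ) : 0 ≤ gibbsProb J β Λ τ σ :=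
  div_nonneg (Real.exp_pos _).le (partition_pos J β Λ τ).le

lemma sum_gibbsProb : ∑ σ, gibbsProb J β Λ τ σ = 1 := by
  simp only [gibbsProb, ← Finset.sum_div]
  exact div_self (partition_pos J β Λ τ).ne'

lemma gibbsExp_eq_sum (f : (Λ → ℤˣ) → ℝ) : gibbsExp J β Λ τ f = ∑ σ, f σ * gibbsProb J β Λ τ σ := by
  simp only [gibbsExp, gibbsProb, Finset.sum_div, mul_div_assoc]

lemma gibbsExp_mono {f g : (Λ → ℤˣ) → ℝ} (hfg : ∀ σ, f σ ≤ g σ) :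
    gibbsExp J β Λ τ f ≤ gibbsExp J β Λ τ g := by
  rw [gibbsExp_eq_sum, gibbsExp_eq_sum]
  exact Finset.sum_le_sum fun σ _ =>
    mul_le_mul_of_nonneg_right (hfg σ) (gibbsProb_nonneg J β Λ τ σ)

lemma gibbsExp_const (c : ℝ) : gibbsExp J β Λ τ (fun _ => c) = c := by
  rw [gibbsExp_eq_sum, ← Finset.mul_sum, sum_gibbsProb, mul_one]

lemma gibbsExp_sub (f g : (Λ → ℤˣ) → ℝ) :
    gibbsExp J β Λ τ (fun σ => f σ - g σ) = gibbsExp J β Λ τ f - gibbsExp J β Λ τ g := by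
  simp only [gibbsExp_eq_sum, sub_mul, Finset.sum_sub_distrib]

lemma gibbsExp_const_mul (c : ℝ) (f : (Λ → ℤˣ) → ℝ) :
    gibbsExp J β Λ τ (fun σ => c * f σ) = c * gibbsExp J β Λ τ f := by
  simp only [gibbsExp_eq_sum, mul_assoc, Finset.mul_sum]

lemma gibbsExp_sum {ι : Type*} (s : Finset ι) (f : ι → (Λ → ℤˣ) → ℝ) :
    gibbsExp J β Λ τ (fun σ => ∑ i ∈ s, f i σ) = ∑ i ∈ s, gibbsExp J β Λ τ (f i) := by
  simp only [gibbsExp_eq_sum, Finset.sum_mul]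
  exact Finset.sum_comm

lemma gibbsExp_comp_neg (f : (Λ → ℤˣ) → ℝ) :
    gibbsExp J β Λ (fun y => -τ y) (fun σ => f (-σ)) = gibbsExp J β Λ τ f := by
  have hflip (σ : Λ → ℤˣ) : hamiltonian J Λ (fun y => -τ y) σ = hamiltonian J Λ τ (-σ) := by
    simp [hamiltonian]
  simp only [gibbsExp, hflip]
  rw [← Equiv.sum_comp (Equiv.neg (Λ → ℤˣ)) fun σ => f σ * _,
    ← Equiv.sum_comp (Equiv.neg (Λ → ℤˣ)) fun σ => Real.exp (-β * hamiltonian J Λ τ σ)]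
  simp only [Equiv.neg_apply]

end GibbsExp

@[simp] lemma glue_of_mem {Λ : Finset (Site d)} (σ : Λ → ℤˣ) (ω : Config d) {x : Site d}
    (hx : x ∈ Λ) : glue Λ σ ω x = σ ⟨x, hx⟩ := by simp [glue, hx]

@[simp] lemma glue_of_notMem {Λ : Finset (Site d)} (σ : Λ → ℤˣ) (ω : Config d) {x : Site d}
    (hx : x ∉ Λ) : glue Λ σ ω x = ω x := by simp [glue, hx]

end FiniteVolume

section Consistency

variable {d : ℕ} {J : Site d → Site d → ℝ}

/-- The interaction of the sites `x` and `y` in the configuration `ω`. -/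
noncomputable def interaction (J : Site d → Site d → ℝ) (ω : Config d) (x y : Site d) : ℝ :=
  if x = y then 0 else J x y * spin (ω x) * spin (ω y)

lemma interaction_symm (hJ : Admissible J) (ω : Config d) (x y : Site d) :
    interaction J ω x y = interaction J ω y x := by
  simp only [interaction, eq_comm (a := x), hJ.symm x y]
  split_ifs
  · rfl
  · ring

lemma summable_interaction (hJ : Admissible J) (ω : Config d) (x : Site d) :
    Summable (interaction J ω x) := by
  refine Summable.of_norm_bounded (hJ.summable_right x) fun y => ?_
  rw [Real.norm_eq_abs, interaction]
  split_ifs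
  · simpa using hJ.ferro x y
  · rw [abs_mul, abs_mul, abs_spin, abs_spin, mul_one, mul_one, abs_of_nonneg (hJ.ferro x y)]

/-- The energy in the volume `Λ` of a configuration of the whole lattice. -/
noncomputable def energy (J : Site d → Site d → ℝ) (Λ : Finset (Site d)) (ω : Config d) : ℝ :=
  hamiltonian J Λ (fun y => spin (ω y)) fun x => ω x

lemma hamiltonian_eq_energy (J : Site d → Site d → ℝ) (Λ : Finset (Site d)) (ω : Config d)
    (σ : Λ → ℤˣ) : hamiltonian J Λ (fun y => spin (ω y)) σ = energy J Λ (glue Λ σ ω) := by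
  rw [energy, hamiltonian, hamiltonian]
  congr 1
  · simp
  · refine Finset.sum_congr rfl fun x _ => tsum_congr fun y => ?_
    simp [y.2]

lemma energy_eq (hJ : Admissible J) (Λ : Finset (Site d)) (ω : Config d) :
    energy J Λ ω = 1 / 2 * (∑ x ∈ Λ, ∑ y ∈ Λ, interaction J ω x y)
      - ∑ x ∈ Λ, ∑' y, interaction J ω x y := by
  have hinside : (∑ x : Λ, ∑ y : Λ, if x = y then 0 else J x y * spin (ω x) * spin (ω y))
      = ∑ x ∈ Λ, ∑ y ∈ Λ, interaction J ω x y := by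
    simp only [interaction, ← Finset.sum_coe_sort Λ, Subtype.ext_iff]
  have houtside (x : Λ) : ∑' y : {y : Site d // y ∉ Λ}, J x y * spin (ω x) * spin (ω y)
      = ∑' y, interaction J ω x y - ∑ y ∈ Λ, interaction J ω x y := by
    rw [← (summable_interaction hJ ω x).sum_add_tsum_subtype_compl Λ, add_sub_cancel_left]
    refine tsum_congr fun y => ?_
    have hne : (x : Site d) ≠ y := fun h => y.2 (h ▸ x.2)
    simp [interaction, hne]
  rw [energy, hamiltonian, hinside, Finset.sum_congr rfl fun x _ => houtside x,
    Finset.sum_sub_distrib, Finset.sum_coe_sort Λ fun x => ∑' y, interaction J ω x y,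
    Finset.sum_coe_sort Λ fun x => ∑ y ∈ Λ, interaction J ω x y]
  ring

lemma sum_sum_eq_add_of_symm {α : Type*} [DecidableEq α] {s t : Finset α} (h : s ⊆ t)
    {f : α → α → ℝ} (hf : ∀ x y, f x y = f y x) :
    ∑ x ∈ t, ∑ y ∈ t, f x y = ∑ x ∈ t \ s, ∑ y ∈ t \ s, f x y
      + 2 * ∑ x ∈ t \ s, ∑ y ∈ s, f x y + ∑ x ∈ s, ∑ y ∈ s, f x y := by
  have hcross : ∑ x ∈ s, ∑ y ∈ t \ s, f x y = ∑ x ∈ t \ s, ∑ y ∈ s, f x y := by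
    rw [Finset.sum_comm]
    simp only [hf]
  simp only [← Finset.sum_sdiff h, Finset.sum_add_distrib, hcross]
  ring

lemma energy_sub_energy_eq (hJ : Admissible J) {Λ Δ : Finset (Site d)} (h : Λ ⊆ Δ) (ω : Config d) :
    energy J Δ ω - energy J Λ ω = 1 / 2 * (∑ x ∈ Δ \ Λ, ∑ y ∈ Δ \ Λ, interaction J ω x y)
      - ∑ x ∈ Δ \ Λ, ∑' y : {y : Site d // y ∉ Λ}, interaction J ω x y := by
  have htail : ∑ x ∈ Δ \ Λ, ∑' y, interaction J ω x y = ∑ x ∈ Δ \ Λ, ∑ y ∈ Λ, interaction J ω x y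
      + ∑ x ∈ Δ \ Λ, ∑' y : {y : Site d // y ∉ Λ}, interaction J ω x y := by
    rw [← Finset.sum_add_distrib]
    exact Finset.sum_congr rfl fun x _ =>
      ((summable_interaction hJ ω x).sum_add_tsum_subtype_compl Λ).symm
  rw [energy_eq hJ, energy_eq hJ, sum_sum_eq_add_of_symm h (interaction_symm hJ ω),
    ← Finset.sum_sdiff h (f := fun x => ∑' y, interaction J ω x y), htail]
  ring

lemma energy_sub_energy_congr (hJ : Admissible J) {Λ Δ : Finset (Site d)} (h : Λ ⊆ Δ)
    {ω ω' : Config d} (hω : ∀ x, x ∉ Λ → ω x = ω' x) :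
    energy J Δ ω - energy J Λ ω = energy J Δ ω' - energy J Λ ω' := by
  have hint {x y : Site d} (hx : x ∉ Λ) (hy : y ∉ Λ) : interaction J ω x y = interaction J ω' x y :=
    by rw [interaction, interaction, hω x hx, hω y hy]
  rw [energy_sub_energy_eq hJ h, energy_sub_energy_eq hJ h]
  congr 1
  · congr 1
    exact Finset.sum_congr rfl fun x hx => Finset.sum_congr rfl fun y hy =>
      hint (Finset.mem_sdiff.1 hx).2 (Finset.mem_sdiff.1 hy).2
  · exact Finset.sum_congr rfl fun x hx => tsum_congr fun y => hint (Finset.mem_sdiff.1 hx).2 y.2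

/-- The conditional expectation of `F` given the spins of `ω` outside `Λ`. -/
noncomputable def resample (J : Site d → Site d → ℝ) (β : ℝ) (Λ : Finset (Site d))
    (F : Config d → ℝ) (ω : Config d) : ℝ :=
  gibbsExp J β Λ (fun y => spin (ω y)) fun σ => F (glue Λ σ ω)

-- Averaging a function over the orbits of a subgroup, with weights `w`, preserves its `w`-mean.
lemma sum_orbit_average_mul {G H : Type*} [Group G] [Fintype G] [Group H] [Fintype H] (e : H →* G)
    {w : G → ℝ} (hw : ∀ g, 0 < w g) (f : G → ℝ) :
    ∑ g, (∑ u, f (e u * g) * w (e u * g)) / (∑ u, w (e u * g)) * w g = ∑ g, f g * w g := by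
  have horbit (g : G) (v : H) : ∑ u, w (e u * (e v * g)) = ∑ u, w (e u * g) := by
    rw [← Equiv.sum_comp (Equiv.mulRight v) fun u => w (e u * g)]
    simp [mul_assoc]
  have hpos (g : G) : 0 < ∑ u, w (e u * g) :=
    Finset.sum_pos (fun u _ => hw _) ⟨1, Finset.mem_univ _⟩
  calc ∑ g, (∑ u, f (e u * g) * w (e u * g)) / (∑ u, w (e u * g)) * w g
      = ∑ u, ∑ g, f (e u * g) * w (e u * g) / (∑ v, w (e v * (e u * g))) *
          w (e u⁻¹ * (e u * g)) := by
        simp only [horbit, ← mul_assoc (e _⁻¹), ← map_mul, inv_mul_cancel, map_one, one_mul,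
          Finset.sum_div, Finset.sum_mul]
        exact Finset.sum_comm
    _ = ∑ u, ∑ g, f g * w g / (∑ v, w (e v * g)) * w (e u⁻¹ * g) :=
        Finset.sum_congr rfl fun u _ => Equiv.sum_comp (Equiv.mulLeft (e u)) fun g =>
          f g * w g / (∑ v, w (e v * g)) * w (e u⁻¹ * g)
    _ = ∑ g, f g * w g / (∑ v, w (e v * g)) * ∑ u, w (e u⁻¹ * g) := by
        simp only [Finset.mul_sum]
        exact Finset.sum_comm
    _ = ∑ g, f g * w g := by
        refine Finset.sum_congr rfl fun g _ => ?_
        have hinv : ∑ u, w (e u⁻¹ * g) = ∑ u, w (e u * g) :=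
          Equiv.sum_comp (Equiv.inv H) fun u => w (e u * g)
        rw [hinv, div_mul_cancel₀ _ (hpos g).ne']

open Classical in
/-- The extension of the configurations in `Λ` to `Δ` by `1`. -/
noncomputable def extendOne (Λ Δ : Finset (Site d)) : (Λ → ℤˣ) →* (Δ → ℤˣ) where
  toFun u x := if h : (x : Site d) ∈ Λ then u ⟨x, h⟩ else 1
  map_one' := by ext; simp
  map_mul' u v := by
    ext x
    by_cases h : (x : Site d) ∈ Λ <;> simp [h]

lemma glue_extendOne_mul {Λ Δ : Finset (Site d)} (h : Λ ⊆ Δ) (u : Λ → ℤˣ) (σ : Δ → ℤˣ)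
    (ω : Config d) : glue Δ (extendOne Λ Δ u * σ) ω
      = glue Λ (u * fun x : Λ => σ ⟨x, h x.2⟩) (glue Δ σ ω) := by
  ext x
  by_cases hx : x ∈ Λ
  · rw [glue_of_mem _ _ (h hx), glue_of_mem _ _ hx]
    simp [extendOne, hx]
  · rw [glue_of_notMem _ _ hx]
    by_cases hx' : x ∈ Δ
    · rw [glue_of_mem _ _ hx', glue_of_mem _ _ hx']
      simp [extendOne, hx]
    · rw [glue_of_notMem _ _ hx', glue_of_notMem _ _ hx']

lemma resample_glue (hJ : Admissible J) (β : ℝ) {Λ Δ : Finset (Site d)} (h : Λ ⊆ Δ) (η : Config d)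
    (F : Config d → ℝ) (σ : Δ → ℤˣ) :
    resample J β Λ F (glue Δ σ η)
      = (∑ u, F (glue Δ (extendOne Λ Δ u * σ) η) *
          Real.exp (-β * hamiltonian J Δ (fun y => spin (η y)) (extendOne Λ Δ u * σ))) /
        ∑ u, Real.exp (-β * hamiltonian J Δ (fun y => spin (η y)) (extendOne Λ Δ u * σ)) := by
  set ω := glue Δ σ η with hω
  set σ' : Λ → ℤˣ := fun x => σ ⟨x, h x.2⟩ with hσ'
  set C := energy J Δ ω - energy J Λ ω with hC
  have hweight (u : Λ → ℤˣ) :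
      Real.exp (-β * hamiltonian J Δ (fun y => spin (η y)) (extendOne Λ Δ u * σ))
        = Real.exp (-β * C) * Real.exp (-β * hamiltonian J Λ (fun y => spin (ω y)) (u * σ')) := by
    rw [← Real.exp_add, hamiltonian_eq_energy, hamiltonian_eq_energy, glue_extendOne_mul h, ← hω,
      ← hσ', ← mul_add, hC, energy_sub_energy_congr hJ h (ω' := glue Λ (u * σ') ω)
        fun x hx => (glue_of_notMem _ _ hx).symm, sub_add_cancel]
  have hshift (f : (Λ → ℤˣ) → ℝ) : ∑ u, f (u * σ') = ∑ u, f u :=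
    Equiv.sum_comp (Equiv.mulRight σ') f
  simp only [hweight, glue_extendOne_mul h, ← hω, ← hσ', mul_left_comm _ (Real.exp (-β * C)),
    ← Finset.mul_sum]
  rw [mul_div_mul_left _ _ (Real.exp_pos _).ne',
    hshift fun ξ => F (glue Λ ξ ω) * Real.exp (-β * hamiltonian J Λ (fun y => spin (ω y)) ξ),
    hshift fun ξ => Real.exp (-β * hamiltonian J Λ (fun y => spin (ω y)) ξ)]
  rfl

lemma gibbsExp_resample (hJ : Admissible J) (β : ℝ) {Λ Δ : Finset (Site d)} (h : Λ ⊆ Δ)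
    (η : Config d) (F : Config d → ℝ) :
    gibbsExp J β Δ (fun y => spin (η y)) (fun σ => resample J β Λ F (glue Δ σ η))
      = gibbsExp J β Δ (fun y => spin (η y)) fun σ => F (glue Δ σ η) := by
  simp only [gibbsExp, resample_glue hJ β h]
  rw [sum_orbit_average_mul (extendOne Λ Δ)
    (w := fun σ => Real.exp (-β * hamiltonian J Δ (fun y => spin (η y)) σ))
    (fun σ => Real.exp_pos _) fun σ => F (glue Δ σ η)]

end Consistency

/-! ### Infinite-volume limits -/

section SubModel

variable {V W : Type*} [Fintype V] [Fintype W]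

lemma exists_sum_comp_eq_mul {G : Type*} [Group G] [Fintype G] [DecidableEq V] [DecidableEq W]
    {i : V → W} (hi : Function.Injective i) :
    ∃ c : ℝ, 0 < c ∧ ∀ f : (V → G) → ℝ, ∑ σ : W → G, f (σ ∘ i) = c * ∑ s, f s := by
  have hshift (f : (V → G) → ℝ) (u : V → G) :
      ∑ σ : W → G, f (u * (σ ∘ i)) = ∑ σ : W → G, f (σ ∘ i) := by
    rw [← Equiv.sum_comp (Equiv.mulLeft (Function.extend i u 1)) fun σ : W → G => f (σ ∘ i)]
    refine Finset.sum_congr rfl fun σ _ => congrArg f ?_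
    ext x
    simp [hi.extend_apply]
  have hV : (0 : ℝ) < Fintype.card (V → G) := Nat.cast_pos.2 Fintype.card_pos
  refine ⟨Fintype.card (W → G) / Fintype.card (V → G),
    div_pos (Nat.cast_pos.2 Fintype.card_pos) hV, fun f => ?_⟩
  rw [div_mul_eq_mul_div, eq_div_iff hV.ne', mul_comm]
  calc _ = ∑ u : V → G, ∑ σ : W → G, f (u * (σ ∘ i)) := by simp [hshift]
    _ = ∑ σ : W → G, ∑ u : V → G, f (u * (σ ∘ i)) := Finset.sum_comm
    _ = ∑ σ : W → G, ∑ u, f u :=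
      Finset.sum_congr rfl fun σ _ => Equiv.sum_comp (Equiv.mulRight (σ ∘ i)) f
    _ = _ := by simp

variable {i : V → W} {K : V → V → ℝ} {h : V → ℝ} {K' : W → W → ℝ} {h' : W → ℝ}

lemma boltzmann_comp_injective (hi : Function.Injective i) (hK : ∀ x y, K' (i x) (i y) = K x y)
    (hK0 : ∀ a b, (a ∉ Set.range i ∨ b ∉ Set.range i) → K' a b = 0) (hh : ∀ x, h' (i x) = h x)
    (hh0 : ∀ a, a ∉ Set.range i → h' a = 0) (σ : W → ℤˣ) :
    boltzmann bondChar (bondCoupling K' h') σ = boltzmann bondChar (bondCoupling K h) (σ ∘ i) := by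
  rw [boltzmann, boltzmann]
  congr 1
  symm
  refine Finset.sum_of_injOn (Sum.map (Prod.map i i) i)
    ((Sum.map_injective.2 ⟨hi.prodMap hi, hi⟩).injOn) (fun _ _ => by simp) ?_ ?_
  · rintro (⟨a, b⟩ | a) _ hnot
    · have hab : a ∉ Set.range i ∨ b ∉ Set.range i := by
        by_contra! hmem
        obtain ⟨⟨x, rfl⟩, ⟨y, rfl⟩⟩ := hmem
        exact hnot ⟨Sum.inl (x, y), by simp, rfl⟩
      simp [hK0 a b hab]
    · have ha : a ∉ Set.range i := by
        rintro ⟨x, rfl⟩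
        exact hnot ⟨Sum.inr x, by simp, rfl⟩
      simp [hh0 a ha]
  · rintro (⟨x, y⟩ | x) _
    · simp [hK]
    · simp [hh]

lemma isingExpect_comp_injective [DecidableEq V] [DecidableEq W] (hi : Function.Injective i)
    (hK : ∀ x y, K' (i x) (i y) = K x y)
    (hK0 : ∀ a b, (a ∉ Set.range i ∨ b ∉ Set.range i) → K' a b = 0) (hh : ∀ x, h' (i x) = h x)
    (hh0 : ∀ a, a ∉ Set.range i → h' a = 0) (f : (V → ℤˣ) → ℝ) :
    isingExpect K' h' (fun σ => f (σ ∘ i)) = isingExpect K h f := by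
  obtain ⟨c, hc, hsum⟩ := exists_sum_comp_eq_mul (G := ℤˣ) hi
  simp only [isingExpect, expect, boltzmann_comp_injective hi hK hK0 hh hh0]
  rw [hsum fun s => f s * boltzmann bondChar (bondCoupling K h) s, hsum,
    mul_div_mul_left _ _ hc.ne']

lemma pairCorr_comp_le [DecidableEq V] [DecidableEq W] (hi : Function.Injective i)
    (hK' : ∀ a b, 0 ≤ K' a b) (x y : V) :
    pairCorr (fun x y => K' (i x) (i y)) 0 x y ≤ pairCorr K' 0 (i x) (i y) := by
  classical
  let K₀ : W → W → ℝ := fun a b => if a ∈ Set.range i ∧ b ∈ Set.range i then K' a b else 0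
  have hK₀ : ∀ a b, (a ∉ Set.range i ∨ b ∉ Set.range i) → K₀ a b = 0 := fun a b hab =>
    if_neg (not_and_or.2 hab)
  have habs : ∀ j, |bondCoupling K₀ 0 j| ≤ bondCoupling K' 0 j := by
    rintro (⟨a, b⟩ | a)
    · simp only [bondCoupling_inl, K₀]
      split_ifs
      · exact (abs_of_nonneg (hK' a b)).le
      · simpa using hK' a b
    · simp
  calc pairCorr (fun x y => K' (i x) (i y)) 0 x y = pairCorr K₀ 0 (i x) (i y) :=
        (isingExpect_comp_injective hi (fun x y => by simp [K₀]) hK₀ (fun _ => rfl)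
          (fun _ _ => rfl) fun σ => spin (σ x) * spin (σ y)).symm
    _ ≤ pairCorr K' 0 (i x) (i y) := by
        simpa [isingExpect, pairCorr] using
          expect_char_le_of_abs_le bondChar habs (siteChar (i x) * siteChar (i y))

end SubModel

section Translation

variable {d : ℕ} {J : Site d → Site d → ℝ}

/-- The translate of a finite volume. -/
def translate (t : Site d) (Λ : Finset (Site d)) : Finset (Site d) := Λ.map (addRightEmbedding t)

lemma mem_translate {t : Site d} {Λ : Finset (Site d)} {x : Site d} :
    x ∈ translate t Λ ↔ x - t ∈ Λ := by
  simp [translate, ← eq_sub_iff_add_eq]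

lemma add_mem_translate {t : Site d} {Λ : Finset (Site d)} {x : Site d} :
    x + t ∈ translate t Λ ↔ x ∈ Λ := by
  rw [mem_translate, add_sub_cancel_right]

lemma tendsto_translate (t : Site d) : Tendsto (translate t) atTop atTop := by
  refine tendsto_atTop.2 fun Λ => ?_
  filter_upwards [eventually_ge_atTop (translate (-t) Λ)] with Δ hΔ x hx
  refine mem_translate.2 (hΔ (mem_translate.2 ?_))
  simpa using hx

/-- The translation by `t` as a bijection of `Λ` onto its translate. -/
def translateEquiv (t : Site d) (Λ : Finset (Site d)) : Λ ≃ translate t Λ :=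
  (Equiv.addRight t).subtypeEquiv fun _ => add_mem_translate.symm

@[simp] lemma coe_translateEquiv (t : Site d) (Λ : Finset (Site d)) (x : Λ) :
    (translateEquiv t Λ x : Site d) = x + t := rfl

lemma volumeField_translate (hJ : Admissible J) (β c : ℝ) (t : Site d) (Λ : Finset (Site d))
    (x : Λ) : volumeField J β (translate t Λ) (fun _ => c) (translateEquiv t Λ x)
      = volumeField J β Λ (fun _ => c) x := by
  let e : {y : Site d // y ∉ Λ} ≃ {y : Site d // y ∉ translate t Λ} :=
    (Equiv.addRight t).subtypeEquiv fun y => by simp [add_mem_translate]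
  rw [volumeField, volumeField, ← e.tsum_eq]
  congr 1
  refine tsum_congr fun y => ?_
  simp [e, hJ.add_right]

lemma glue_translate (t : Site d) (Λ : Finset (Site d)) (σ : translate t Λ → ℤˣ) :
    glue (translate t Λ) σ 1 = fun x => glue Λ (σ ∘ translateEquiv t Λ) 1 (x - t) := by
  funext x
  by_cases hx : x ∈ translate t Λ
  · rw [glue_of_mem _ _ hx, glue_of_mem _ _ (mem_translate.1 hx)]
    exact congrArg σ (Subtype.ext (sub_add_cancel x t).symm)
  · rw [glue_of_notMem _ _ hx, glue_of_notMem _ _ fun hmem => hx (mem_translate.2 hmem)]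
    rfl

lemma gibbsExp_translate (hJ : Admissible J) (β c : ℝ) (t : Site d) (Λ : Finset (Site d))
    (F : Config d → ℝ) :
    gibbsExp J β (translate t Λ) (fun _ => c) (fun σ => F (glue (translate t Λ) σ 1))
      = gibbsExp J β Λ (fun _ => c) fun σ => F fun x => glue Λ σ 1 (x - t) := by
  have hrange (a : translate t Λ) : a ∈ Set.range (translateEquiv t Λ) :=
    (translateEquiv t Λ).surjective a
  simp only [glue_translate, gibbsExp_eq_isingExpect]
  exact isingExpect_comp_injective (translateEquiv t Λ).injective
    (fun x y => pairCoupling_add_right hJ β x y t)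
    (fun a b hab => (hab.elim (· (hrange a)) (· (hrange b))).elim)
    (volumeField_translate hJ β c t Λ) (fun a ha => (ha (hrange a)).elim)
    fun s => F fun x => glue Λ s 1 (x - t)

end Translation

section PlusState

variable {d : ℕ} {J : Site d → Site d → ℝ} {β : ℝ}

/-- The magnetization at `x` in the volume `Λ` with plus boundary condition. -/
noncomputable def plusSite (J : Site d → Site d → ℝ) (β : ℝ) (Λ : Finset (Site d)) (x : Site d) :
    ℝ :=
  gibbsExp J β Λ (fun _ => 1) fun σ => spin (glue Λ σ 1 x)

lemma plusSite_of_mem (J : Site d → Site d → ℝ) (β : ℝ) {Λ : Finset (Site d)} (x : Λ) :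
    plusSite J β Λ x
      = isingExpect (volumePair J β Λ) (volumeField J β Λ fun _ => 1) fun σ => spin (σ x) := by
  simp only [plusSite, glue_of_mem _ _ x.2, gibbsExp_eq_isingExpect]

lemma plusSite_of_notMem (J : Site d → Site d → ℝ) (β : ℝ) {Λ : Finset (Site d)} {x : Site d}
    (hx : x ∉ Λ) : plusSite J β Λ x = 1 := by
  simp only [plusSite, glue_of_notMem _ _ hx, Pi.one_apply, spin_one, gibbsExp_const]

lemma abs_bondCoupling_volume_le (hJ : Admissible J) (hβ : 0 ≤ β) (Λ : Finset (Site d))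
    {τ : Site d → ℝ} (hτ : ∀ y, |τ y| ≤ 1) :
    ∀ i, |bondCoupling (volumePair J β Λ) (volumeField J β Λ τ) i|
      ≤ bondCoupling (volumePair J β Λ) (volumeField J β Λ fun _ => 1) i
  | Sum.inl p => (abs_of_nonneg (volumePair_nonneg hJ hβ Λ p.1 p.2)).le
  | Sum.inr x => abs_volumeField_le hJ hβ Λ hτ x

lemma gibbsExp_site_le_plusSite (hJ : Admissible J) (hβ : 0 ≤ β) {Λ : Finset (Site d)}
    {τ : Site d → ℝ} (hτ : ∀ y, |τ y| ≤ 1) (x : Λ) :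
    gibbsExp J β Λ τ (fun σ => spin (σ x)) ≤ plusSite J β Λ x := by
  rw [plusSite_of_mem, gibbsExp_eq_isingExpect]
  exact expect_char_le_of_abs_le bondChar (abs_bondCoupling_volume_le hJ hβ Λ hτ) (siteChar x)

lemma plusSite_le_one (J : Site d → Site d → ℝ) (β : ℝ) (Λ : Finset (Site d)) (x : Site d) :
    plusSite J β Λ x ≤ 1 :=
  (gibbsExp_mono J β Λ _ fun _ => spin_le_one _).trans_eq (gibbsExp_const J β Λ _ 1)

lemma volume_bondCoupling_nonneg (hJ : Admissible J) (hβ : 0 ≤ β) (Λ : Finset (Site d)) :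
    ∀ i, 0 ≤ bondCoupling (volumePair J β Λ) (volumeField J β Λ fun _ => 1) i :=
  bondCoupling_nonneg (volumePair_nonneg hJ hβ Λ) (volumeField_one_nonneg hJ hβ Λ)

lemma plusSite_nonneg (hJ : Admissible J) (hβ : 0 ≤ β) (Λ : Finset (Site d)) (x : Site d) :
    0 ≤ plusSite J β Λ x := by
  by_cases hx : x ∈ Λ
  · rw [plusSite_of_mem J β ⟨x, hx⟩]
    exact expect_char_nonneg bondChar (volume_bondCoupling_nonneg hJ hβ Λ) (siteChar ⟨x, hx⟩)
  · rw [plusSite_of_notMem J β hx]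
    exact zero_le_one

-- Resampling the smaller volume, its random boundary spins are dominated by plus spins.
lemma plusSite_antitone (hJ : Admissible J) (hβ : 0 ≤ β) (x : Site d) :
    Antitone fun Λ => plusSite J β Λ x := by
  intro Λ Δ hΛΔ
  by_cases hx : x ∈ Λ
  · have hone : (fun y => spin ((1 : Config d) y)) = fun _ => 1 := by ext; simp
    have hresample := gibbsExp_resample hJ β hΛΔ 1 fun ω => spin (ω x)
    rw [hone] at hresample
    calc plusSite J β Δ x = _ := hresample.symm
      _ ≤ gibbsExp J β Δ (fun _ => 1) fun _ => plusSite J β Λ x := by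
        refine gibbsExp_mono J β Δ _ fun σ => ?_
        simp only [resample, glue_of_mem _ _ hx]
        exact gibbsExp_site_le_plusSite hJ hβ (fun y => (abs_spin _).le) ⟨x, hx⟩
      _ = plusSite J β Λ x := gibbsExp_const J β Δ _ _
  · simp only [plusSite_of_notMem J β hx]
    exact plusSite_le_one J β Δ x

lemma plusSite_translate (hJ : Admissible J) (β : ℝ) (t : Site d) (Λ : Finset (Site d))
    (x : Site d) : plusSite J β (translate t Λ) (x + t) = plusSite J β Λ x := by
  rw [plusSite, gibbsExp_translate hJ β 1 t Λ fun ω => spin (ω (x + t)), plusSite]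
  simp

lemma tendsto_plusSite (hJ : Admissible J) (hβ : 0 ≤ β) (x : Site d) :
    Tendsto (fun Λ => plusSite J β Λ x) atTop (nhds (spontaneousMagnetization J β)) := by
  have hlim (x : Site d) : Tendsto (fun Λ => plusSite J β Λ x) atTop
      (nhds (⨅ Λ, plusSite J β Λ x)) :=
    tendsto_atTop_ciInf (plusSite_antitone hJ hβ x)
      ⟨0, by rintro _ ⟨Λ, rfl⟩; exact plusSite_nonneg hJ hβ Λ x⟩
  have hzero : spontaneousMagnetization J β = ⨅ Λ, plusSite J β Λ 0 := (hlim 0).limUnder_eq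
  have htransl : (fun Λ => plusSite J β Λ x) ∘ translate x = fun Λ => plusSite J β Λ 0 := by
    ext Λ
    simpa using plusSite_translate hJ β x Λ 0
  rw [hzero, tendsto_nhds_unique (hlim 0) (htransl ▸ (hlim x).comp (tendsto_translate x))]
  exact hlim x

lemma spontaneousMagnetization_le (hJ : Admissible J) (hβ : 0 ≤ β) (Λ : Finset (Site d))
    (x : Site d) : spontaneousMagnetization J β ≤ plusSite J β Λ x :=
  (plusSite_antitone hJ hβ x).le_of_tendsto (tendsto_plusSite hJ hβ x) Λ

lemma spontaneousMagnetization_nonneg (hJ : Admissible J) (hβ : 0 ≤ β) :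
    0 ≤ spontaneousMagnetization J β :=
  ge_of_tendsto' (tendsto_plusSite hJ hβ 0) fun Λ => plusSite_nonneg hJ hβ Λ 0

lemma sq_spontaneousMagnetization_le (hJ : Admissible J) (hβ : 0 ≤ β) {Λ : Finset (Site d)}
    (x y : Λ) : spontaneousMagnetization J β ^ 2
      ≤ pairCorr (volumePair J β Λ) (volumeField J β Λ fun _ => 1) x y := by
  have hm := spontaneousMagnetization_nonneg hJ hβ
  have hle (x : Λ) := spontaneousMagnetization_le hJ hβ Λ x
  calc spontaneousMagnetization J β ^ 2 ≤ plusSite J β Λ x * plusSite J β Λ y := by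
        rw [sq]
        exact mul_le_mul (hle x) (hle y) hm (hm.trans (hle x))
    _ ≤ _ := by
        rw [plusSite_of_mem, plusSite_of_mem]
        exact expect_mul_expect_le bondChar (volume_bondCoupling_nonneg hJ hβ Λ) (siteChar x)
          (siteChar y)

end PlusState

section FreeState

variable {d : ℕ} {J : Site d → Site d → ℝ} {β : ℝ}

/-- The correlation of `x` and `y` in the volume `Λ` with free boundary condition. -/
noncomputable def freePair (J : Site d → Site d → ℝ) (β : ℝ) (Λ : Finset (Site d)) (x y : Site d) :
    ℝ := gibbsExp J β Λ (fun _ => 0) fun σ => spin (glue Λ σ 1 x) * spin (glue Λ σ 1 y)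

lemma freePair_eq_pairCorr (J : Site d → Site d → ℝ) (β : ℝ) {Λ : Finset (Site d)} (x y : Λ) :
    freePair J β Λ x y = pairCorr (volumePair J β Λ) 0 x y := by
  rw [freePair, gibbsExp_eq_isingExpect, volumeField_zero, pairCorr]
  simp only [glue_of_mem _ _ x.2, glue_of_mem _ _ y.2]

lemma freePair_mono (hJ : Admissible J) (hβ : 0 ≤ β) {Λ Δ : Finset (Site d)} (hΛΔ : Λ ⊆ Δ)
    {x y : Site d} (hx : x ∈ Λ) (hy : y ∈ Λ) : freePair J β Λ x y ≤ freePair J β Δ x y := by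
  let i : Λ → Δ := fun v => ⟨v, hΛΔ v.2⟩
  have hi : Function.Injective i := fun v w hvw => Subtype.ext (congrArg (fun u : Δ => u.1) hvw)
  calc freePair J β Λ x y = pairCorr (volumePair J β Λ) 0 ⟨x, hx⟩ ⟨y, hy⟩ :=
        freePair_eq_pairCorr J β ⟨x, hx⟩ ⟨y, hy⟩
    _ ≤ pairCorr (volumePair J β Δ) 0 (i ⟨x, hx⟩) (i ⟨y, hy⟩) :=
        pairCorr_comp_le hi (volumePair_nonneg hJ hβ Δ) _ _
    _ = freePair J β Δ x y := (freePair_eq_pairCorr J β _ _).symm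

lemma freePair_le_one (J : Site d → Site d → ℝ) (β : ℝ) (Λ : Finset (Site d)) (x y : Site d) :
    freePair J β Λ x y ≤ 1 := by
  refine (gibbsExp_mono J β Λ _ fun σ => ?_).trans_eq (gibbsExp_const J β Λ _ 1)
  rw [← spin_mul]
  exact spin_le_one _

/-- The correlation `⟨σ_x σ_y⟩⁰` in the free state. -/
noncomputable def freeCorr (J : Site d → Site d → ℝ) (β : ℝ) (x y : Site d) : ℝ :=
  freeExp J β fun ω => spin (ω x) * spin (ω y)

lemma tendsto_freePair (hJ : Admissible J) (hβ : 0 ≤ β) (x y : Site d) :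
    Tendsto (fun Λ => freePair J β Λ x y) atTop (nhds (freeCorr J β x y)) := by
  have hmono : Monotone fun Λ : Finset (Site d) => freePair J β (Λ ∪ {x, y}) x y :=
    fun Λ Δ h => freePair_mono hJ hβ (Finset.union_subset_union_left h) (by simp) (by simp)
  have hlim := tendsto_atTop_ciSup hmono
    ⟨1, by rintro _ ⟨Λ, rfl⟩; exact freePair_le_one J β _ x y⟩
  refine tendsto_nhds_limUnder ⟨_, hlim.congr' ?_⟩
  filter_upwards [eventually_ge_atTop {x, y}] with Λ hΛ
  rw [Finset.union_eq_left.2 hΛ]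

lemma freePair_le_freeCorr (hJ : Admissible J) (hβ : 0 ≤ β) {Λ : Finset (Site d)} {x y : Site d}
    (hx : x ∈ Λ) (hy : y ∈ Λ) : freePair J β Λ x y ≤ freeCorr J β x y :=
  ge_of_tendsto (tendsto_freePair hJ hβ x y)
    (by filter_upwards [eventually_ge_atTop Λ] with Δ hΔ using freePair_mono hJ hβ hΔ hx hy)

lemma freeCorr_add_right (hJ : Admissible J) (hβ : 0 ≤ β) (x y t : Site d) :
    freeCorr J β (x + t) (y + t) = freeCorr J β x y := by
  have htransl : (fun Λ => freePair J β Λ (x + t) (y + t)) ∘ translate t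
      = fun Λ => freePair J β Λ x y := by
    ext Λ
    rw [Function.comp_apply, freePair,
      gibbsExp_translate hJ β 0 t Λ fun ω => spin (ω (x + t)) * spin (ω (y + t)), freePair]
    simp
  exact tendsto_nhds_unique
    (htransl ▸ (tendsto_freePair hJ hβ (x + t) (y + t)).comp (tendsto_translate t))
    (tendsto_freePair hJ hβ x y)

end FreeState

section Pullback

variable {V W : Type*} {K : V → V → ℝ} {f : W → V} {B : Finset V}

lemma BlockConnected.preimage (hB : BlockConnected K B) (hf : Function.Injective f)
    (hrange : ∀ b ∈ B, b ∈ Set.range f) :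
    BlockConnected (fun x y => K (f x) (f y)) (B.preimage f hf.injOn) := by
  intro x hx y hy
  have : Nonempty W := ⟨x⟩
  rw [Finset.mem_preimage] at hx hy
  refine Quot.eqvGen_exact ?_
  have h := apply_eq_of_eqvGen (f := fun v => Quot.mk (fun a b => a ∈ B.preimage f hf.injOn ∧
    b ∈ B.preimage f hf.injOn ∧ 0 < K (f a) (f b)) (Function.invFun f v)) (fun a b hab => ?_)
    (hB _ hx _ hy)
  · simpa only [Function.leftInverse_invFun hf _] using h
  · obtain ⟨a, rfl⟩ := hrange a hab.1
    obtain ⟨b, rfl⟩ := hrange b hab.2.1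
    simp only [Function.leftInverse_invFun hf _]
    exact Quot.sound (by simpa only [Finset.mem_preimage] using hab)

lemma blockConst_preimage (K : V → V → ℝ) (hf : Function.Injective f)
    (hrange : ∀ b ∈ B, b ∈ Set.range f) :
    blockConst (fun x y => K (f x) (f y)) (B.preimage f hf.injOn) = blockConst K B := by
  have hprod (g : V → ℝ) : ∏ x ∈ B.preimage f hf.injOn, g (f x) = ∏ x ∈ B, g x :=
    Finset.prod_preimage f B hf.injOn g fun b hb hb' => absurd (hrange b hb) hb'
  simp only [blockConst]
  rw [← hprod]
  exact Finset.prod_congr rfl fun x _ =>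
    hprod fun y => if 0 < K (f x) y then insertConst (2 * K (f x) y) / 4 else 1

end Pullback

section Magnetization

variable {d : ℕ} {J : Site d → Site d → ℝ} {β : ℝ} {w : ℕ → Site d} {n : ℕ} {p : ℝ}

lemma le_clusterProb_connField (hJ : Admissible J) (hβ : 0 ≤ β) (hw0 : w 0 = 0)
    (hw : ∀ i < n, 0 < pairCoupling J β (w i) (w (i + 1)))
    (hp : p * (pathConst (pairCoupling J β) w n + 1)
      ≤ spontaneousMagnetization J β ^ 2 - freeCorr J β 0 (w n))
    {Λ : Finset (Site d)} (x : Λ) (hΛ : ∀ i ≤ n, w i + x ∈ Λ) :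
    p ≤ clusterProb (volumePair J β Λ) (volumeField J β Λ fun _ => 1) {ω | ConnField ω x} := by
  have hK := volumePair_nonneg hJ hβ Λ
  have hh := volumeField_one_nonneg hJ hβ Λ
  let u (i : ℕ) : Λ := ⟨w (min i n) + x, hΛ _ (min_le_right i n)⟩
  have hu0 : u 0 = x := Subtype.ext (by simp [u, hw0])
  have hcoupling : ∀ i < n, volumePair J β Λ (u i) (u (i + 1))
      = pairCoupling J β (w i) (w (i + 1)) := fun i hi => by
    simp only [volumePair, u, pairCoupling_add_right hJ, min_eq_left hi.le,
      min_eq_left (Nat.succ_le_of_lt hi)]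
  have hconst : pathConst (volumePair J β Λ) u n = pathConst (pairCoupling J β) w n := by
    rw [pathConst, pathConst, Finset.prod_congr rfl fun i hi => by
      rw [hcoupling i (Finset.mem_range.1 hi)]]
  have hgap := pairCorr_sub_pairCorr_zero_le_pathConst_mul hK hh
    fun i hi => (hw i hi).trans_eq (hcoupling i hi).symm
  rw [hu0, hconst] at hgap
  have hplus := sq_spontaneousMagnetization_le hJ hβ x (u n)
  have hfree : pairCorr (volumePair J β Λ) 0 x (u n) ≤ freeCorr J β 0 (w n) := by
    rw [← freePair_eq_pairCorr, ← freeCorr_add_right hJ hβ 0 (w n) x, zero_add]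
    simpa only [u, min_self] using freePair_le_freeCorr hJ hβ x.2 (u n).2
  have hM := pathConst_nonneg hw
  have hP := clusterProb_nonneg hK hh {ω | ConnField ω x}
  refine le_of_mul_le_mul_right ?_ (add_pos_of_nonneg_of_pos hM one_pos)
  linarith

lemma sub_val_injective (Λ : Finset (Site d)) (a : Site d) :
    Function.Injective fun v : Λ => v.1 - a :=
  sub_left_injective.comp Subtype.val_injective

/-- The translate `B + a` as a set of sites of the volume `Λ`. -/
noncomputable def translateIn (Λ : Finset (Site d)) (a : Site d) (B : Finset (Site d)) : Finset Λ :=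
  B.preimage (fun v => v.1 - a) (sub_val_injective Λ a).injOn

variable {Λ S B : Finset (Site d)} {a : Site d}

lemma mem_translateIn {v : Λ} : v ∈ translateIn Λ a B ↔ v.1 - a ∈ B := Finset.mem_preimage

lemma exists_sub_eq (h : translate a B ⊆ Λ) :
    ∀ b ∈ B, b ∈ Set.range fun v : Λ => v.1 - a := fun b hb =>
  ⟨⟨b + a, h (add_mem_translate.2 hb)⟩, add_sub_cancel_right b a⟩

lemma sum_translateIn (h : translate a B ⊆ Λ) (g : Site d → ℝ) :
    ∑ v ∈ translateIn Λ a B, g (v.1 - a) = ∑ x ∈ B, g x :=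
  Finset.sum_preimage _ B (sub_val_injective Λ a).injOn g fun b hb hb' =>
    absurd (exists_sub_eq h b hb) hb'

lemma card_translateIn (h : translate a B ⊆ Λ) : ((translateIn Λ a B).card : ℝ) = B.card := by
  simpa using sum_translateIn h 1

lemma volumePair_eq_sub (hJ : Admissible J) (β : ℝ) (Λ : Finset (Site d)) (a : Site d) :
    volumePair J β Λ = fun v w => pairCoupling J β (v.1 - a) (w.1 - a) := by
  ext v w
  simp only [sub_eq_add_neg, pairCoupling_add_right hJ, volumePair]

lemma blockConnected_translateIn (hJ : Admissible J)
    (hB : BlockConnected (pairCoupling J β) B) (h : translate a B ⊆ Λ) :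
    BlockConnected (volumePair J β Λ) (translateIn Λ a B) := by
  rw [volumePair_eq_sub hJ β Λ a]
  exact hB.preimage (sub_val_injective Λ a) (exists_sub_eq h)

lemma blockConst_translateIn (hJ : Admissible J) (β : ℝ) (h : translate a B ⊆ Λ) :
    blockConst (volumePair J β Λ) (translateIn Λ a B) = blockConst (pairCoupling J β) B := by
  rw [volumePair_eq_sub hJ β Λ a]
  exact blockConst_preimage _ (sub_val_injective Λ a) (exists_sub_eq h)

lemma sum_pairCorr_translateIn_le (hJ : Admissible J) (hβ : 0 ≤ β) (h : translate a S ⊆ Λ) :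
    ∑ v ∈ translateIn Λ a S, ∑ w ∈ translateIn Λ a S, pairCorr (volumePair J β Λ) 0 v w
      ≤ ∑ x ∈ S, ∑ y ∈ S, freeCorr J β x y := by
  have hcorr (v w : Λ) :
      pairCorr (volumePair J β Λ) 0 v w ≤ freeCorr J β (v.1 - a) (w.1 - a) := by
    rw [← freePair_eq_pairCorr, ← freeCorr_add_right hJ hβ (v.1 - a) (w.1 - a) a]
    simpa only [sub_add_cancel] using freePair_le_freeCorr hJ hβ v.2 w.2
  rw [← sum_translateIn h]
  refine Finset.sum_le_sum fun v _ => ?_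
  rw [← sum_translateIn h]
  exact Finset.sum_le_sum fun w _ => hcorr v w

/-- The total coupling of the volume `Λ` with its complement, which is the total field produced in
`Λ` by the plus boundary condition at `β = 1`. -/
noncomputable def boundaryCoupling (J : Site d → Site d → ℝ) (Λ : Finset (Site d)) : ℝ :=
  ∑ x ∈ Λ, ∑' y : {y : Site d // y ∉ Λ}, J x y

lemma card_mul_le_boundaryCoupling (hJ : Admissible J) (hβ : 0 ≤ β) (hS : S.Nonempty) (hSB : S ⊆ B)
    (hB : BlockConnected (pairCoupling J β) B) (hw0 : w 0 = 0)
    (hw : ∀ i < n, 0 < pairCoupling J β (w i) (w (i + 1))) (hwB : ∀ x ∈ S, ∀ i ≤ n, w i + x ∈ B)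
    (hp : 0 < p) (hgap : p * (pathConst (pairCoupling J β) w n + 1)
      ≤ spontaneousMagnetization J β ^ 2 - freeCorr J β 0 (w n))
    (hpair : ∑ x ∈ S, ∑ y ∈ S, freeCorr J β x y ≤ p ^ 2 / 4 * (S.card : ℝ) ^ 2)
    {A : Finset (Site d)} (hA : ∀ a ∈ A, translate a B ⊆ Λ)
    (hdisj : (A : Set (Site d)).PairwiseDisjoint fun a => translate a B) :
    A.card * (blockConst (pairCoupling J β) B * (p / 4))
      ≤ β * boundaryCoupling J Λ := by
  have hAS : ∀ a ∈ A, translate a S ⊆ Λ := fun a ha v hv =>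
    hA a ha (mem_translate.2 (hSB (mem_translate.1 hv)))
  have hfield : ∑ x, volumeField J β Λ (fun _ => 1) x
      = β * boundaryCoupling J Λ := by
    rw [boundaryCoupling, ← Finset.sum_coe_sort Λ, Finset.mul_sum]
    simp only [volumeField, mul_one]
  rw [← hfield]
  refine card_mul_le_sum_field (volumePair_nonneg hJ hβ Λ) (volumeField_one_nonneg hJ hβ Λ)
    (S := fun a => translateIn Λ a S) (B := fun a => translateIn Λ a B)
    (fun a _ v hv => mem_translateIn.2 (hSB (mem_translateIn.1 hv))) (fun a ha => ?_)
    (fun a ha => blockConnected_translateIn hJ hB (hA a ha)) (fun a ha b hb hab => ?_)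
    (fun a ha => (blockConst_translateIn hJ β (hA a ha)).ge) hp (fun a ha v hv => ?_)
    fun a ha => ?_
  · rw [← Finset.card_pos, ← Nat.cast_pos (α := ℝ), card_translateIn (hAS a ha)]
    exact_mod_cast hS.card_pos
  · exact Finset.disjoint_left.2 fun v hva hvb => Finset.disjoint_left.1 (hdisj ha hb hab)
      (mem_translate.2 (mem_translateIn.1 hva)) (mem_translate.2 (mem_translateIn.1 hvb))
  · refine le_clusterProb_connField hJ hβ hw0 hw hgap v fun i hi => ?_
    have hmem := hA a ha (add_mem_translate.2 (hwB _ (mem_translateIn.1 hv) i hi))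
    rwa [add_assoc, sub_add_cancel] at hmem
  · rw [card_translateIn (hAS a ha)]
    exact (sum_pairCorr_translateIn_le hJ hβ (hAS a ha)).trans hpair

end Magnetization

/-! ### Absence of magnetization without long-range order -/

section Cubes

variable {d : ℕ} {J : Site d → Site d → ℝ} {β : ℝ}

/-- The cube `[0, N)^d`. -/
noncomputable def cube (d N : ℕ) : Finset (Site d) := Fintype.piFinset fun _ => Finset.Ico (0 : ℤ) N

lemma mem_cube {N : ℕ} {x : Site d} : x ∈ cube d N ↔ ∀ i, 0 ≤ x i ∧ x i < N := by
  simp [cube]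

lemma card_cube (N : ℕ) : (cube d N).card = N ^ d := by
  simp [cube]

/-- The number of sites of the cube `[0, N)^d` that the translation by `v` moves out of it. -/
noncomputable def exitCount (N : ℕ) (v : Site d) : ℕ := {x ∈ cube d N | x + v ∉ cube d N}.card

lemma exitCount_le (N : ℕ) (v : Site d) : exitCount N v ≤ N ^ d :=
  (Finset.card_filter_le _ _).trans_eq (card_cube N)

lemma prod_sub_abs_le_card {N : ℕ} {v : Site d} (hN : ∀ i, |v i| ≤ N) :
    ∏ i, ((N : ℝ) - |(v i : ℝ)|) ≤ {x ∈ cube d N | x + v ∈ cube d N}.card := by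
  have hbox : (Fintype.piFinset fun i => Finset.Ico (max 0 (-v i)) (min (N : ℤ) (N - v i)))
      ⊆ {x ∈ cube d N | x + v ∈ cube d N} := by
    intro x hx
    simp only [Fintype.mem_piFinset, Finset.mem_Ico] at hx
    simp only [Finset.mem_filter, mem_cube, Pi.add_apply]
    exact ⟨fun i => by have := hx i; omega, fun i => by have := hx i; omega⟩
  refine le_trans ?_ (Nat.cast_le.2 (Finset.card_le_card hbox))
  rw [Fintype.card_piFinset, Nat.cast_prod]
  refine Finset.prod_le_prod (fun i _ => sub_nonneg.2 (by exact_mod_cast hN i)) fun i _ => ?_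
  have hside : (N : ℤ) - |v i| ≤ ((min (N : ℤ) (N - v i) - max 0 (-v i)).toNat : ℤ) := by
    have := hN i
    rw [Int.abs_eq_natAbs] at this ⊢
    omega
  rw [Int.card_Ico]
  exact_mod_cast hside

lemma exitCount_div_le {N : ℕ} (hpos : 0 < N) {v : Site d} (hN : ∀ i, |v i| ≤ N) :
    (exitCount N v : ℝ) / (N : ℝ) ^ d ≤ 1 - ∏ i, (1 - |(v i : ℝ)| / (N : ℝ)) := by
  have hN0 : (0 : ℝ) < N := Nat.cast_pos.2 hpos
  have hcard : ({x ∈ cube d N | x + v ∈ cube d N}.card : ℝ) + exitCount N v = (N : ℝ) ^ d := by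
    exact_mod_cast (Finset.card_filter_add_card_filter_not _).trans (card_cube N)
  have hprod : ∏ i, (1 - |(v i : ℝ)| / (N : ℝ)) = (∏ i, ((N : ℝ) - |(v i : ℝ)|)) / (N : ℝ) ^ d := by
    rw [← Fin.prod_const d (N : ℝ), ← Finset.prod_div_distrib]
    exact Finset.prod_congr rfl fun i _ => by rw [sub_div, div_self hN0.ne']
  rw [hprod, div_le_iff₀ (pow_pos hN0 d), sub_mul, div_mul_cancel₀ _ (pow_pos hN0 d).ne']
  linarith [prod_sub_abs_le_card hN]

lemma tendsto_exitCount (v : Site d) :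
    Tendsto (fun N : ℕ => (exitCount N v : ℝ) / (N : ℝ) ^ d) atTop (nhds 0) := by
  have hlim : Tendsto (fun N : ℕ => 1 - ∏ i, (1 - |(v i : ℝ)| / (N : ℝ))) atTop (nhds 0) := by
    have hprod := tendsto_finsetProd (Finset.univ : Finset (Fin d)) fun i _ =>
      (tendsto_const_nhds (x := (1 : ℝ))).sub (tendsto_const_div_atTop_nhds_zero_nat |(v i : ℝ)|)
    simpa using (tendsto_const_nhds (x := (1 : ℝ))).sub hprod
  have hlarge : ∀ᶠ N : ℕ in atTop, ∀ i, |v i| ≤ N := eventually_all.2 fun i => by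
    filter_upwards [eventually_ge_atTop (v i).natAbs] with N hN
    rw [Int.abs_eq_natAbs]
    exact_mod_cast hN
  refine tendsto_of_tendsto_of_tendsto_of_le_of_le' tendsto_const_nhds hlim
    (Eventually.of_forall fun N => by positivity) ?_
  filter_upwards [hlarge, eventually_gt_atTop 0] with N hN hpos using exitCount_div_le hpos hN

lemma tsum_notMem_eq (hJ : Admissible J) (Λ : Finset (Site d)) (x : Site d) :
    ∑' y : {y : Site d // y ∉ Λ}, J x y = ∑' v, if x + v ∉ Λ then J 0 v else 0 := by
  have hind : ∑' y : {y : Site d // y ∉ Λ}, J x y = ∑' y, Set.indicator {y | y ∉ Λ} (J x) y :=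
    tsum_subtype {y | y ∉ Λ} (J x)
  rw [hind, ← (Equiv.addLeft x).tsum_eq]
  refine tsum_congr fun v => ?_
  rw [Set.indicator_apply, Equiv.coe_addLeft, hJ.transl x, add_sub_cancel_left]
  rfl

lemma boundaryCoupling_cube (hJ : Admissible J) (N : ℕ) :
    boundaryCoupling J (cube d N) = ∑' v, J 0 v * exitCount N v := by
  have hsummable : ∀ x ∈ cube d N, Summable fun v => if x + v ∉ cube d N then J 0 v else 0 :=
    fun x _ => hJ.summable.of_nonneg_of_le
      (fun v => by split_ifs <;> [exact le_rfl; exact hJ.ferro 0 v])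
      (fun v => by split_ifs <;> [exact hJ.ferro 0 v; exact le_rfl])
  rw [boundaryCoupling, Finset.sum_congr rfl fun x _ => tsum_notMem_eq hJ _ x,
    ← Summable.tsum_finsetSum hsummable]
  refine tsum_congr fun v => ?_
  rw [← Finset.sum_filter, Finset.sum_const, nsmul_eq_mul, mul_comm, exitCount]

lemma tendsto_boundaryCoupling_cube (hJ : Admissible J) :
    Tendsto (fun N : ℕ => boundaryCoupling J (cube d N) / (N : ℝ) ^ d) atTop (nhds 0) := by
  have hsum (N : ℕ) : boundaryCoupling J (cube d N) / (N : ℝ) ^ d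
      = ∑' v, J 0 v * (exitCount N v / (N : ℝ) ^ d) := by
    rw [boundaryCoupling_cube hJ, ← tsum_div_const]
    exact tsum_congr fun v => mul_div_assoc _ _ _
  have hlim := tendsto_tsum_of_dominated_convergence (𝓕 := atTop)
    (f := fun (N : ℕ) v => J 0 v * (exitCount N v / (N : ℝ) ^ d)) hJ.summable
    (fun v => (tendsto_exitCount v).const_mul (J 0 v))
    (Eventually.of_forall fun N v => by
      have hle : (exitCount N v : ℝ) / (N : ℝ) ^ d ≤ 1 :=
        div_le_one_of_le₀ (by exact_mod_cast exitCount_le N v) (by positivity)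
      rw [Real.norm_of_nonneg (mul_nonneg (hJ.ferro 0 v) (by positivity))]
      exact mul_le_of_le_one_right (hJ.ferro 0 v) hle)
  simpa only [hsum, mul_zero, tsum_zero] using hlim

lemma nonpos_of_forall_pow_mul_le (hJ : Admissible J) {L : ℕ} (hL : 0 < L) {q : ℝ}
    (hbound : ∀ n : ℕ, (n : ℝ) ^ d * q ≤ β * boundaryCoupling J (cube d (n * L))) : q ≤ 0 := by
  have hLd : (0 : ℝ) < (L : ℝ) ^ d := pow_pos (Nat.cast_pos.2 hL) d
  have hlim : Tendsto (fun n : ℕ => β * (boundaryCoupling J (cube d (n * L)) /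
      ((n * L : ℕ) : ℝ) ^ d)) atTop (nhds (β * 0)) :=
    ((tendsto_boundaryCoupling_cube hJ).comp (tendsto_id.atTop_mul_const' hL)).const_mul β
  have hle : q / (L : ℝ) ^ d ≤ β * 0 := by
    refine ge_of_tendsto hlim ?_
    filter_upwards [eventually_gt_atTop 0] with n hn
    have hnd : (0 : ℝ) < (n : ℝ) ^ d := pow_pos (Nat.cast_pos.2 hn) d
    rw [← mul_div_assoc, Nat.cast_mul, mul_pow, div_le_div_iff₀ hLd (mul_pos hnd hLd),
      ← mul_assoc, mul_comm q]
    exact mul_le_mul_of_nonneg_right (hbound n) hLd.le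
  rwa [mul_zero, div_le_iff₀ hLd, zero_mul] at hle

/-- The points of the lattice of spacing `2k + 1` that tile `ℤ^d` by cubes of radius `k` around
them. -/
def gridPoint (k : ℕ) (t : Site d) : Site d := fun i => (2 * k + 1) * t i + k

lemma add_gridPoint_ediv {k : ℕ} {b : Site d} (hb : ∀ i, |b i| ≤ k) (t : Site d) (i : Fin d) :
    (b + gridPoint k t) i / ((2 * k + 1 : ℕ) : ℤ) = t i := by
  have hbi := abs_le.1 (hb i)
  have hsplit : (b + gridPoint k t) i = (b i + k) + ((2 * k + 1 : ℕ) : ℤ) * t i := by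
    rw [Pi.add_apply, gridPoint]
    push_cast
    ring
  rw [hsplit, Int.add_mul_ediv_left _ _ (by omega),
    Int.ediv_eq_zero_of_lt (by omega) (by omega), zero_add]

lemma gridPoint_injective (k : ℕ) : Function.Injective (gridPoint (d := d) k) := fun t t' h => by
  have h0 : ∀ i, |(0 : Site d) i| ≤ k := fun i => by simp
  ext i
  rw [← add_gridPoint_ediv h0 t, h, add_gridPoint_ediv h0]

lemma exists_forall_abs_le (B : Finset (Site d)) : ∃ k : ℕ, ∀ b ∈ B, ∀ i, |b i| ≤ k := by
  refine ⟨B.sup fun b => Finset.univ.sup fun i => (b i).natAbs, fun b hb i => ?_⟩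
  rw [Int.abs_eq_natAbs, Nat.cast_le]
  exact (Finset.le_sup (f := fun i => (b i).natAbs) (Finset.mem_univ i)).trans
    (Finset.le_sup (f := fun b : Site d => Finset.univ.sup fun i => (b i).natAbs) hb)

lemma exists_disjoint_translates (B : Finset (Site d)) : ∃ L : ℕ, 0 < L ∧ ∀ n : ℕ,
    ∃ A : Finset (Site d), A.card = n ^ d ∧ (∀ a ∈ A, translate a B ⊆ cube d (n * L)) ∧
      (A : Set (Site d)).PairwiseDisjoint fun a => translate a B := by
  obtain ⟨k, hk⟩ := exists_forall_abs_le B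
  have hdiv {t v : Site d} (hv : v ∈ translate (gridPoint k t) B) (i : Fin d) :
      v i / ((2 * k + 1 : ℕ) : ℤ) = t i := by
    rw [← add_gridPoint_ediv (hk _ (mem_translate.1 hv)) t i, sub_add_cancel]
  refine ⟨2 * k + 1, by omega, fun n => ⟨(cube d n).map ⟨_, gridPoint_injective k⟩, ?_, ?_, ?_⟩⟩
  · rw [Finset.card_map, card_cube]
  · simp only [Finset.forall_mem_map, Function.Embedding.coeFn_mk]
    intro t ht v hv
    refine mem_cube.2 fun i => ?_
    rw [← Int.ediv_nonneg_iff_of_pos (Nat.cast_pos.2 (Nat.succ_pos (2 * k))), Nat.cast_mul,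
      ← Int.ediv_lt_iff_lt_mul (Nat.cast_pos.2 (Nat.succ_pos (2 * k))), hdiv hv i]
    exact mem_cube.1 ht i
  · rintro _ ha _ ha' hne
    obtain ⟨t, -, rfl⟩ := Finset.mem_map.1 ha
    obtain ⟨t', -, rfl⟩ := Finset.mem_map.1 ha'
    refine Finset.disjoint_left.2 fun v hv hv' => hne (congrArg (gridPoint k) ?_)
    ext i
    rw [← hdiv hv i, hdiv hv' i]

end Cubes

section NoMagnetization

variable {d : ℕ} {J : Site d → Site d → ℝ} {β : ℝ}

lemma exists_path (hJ : Admissible J) (hβ : 0 < β) (z : Site d) : ∃ (n : ℕ) (w : ℕ → Site d),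
    w 0 = 0 ∧ w n = z ∧ ∀ i < n, 0 < pairCoupling J β (w i) (w (i + 1)) := by
  induction hJ.aperiodic z with
  | refl => exact ⟨0, fun _ => 0, rfl, rfl, fun i hi => absurd hi i.not_lt_zero⟩
  | @tail b c _ hbc ih =>
    obtain ⟨n, w, hw0, rfl, hw⟩ := ih
    by_cases hne : w n = c
    · exact ⟨n, w, hw0, hne, hw⟩
    · refine ⟨n + 1, Function.update w (n + 1) c, ?_, Function.update_self .., fun i hi => ?_⟩
      · rwa [Function.update_of_ne (Nat.succ_ne_zero n).symm]
      · rw [Function.update_of_ne hi.ne]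
        rcases (Nat.le_of_lt_succ hi).eq_or_lt with rfl | hi
        · rw [Function.update_self]
          exact pairCoupling_pos hβ hne hbc
        · rw [Function.update_of_ne (by omega)]
          exact hw i hi

lemma exists_blockConnected (hJ : Admissible J) (hβ : 0 < β) (W : Finset (Site d)) :
    ∃ B, W ⊆ B ∧ BlockConnected (pairCoupling J β) B := by
  choose n w hw0 hwn hw using exists_path hJ hβ
  let B : Finset (Site d) := W.biUnion fun z => (Finset.range (n z + 1)).image (w z)
  have hmem : ∀ z ∈ W, ∀ i ≤ n z, w z i ∈ B := fun z hz i hi => Finset.mem_biUnion.2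
    ⟨z, hz, Finset.mem_image_of_mem _ (Finset.mem_range.2 (Nat.lt_succ_of_le hi))⟩
  have hpath : ∀ z ∈ W, ∀ i ≤ n z, Relation.EqvGen
      (fun a b => a ∈ B ∧ b ∈ B ∧ 0 < pairCoupling J β a b) 0 (w z i) := by
    intro z hz i hi
    induction i with
    | zero => exact hw0 z ▸ Relation.EqvGen.refl _
    | succ i ih =>
      exact Relation.EqvGen.trans _ _ _ (ih (by omega))
        (Relation.EqvGen.rel _ _ ⟨hmem z hz i (by omega), hmem z hz _ hi, hw z i hi⟩)
  have hzero : ∀ x ∈ B, Relation.EqvGen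
      (fun a b => a ∈ B ∧ b ∈ B ∧ 0 < pairCoupling J β a b) 0 x := fun x hx => by
    obtain ⟨z, hz, hx⟩ := Finset.mem_biUnion.1 hx
    obtain ⟨i, hi, rfl⟩ := Finset.mem_image.1 hx
    exact hpath z hz i (Nat.le_of_lt_succ (Finset.mem_range.1 hi))
  refine ⟨B, fun z hz => ?_, fun x hx y hy => ((hzero x hx).symm _ _).trans _ _ _ (hzero y hy)⟩
  simpa only [hwn] using hmem z hz (n z) le_rfl

lemma exists_sum_freeCorr_lt (hLRO : modifiedLRO J β = 0) {ε : ℝ} (hε : 0 < ε) :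
    ∃ S : Finset (Site d), S.Nonempty ∧
      ∑ x ∈ S, ∑ y ∈ S, freeCorr J β x y < ε * (S.card : ℝ) ^ 2 := by
  have : Nonempty {B : Finset (Site d) // B.Nonempty} := ⟨⟨{0}, Finset.singleton_nonempty 0⟩⟩
  obtain ⟨⟨S, hS⟩, hlt⟩ := exists_lt_of_ciInf_lt ((Real.sqrt_eq_zero'.1 hLRO).trans_lt hε)
  refine ⟨S, hS, ?_⟩
  have hcard : (0 : ℝ) < (S.card : ℝ) ^ 2 := pow_pos (Nat.cast_pos.2 hS.card_pos) 2
  rwa [one_div_mul_eq_div, div_lt_iff₀ hcard] at hlt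

lemma exists_freeCorr_lt (hJ : Admissible J) (hβ : 0 ≤ β) (hLRO : modifiedLRO J β = 0) {ε : ℝ}
    (hε : 0 < ε) : ∃ z, freeCorr J β 0 z < ε := by
  by_contra! hge
  obtain ⟨S, -, hlt⟩ := exists_sum_freeCorr_lt hLRO hε
  refine hlt.not_ge ?_
  calc ε * (S.card : ℝ) ^ 2 = ∑ _x ∈ S, ∑ _y ∈ S, ε := by
        simp only [Finset.sum_const, nsmul_eq_mul]
        ring
    _ ≤ ∑ x ∈ S, ∑ y ∈ S, freeCorr J β x y := Finset.sum_le_sum fun x _ =>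
        Finset.sum_le_sum fun y _ => by
          simpa only [zero_add, sub_add_cancel] using
            (hge (y - x)).trans_eq (freeCorr_add_right hJ hβ 0 (y - x) x).symm

lemma spontaneousMagnetization_eq_zero_of_pos (hJ : Admissible J) (hβ : 0 < β)
    (hLRO : modifiedLRO J β = 0) : spontaneousMagnetization J β = 0 := by
  by_contra hne
  have hm := (spontaneousMagnetization_nonneg hJ hβ.le).lt_of_ne' hne
  obtain ⟨z, hz⟩ := exists_freeCorr_lt hJ hβ.le hLRO (pow_pos hm 2)
  obtain ⟨n, w, hw0, rfl, hw⟩ := exists_path hJ hβ z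
  have hconst := add_pos_of_nonneg_of_pos (pathConst_nonneg hw) one_pos
  set p := (spontaneousMagnetization J β ^ 2 - freeCorr J β 0 (w n)) /
    (pathConst (pairCoupling J β) w n + 1)
  have hp : 0 < p := div_pos (sub_pos.2 hz) hconst
  obtain ⟨S, hS, hlt⟩ := exists_sum_freeCorr_lt hLRO (div_pos (pow_pos hp 2) four_pos)
  obtain ⟨B, hWB, hB⟩ := exists_blockConnected hJ hβ
    (S.biUnion fun x => (Finset.range (n + 1)).image fun i => w i + x)
  have hwB : ∀ x ∈ S, ∀ i ≤ n, w i + x ∈ B := fun x hx i hi => hWB <| Finset.mem_biUnion.2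
    ⟨x, hx, Finset.mem_image.2 ⟨i, Finset.mem_range.2 (Nat.lt_succ_of_le hi), rfl⟩⟩
  have hSB : S ⊆ B := fun x hx => by simpa only [hw0, zero_add] using hwB x hx 0 n.zero_le
  obtain ⟨L, hL, htranslates⟩ := exists_disjoint_translates B
  refine (mul_pos (blockConst_pos (pairCoupling J β) B) (div_pos hp four_pos)).not_ge
    (nonpos_of_forall_pow_mul_le (β := β) hJ hL fun n => ?_)
  obtain ⟨A, hcard, hA, hdisj⟩ := htranslates n
  rw [← Nat.cast_pow, ← hcard]
  exact card_mul_le_boundaryCoupling hJ hβ.le hS hSB hB hw0 hw hwB hp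
    (div_mul_cancel₀ _ hconst.ne').le hlt.le hA hdisj

lemma spontaneousMagnetization_zero (hJ : Admissible J) : spontaneousMagnetization J 0 = 0 := by
  refine le_antisymm ?_ (spontaneousMagnetization_nonneg hJ le_rfl)
  refine (spontaneousMagnetization_le hJ le_rfl {0} 0).trans_eq ?_
  have h0 : (0 : Site d) ∈ ({0} : Finset (Site d)) := Finset.mem_singleton_self 0
  have hflip := Equiv.sum_comp (Equiv.neg (({0} : Finset (Site d)) → ℤˣ)) fun σ => spin (σ ⟨0, h0⟩)
  simp only [Equiv.neg_apply, Pi.neg_apply, spin_neg, Finset.sum_neg_distrib] at hflip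
  simp only [plusSite, glue_of_mem _ _ h0, gibbsExp, neg_zero, zero_mul, Real.exp_zero, mul_one]
  rw [self_eq_neg.1 hflip.symm, zero_div]

lemma spontaneousMagnetization_eq_zero (hJ : Admissible J) (hβ : 0 ≤ β)
    (hLRO : modifiedLRO J β = 0) : spontaneousMagnetization J β = 0 := by
  rcases hβ.eq_or_lt with rfl | hβ
  · exact spontaneousMagnetization_zero hJ
  · exact spontaneousMagnetization_eq_zero_of_pos hJ hβ hLRO

end NoMagnetization

/-! ### Existence and uniqueness of the Gibbs state -/

section Existence

instance : DiscreteMeasurableSpace ℤˣ :=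
  ⟨fun s => ⟨Units.val '' s, MeasurableSet.of_discrete,
    Set.preimage_image_eq s Units.val_injective⟩⟩

instance : BorelSpace ℤˣ :=
  ⟨le_antisymm
    (fun s _ => MeasurableSpace.measurableSet_generateFrom (isOpen_discrete s))
    fun _ _ => MeasurableSet.of_discrete⟩

variable {d : ℕ} {J : Site d → Site d → ℝ}

lemma continuous_spin_apply (x : Site d) : Continuous fun ω : Config d => spin (ω x) :=
  (continuous_of_discreteTopology (f := spin)).comp (continuous_apply x)

lemma continuous_glue (Λ : Finset (Site d)) (σ : Λ → ℤˣ) : Continuous (glue Λ σ) := by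
  refine continuous_pi fun x => ?_
  by_cases hx : x ∈ Λ
  · simp only [glue_of_mem _ _ hx, continuous_const]
  · simp only [glue_of_notMem _ _ hx, continuous_apply]

lemma continuous_hamiltonian (hJ : Admissible J) (Λ : Finset (Site d)) (σ : Λ → ℤˣ) :
    Continuous fun ω : Config d => hamiltonian J Λ (fun y => spin (ω y)) σ := by
  refine continuous_const.sub (continuous_finsetSum _ fun x _ => ?_)
  refine continuous_tsum (u := fun y : {y : Site d // y ∉ Λ} => J x y)
    (fun y => continuous_const.mul (continuous_spin_apply _))
    ((hJ.summable_right (x : Site d)).subtype fun y => y ∉ Λ) fun y ω => ?_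
  rw [Real.norm_eq_abs, abs_mul, abs_mul, abs_spin, abs_spin, mul_one, mul_one,
    abs_of_nonneg (hJ.ferro _ _)]

lemma continuous_gibbsProb (hJ : Admissible J) (β : ℝ) (Λ : Finset (Site d)) (σ : Λ → ℤˣ) :
    Continuous fun ω : Config d => gibbsProb J β Λ (fun y => spin (ω y)) σ := by
  have hweight (σ : Λ → ℤˣ) : Continuous fun ω : Config d =>
      Real.exp (-β * hamiltonian J Λ (fun y => spin (ω y)) σ) :=
    Real.continuous_exp.comp (continuous_const.mul (continuous_hamiltonian hJ Λ σ))
  exact (hweight σ).div (continuous_finsetSum _ fun σ _ => hweight σ)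
    fun ω => (partition_pos J β Λ _).ne'

lemma resample_eq_sum (J : Site d → Site d → ℝ) (β : ℝ) (Λ : Finset (Site d)) (F : Config d → ℝ)
    (ω : Config d) :
    resample J β Λ F ω = ∑ σ, F (glue Λ σ ω) * gibbsProb J β Λ (fun y => spin (ω y)) σ :=
  gibbsExp_eq_sum J β Λ _ _

lemma continuous_resample (hJ : Admissible J) (β : ℝ) (Λ : Finset (Site d)) {F : Config d → ℝ}
    (hF : Continuous F) : Continuous (resample J β Λ F) := by
  simp only [funext (resample_eq_sum J β Λ F)]
  exact continuous_finsetSum _ fun σ _ =>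
    (hF.comp (continuous_glue Λ σ)).mul (continuous_gibbsProb hJ β Λ σ)

lemma integrable_of_continuous {μ : Measure (Config d)} [IsFiniteMeasure μ] {F : Config d → ℝ}
    (hF : Continuous F) : Integrable F μ :=
  (BoundedContinuousFunction.mkOfCompact ⟨F, hF⟩).integrable μ

/-- The part of `resampleMeasure J β Λ μ` where the resampled spins are equal to `σ`. -/
noncomputable def resamplePart (J : Site d → Site d → ℝ) (β : ℝ) (Λ : Finset (Site d))
    (μ : Measure (Config d)) (σ : Λ → ℤˣ) : Measure (Config d) :=
  (μ.withDensity fun ω => ENNReal.ofReal (gibbsProb J β Λ (fun y => spin (ω y)) σ)).map (glue Λ σ)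

/-- The measure obtained from `μ` by resampling the spins in `Λ` from the finite volume Gibbs state
with the remaining spins as boundary condition. Gibbs states are its fixed points, and a point mass
`μ` gives the finite volume Gibbs state itself, as a measure on all configurations. -/
noncomputable def resampleMeasure (J : Site d → Site d → ℝ) (β : ℝ) (Λ : Finset (Site d))
    (μ : Measure (Config d)) : Measure (Config d) :=
  ∑ σ : Λ → ℤˣ, resamplePart J β Λ μ σ

lemma isFiniteMeasure_resamplePart (hJ : Admissible J) (β : ℝ) (Λ : Finset (Site d))
    (μ : Measure (Config d)) [IsFiniteMeasure μ] (σ : Λ → ℤˣ) :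
    IsFiniteMeasure (resamplePart J β Λ μ σ) := by
  have := isFiniteMeasure_withDensity_ofReal
    (integrable_of_continuous (μ := μ) (continuous_gibbsProb hJ β Λ σ)).2
  exact Measure.isFiniteMeasure_map _ _

lemma isFiniteMeasure_resampleMeasure (hJ : Admissible J) (β : ℝ) (Λ : Finset (Site d))
    (μ : Measure (Config d)) [IsFiniteMeasure μ] : IsFiniteMeasure (resampleMeasure J β Λ μ) := by
  have := isFiniteMeasure_resamplePart hJ β Λ μ
  rw [resampleMeasure]
  infer_instance

lemma integral_resamplePart (hJ : Admissible J) (β : ℝ) (Λ : Finset (Site d))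
    (μ : Measure (Config d)) (σ : Λ → ℤˣ) {F : Config d → ℝ} (hF : Measurable F) :
    ∫ ω, F ω ∂(resamplePart J β Λ μ σ)
      = ∫ ω, F (glue Λ σ ω) * gibbsProb J β Λ (fun y => spin (ω y)) σ ∂μ := by
  rw [resamplePart, integral_map (continuous_glue Λ σ).measurable.aemeasurable
      hF.aestronglyMeasurable,
    integral_withDensity_eq_integral_toReal_smul
      (continuous_gibbsProb hJ β Λ σ).measurable.ennreal_ofReal
      (Eventually.of_forall fun _ => ENNReal.ofReal_lt_top)]
  simp only [ENNReal.toReal_ofReal (gibbsProb_nonneg _ _ _ _ _), smul_eq_mul, mul_comm]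

lemma integral_resampleMeasure (hJ : Admissible J) (β : ℝ) (Λ : Finset (Site d))
    (μ : Measure (Config d)) [IsFiniteMeasure μ] {F : Config d → ℝ} (hF : Measurable F)
    (hb : ∃ C : ℝ, ∀ ω, |F ω| ≤ C) :
    ∫ ω, F ω ∂(resampleMeasure J β Λ μ) = ∫ ω, resample J β Λ F ω ∂μ := by
  obtain ⟨C, hC⟩ := hb
  have := isFiniteMeasure_resamplePart hJ β Λ μ
  have hint (σ : Λ → ℤˣ) :
      Integrable (fun ω => F (glue Λ σ ω) * gibbsProb J β Λ (fun y => spin (ω y)) σ) μ :=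
    (integrable_of_continuous (continuous_gibbsProb hJ β Λ σ)).bdd_mul
      (hF.comp (continuous_glue Λ σ).measurable).aestronglyMeasurable
      (Eventually.of_forall fun ω => hC _)
  rw [resampleMeasure, integral_finsetSum_measure fun σ _ =>
    Integrable.of_bound hF.aestronglyMeasurable C (Eventually.of_forall hC)]
  simp only [integral_resamplePart hJ β Λ μ _ hF, resample_eq_sum]
  exact (integral_finsetSum _ fun σ _ => hint σ).symm

lemma isProbabilityMeasure_resampleMeasure (hJ : Admissible J) (β : ℝ) (Λ : Finset (Site d))
    (μ : Measure (Config d)) [IsProbabilityMeasure μ] :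
    IsProbabilityMeasure (resampleMeasure J β Λ μ) := by
  have := isFiniteMeasure_resampleMeasure hJ β Λ μ
  have hone := integral_resampleMeasure hJ β Λ μ (measurable_const (a := (1 : ℝ))) ⟨1, by simp⟩
  simp only [resample, gibbsExp_const, integral_const, smul_eq_mul, mul_one,
    probReal_univ] at hone
  exact isProbabilityMeasure_iff_real.2 hone

lemma isGibbsState_of_forall_continuous (hJ : Admissible J) {β : ℝ}
    {μ : ProbabilityMeasure (Config d)}
    (h : ∀ (Λ : Finset (Site d)) (F : Config d → ℝ), Continuous F →
      ∫ ω, resample J β Λ F ω ∂(μ : Measure (Config d)) = ∫ ω, F ω ∂(μ : Measure (Config d))) :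
    IsGibbsState J β μ := by
  intro Λ F hF hb
  have := isFiniteMeasure_resampleMeasure hJ β Λ (μ : Measure (Config d))
  have heq : resampleMeasure J β Λ (μ : Measure (Config d)) = μ := by
    refine ext_of_forall_integral_eq_of_IsFiniteMeasure fun f => ?_
    rw [integral_resampleMeasure hJ β Λ _ f.continuous.measurable ⟨‖f‖, f.norm_coe_le_norm⟩,
      h Λ f f.continuous]
  exact (integral_resampleMeasure hJ β Λ (μ : Measure (Config d)) hF hb).symm.trans (by rw [heq])

lemma integral_resampleMeasure_dirac (hJ : Admissible J) (β : ℝ) (Λ : Finset (Site d))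
    (η : Config d) {F : Config d → ℝ} (hF : Continuous F) :
    ∫ ω, F ω ∂(resampleMeasure J β Λ (Measure.dirac η)) = resample J β Λ F η := by
  rw [integral_resampleMeasure hJ β Λ _ hF.measurable
    ⟨_, (BoundedContinuousFunction.mkOfCompact ⟨F, hF⟩).norm_coe_le_norm⟩, integral_dirac]

-- Any accumulation point of the finite volume Gibbs states is a Gibbs state.
theorem exists_isGibbsState (hJ : Admissible J) (β : ℝ) :
    ∃ μ : ProbabilityMeasure (Config d), IsGibbsState J β μ := by
  let m (Δ : Finset (Site d)) : ProbabilityMeasure (Config d) :=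
    ⟨resampleMeasure J β Δ (Measure.dirac 1), isProbabilityMeasure_resampleMeasure hJ β Δ _⟩
  let u : Ultrafilter (Finset (Site d)) := Ultrafilter.of atTop
  obtain ⟨μ, -, hμ : Tendsto m u (nhds μ)⟩ :=
    isCompact_univ.ultrafilter_le_nhds (u.map m) (by simp)
  have hlim {F : Config d → ℝ} (hF : Continuous F) : Tendsto (fun Δ => resample J β Δ F 1) u
      (nhds (∫ ω, F ω ∂(μ : Measure (Config d)))) := by
    simp only [← integral_resampleMeasure_dirac hJ β _ 1 hF]
    exact ProbabilityMeasure.tendsto_iff_forall_integral_tendsto.1 hμ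
      (BoundedContinuousFunction.mkOfCompact ⟨F, hF⟩)
  refine ⟨μ, isGibbsState_of_forall_continuous hJ fun Λ F hF => ?_⟩
  refine tendsto_nhds_unique (hlim (continuous_resample hJ β Λ hF)) ((hlim hF).congr' ?_)
  filter_upwards [Ultrafilter.of_le atTop (eventually_ge_atTop Λ)] with Δ hΔ
  exact (gibbsExp_resample hJ β hΔ 1 F).symm

end Existence

section StochasticDomination

lemma holley_div {α : Type*} [DistribLattice α] [Fintype α] [Nonempty α] {f w w' : α → ℝ}
    (hf : Monotone f) (hw : ∀ a, 0 < w a) (hw' : ∀ a, 0 < w' a)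
    (h : ∀ a b, w a * w' b ≤ w (a ⊓ b) * w' (a ⊔ b)) :
    (∑ a, f a * w a) / ∑ a, w a ≤ (∑ a, f a * w' a) / ∑ a, w' a := by
  obtain ⟨c, hc⟩ := (Set.finite_range f).bddBelow
  have hsum {v : α → ℝ} (hv : ∀ a, 0 < v a) : 0 < ∑ a, v a :=
    Finset.sum_pos (fun a _ => hv a) Finset.univ_nonempty
  have hshift {v : α → ℝ} (hv : ∀ a, 0 < v a) :
      ∑ a, (f a - c) * (v a / ∑ a, v a) = (∑ a, f a * v a) / (∑ a, v a) - c := by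
    simp only [← mul_div_assoc, sub_mul, ← Finset.sum_div, Finset.sum_sub_distrib,
      ← Finset.mul_sum]
    rw [sub_div, mul_div_cancel_right₀ _ (hsum hv).ne']
  have hnorm {v : α → ℝ} (hv : ∀ a, 0 < v a) : ∑ a, v a / ∑ a, v a = 1 := by
    rw [← Finset.sum_div, div_self (hsum hv).ne']
  rw [← sub_le_sub_iff_right c, ← hshift hw, ← hshift hw']
  refine holley (μ := fun a => f a - c) (f := fun a => w a / ∑ a, w a)
    (g := fun a => w' a / ∑ a, w' a) (fun a => sub_nonneg.2 (hc ⟨a, rfl⟩))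
    (fun a => (div_pos (hw a) (hsum hw)).le) (fun a => (div_pos (hw' a) (hsum hw')).le)
    (fun a b hab => sub_le_sub_right (hf hab) c) ((hnorm hw).trans (hnorm hw').symm)
    fun a b => ?_
  rw [div_mul_div_comm, div_mul_div_comm]
  exact div_le_div_of_nonneg_right (h a b) (mul_pos (hsum hw) (hsum hw')).le

lemma spin_mono : Monotone spin := fun _ _ h => Int.cast_le.2 h

lemma mul_spin_add_le_inf_sup {s t : ℝ} (hst : s ≤ t) (a b : ℤˣ) :
    s * spin a + t * spin b ≤ s * spin (a ⊓ b) + t * spin (a ⊔ b) := by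
  rcases le_total a b with hab | hab
  · rw [inf_eq_left.2 hab, sup_eq_right.2 hab]
  · rw [inf_eq_right.2 hab, sup_eq_left.2 hab]
    linarith [mul_nonneg (sub_nonneg.2 hst) (sub_nonneg.2 (spin_mono hab))]

lemma spin_mul_spin_add_le_inf_sup (a a' b b' : ℤˣ) :
    spin a * spin a' + spin b * spin b'
      ≤ spin (a ⊓ b) * spin (a' ⊓ b') + spin (a ⊔ b) * spin (a' ⊔ b') := by
  rcases le_total a b with hab | hab <;> rcases le_total a' b' with hab' | hab' <;>
    simp only [inf_eq_left.2, inf_eq_right.2, sup_eq_left.2, sup_eq_right.2, hab, hab'] <;>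
    linarith [mul_nonneg (sub_nonneg.2 (spin_mono hab)) (sub_nonneg.2 (spin_mono hab'))]

variable {V : Type*} [Fintype V] {K : V → V → ℝ} {h h' : V → ℝ}

lemma boltzmann_mul_le_inf_sup (hK : ∀ x y, 0 ≤ K x y) (hh : ∀ x, h x ≤ h' x) (a b : V → ℤˣ) :
    boltzmann bondChar (bondCoupling K h) a * boltzmann bondChar (bondCoupling K h') b
      ≤ boltzmann bondChar (bondCoupling K h) (a ⊓ b)
        * boltzmann bondChar (bondCoupling K h') (a ⊔ b) := by
  simp only [boltzmann, ← Real.exp_add, ← Finset.sum_add_distrib]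
  refine Real.exp_le_exp.2 (Finset.sum_le_sum fun i _ => ?_)
  rcases i with ⟨x, y⟩ | x
  · simp only [bondCoupling_inl, bondChar_inl_apply, spin_mul, Pi.inf_apply, Pi.sup_apply,
      ← mul_add]
    exact mul_le_mul_of_nonneg_left (spin_mul_spin_add_le_inf_sup _ _ _ _) (hK x y)
  · simp only [bondCoupling_inr, bondChar_inr_apply, Pi.inf_apply, Pi.sup_apply]
    exact mul_spin_add_le_inf_sup (hh x) _ _

lemma isingExpect_le_of_monotone [DecidableEq V] (hK : ∀ x y, 0 ≤ K x y) (hh : ∀ x, h x ≤ h' x)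
    {f : (V → ℤˣ) → ℝ} (hf : Monotone f) :
    isingExpect K h f ≤ isingExpect K h' f :=
  holley_div hf (boltzmann_pos _ _) (boltzmann_pos _ _) (boltzmann_mul_le_inf_sup hK hh)

lemma gibbsExp_le_of_monotone {d : ℕ} {J : Site d → Site d → ℝ} (hJ : Admissible J) {β : ℝ}
    (hβ : 0 ≤ β) (Λ : Finset (Site d)) {τ : Site d → ℝ} (hτ : ∀ y, |τ y| ≤ 1)
    {f : (Λ → ℤˣ) → ℝ} (hf : Monotone f) :
    gibbsExp J β Λ τ f ≤ gibbsExp J β Λ (fun _ => 1) f := by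
  rw [gibbsExp_eq_isingExpect, gibbsExp_eq_isingExpect]
  exact isingExpect_le_of_monotone (volumePair_nonneg hJ hβ Λ)
    (fun x => (le_abs_self _).trans (abs_volumeField_le hJ hβ Λ hτ x)) hf

end StochasticDomination

section Uniqueness

variable {d : ℕ} {J : Site d → Site d → ℝ} {β : ℝ}

/-- The indicator function of the event that all spins in `A` are `1`, as a product over the
sites. -/
noncomputable def plusIndicator (A : Finset (Site d)) (ω : Config d) : ℝ :=
  ∏ x ∈ A, (1 + spin (ω x)) / 2

lemma neg_one_le_spin (a : ℤˣ) : -1 ≤ spin a := neg_le_of_abs_le (abs_spin a).le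

lemma plusIndicator_mono (A : Finset (Site d)) : Monotone (plusIndicator A) := fun ω ω' h =>
  Finset.prod_le_prod (fun x _ => by linarith [neg_one_le_spin (ω x)])
    fun x _ => by linarith [spin_mono (h x)]

lemma prod_sub_prod_le_sum_sub {ι : Type*} (s : Finset ι) {a b : ι → ℝ} (ha : ∀ i, 0 ≤ a i)
    (hab : ∀ i, a i ≤ b i) (hb : ∀ i, b i ≤ 1) :
    ∏ i ∈ s, b i - ∏ i ∈ s, a i ≤ ∑ i ∈ s, (b i - a i) := by
  classical
  induction s using Finset.induction_on with
  | empty => simp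
  | insert i s hi ih =>
    rw [Finset.prod_insert hi, Finset.prod_insert hi, Finset.sum_insert hi]
    have hle : ∏ i ∈ s, a i ≤ ∏ i ∈ s, b i := Finset.prod_le_prod (fun i _ => ha i) fun i _ => hab i
    have hle_one : ∏ i ∈ s, a i ≤ 1 :=
      Finset.prod_le_one (fun i _ => ha i) fun i _ => (hab i).trans (hb i)
    calc b i * ∏ i ∈ s, b i - a i * ∏ i ∈ s, a i
        = b i * (∏ i ∈ s, b i - ∏ i ∈ s, a i) + (b i - a i) * ∏ i ∈ s, a i := by ring
      _ ≤ 1 * (∏ i ∈ s, b i - ∏ i ∈ s, a i) + (b i - a i) * 1 :=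
        add_le_add (mul_le_mul_of_nonneg_right (hb i) (sub_nonneg.2 hle))
          (mul_le_mul_of_nonneg_left hle_one (sub_nonneg.2 (hab i)))
      _ ≤ b i - a i + ∑ i ∈ s, (b i - a i) := by linarith

lemma half_sum_spin_sub_plusIndicator_mono (A : Finset (Site d)) :
    Monotone fun ω : Config d => ∑ x ∈ A, 1 / 2 * spin (ω x) - plusIndicator A ω := by
  intro ω ω' h
  have hprod : plusIndicator A ω' - plusIndicator A ω
      ≤ ∑ x ∈ A, ((1 + spin (ω' x)) / 2 - (1 + spin (ω x)) / 2) :=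
    prod_sub_prod_le_sum_sub A (fun x => by linarith [neg_one_le_spin (ω x)])
      (fun x => by linarith [spin_mono (h x)]) fun x => by linarith [spin_le_one (ω' x)]
  have hsum : ∑ x ∈ A, ((1 + spin (ω' x)) / 2 - (1 + spin (ω x)) / 2)
      = ∑ x ∈ A, 1 / 2 * spin (ω' x) - ∑ x ∈ A, 1 / 2 * spin (ω x) := by
    rw [← Finset.sum_sub_distrib]
    exact Finset.sum_congr rfl fun x _ => by ring
  simp only
  linarith

lemma glue_mono (Λ : Finset (Site d)) (ω : Config d) : Monotone fun σ => glue Λ σ ω := by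
  intro σ σ' h x
  by_cases hx : x ∈ Λ
  · simpa [hx] using h ⟨x, hx⟩
  · simp [hx]

lemma neg_plusSite_le_gibbsExp_site (hJ : Admissible J) (hβ : 0 ≤ β) {Λ : Finset (Site d)}
    {τ : Site d → ℝ} (hτ : ∀ y, |τ y| ≤ 1) (x : Λ) :
    -plusSite J β Λ x ≤ gibbsExp J β Λ τ fun σ => spin (σ x) := by
  have hflip := gibbsExp_comp_neg J β Λ τ fun σ => -1 * spin (σ x)
  have hle := gibbsExp_site_le_plusSite hJ hβ (τ := fun y => -τ y) (by simpa only [abs_neg]) x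
  simp only [Pi.neg_apply, spin_neg, neg_mul_neg, one_mul] at hflip
  rw [hflip, gibbsExp_const_mul] at hle
  linarith

-- Both the indicator and `(∑ x ∈ A, spin x) / 2` minus the indicator are increasing, so the
-- indicator responds to the boundary condition at most as much as the half sum of spins.
lemma abs_gibbsExp_plusIndicator_sub_le (hJ : Admissible J) (hβ : 0 ≤ β) {A Λ : Finset (Site d)}
    (hA : A ⊆ Λ) {τ : Site d → ℝ} (hτ : ∀ y, |τ y| ≤ 1) :
    |gibbsExp J β Λ τ (fun σ => plusIndicator A (glue Λ σ 1))
        - gibbsExp J β Λ (fun _ => 1) fun σ => plusIndicator A (glue Λ σ 1)|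
      ≤ ∑ x ∈ A, plusSite J β Λ x := by
  have hmono := gibbsExp_le_of_monotone hJ hβ Λ hτ ((plusIndicator_mono A).comp (glue_mono Λ 1))
  have hcomp := gibbsExp_le_of_monotone hJ hβ Λ hτ
    ((half_sum_spin_sub_plusIndicator_mono A).comp (glue_mono Λ 1))
  simp only [Function.comp_def] at hmono hcomp
  simp only [gibbsExp_sub, gibbsExp_sum, gibbsExp_const_mul] at hcomp
  have hsite : ∑ x ∈ A, 1 / 2 * gibbsExp J β Λ (fun _ => 1) (fun σ => spin (glue Λ σ 1 x))
      ≤ ∑ x ∈ A, 1 / 2 * gibbsExp J β Λ τ (fun σ => spin (glue Λ σ 1 x))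
        + ∑ x ∈ A, plusSite J β Λ x := by
    rw [← Finset.sum_add_distrib]
    refine Finset.sum_le_sum fun x hx => ?_
    have hneg := neg_plusSite_le_gibbsExp_site hJ hβ hτ ⟨x, hA hx⟩
    rw [← plusSite]
    simp only [glue_of_mem _ _ (hA hx)]
    linarith
  rw [abs_sub_comm, abs_of_nonneg (sub_nonneg.2 hmono)]
  linarith

lemma resample_plusIndicator (J : Site d → Site d → ℝ) (β : ℝ) {A Λ : Finset (Site d)}
    (hA : A ⊆ Λ) (ω : Config d) : resample J β Λ (plusIndicator A) ω
      = gibbsExp J β Λ (fun y => spin (ω y)) fun σ => plusIndicator A (glue Λ σ 1) := by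
  have hglue (σ : Λ → ℤˣ) : plusIndicator A (glue Λ σ ω) = plusIndicator A (glue Λ σ 1) :=
    Finset.prod_congr rfl fun x hx => by rw [glue_of_mem _ _ (hA hx), glue_of_mem _ _ (hA hx)]
  simp only [resample, hglue]

/-- The event that all spins in `A` are `1`. These events determine a probability measure. -/
def plusEvent (A : Finset (Site d)) : Set (Config d) := {ω | ∀ x ∈ A, ω x = 1}

@[simp] lemma mem_plusEvent {A : Finset (Site d)} {ω : Config d} :
    ω ∈ plusEvent A ↔ ∀ x ∈ A, ω x = 1 := Iff.rfl

lemma plusIndicator_eq_indicator (A : Finset (Site d)) :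
    plusIndicator A = (plusEvent A).indicator 1 := by
  ext ω
  by_cases h : ω ∈ plusEvent A
  · rw [Set.indicator_of_mem h]
    exact Finset.prod_eq_one fun x hx => by norm_num [mem_plusEvent.1 h x hx]
  · rw [Set.indicator_of_notMem h]
    simp only [mem_plusEvent, not_forall] at h
    obtain ⟨x, hx, hωx⟩ := h
    refine Finset.prod_eq_zero hx ?_
    simp [(Int.units_eq_one_or _).resolve_left hωx]

lemma continuous_plusIndicator (A : Finset (Site d)) : Continuous (plusIndicator A) :=
  continuous_finsetProd _ fun x _ => (continuous_const.add (continuous_spin_apply x)).div_const 2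

lemma abs_plusIndicator_le (A : Finset (Site d)) (ω : Config d) : |plusIndicator A ω| ≤ 1 := by
  classical
  rw [plusIndicator_eq_indicator, Set.indicator_apply]
  split_ifs <;> simp

lemma measurableSet_plusEvent (A : Finset (Site d)) : MeasurableSet (plusEvent A) :=
  measurableSet_setOfPred.2 <| Measurable.forall fun x => Measurable.imp measurable_const <|
    measurableSet_setOfPred.1 <| measurable_pi_apply x (MeasurableSet.of_discrete (s := {1}))

lemma isPiSystem_range_plusEvent :
    IsPiSystem (Set.range (plusEvent : Finset (Site d) → Set (Config d))) := by
  classical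
  rintro _ ⟨A, rfl⟩ _ ⟨A', rfl⟩ -
  refine ⟨A ∪ A', ?_⟩
  ext ω
  simp only [mem_plusEvent, Set.mem_inter_iff, Finset.forall_mem_union]

lemma generateFrom_range_plusEvent :
    MeasurableSpace.generateFrom (Set.range (plusEvent : Finset (Site d) → Set (Config d)))
      = MeasurableSpace.pi := by
  refine le_antisymm (MeasurableSpace.generateFrom_le ?_) (iSup_le fun x => ?_)
  · rintro _ ⟨A, rfl⟩
    exact measurableSet_plusEvent A
  · rw [← measurable_iff_comap_le]
    refine @measurable_to_countable' ℤˣ (Config d) _ _ (MeasurableSpace.generateFrom _)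
      (fun ω => ω x) fun a => ?_
    have hplus : MeasurableSet[MeasurableSpace.generateFrom (Set.range plusEvent)]
        ((fun ω : Config d => ω x) ⁻¹' {1}) :=
      MeasurableSpace.measurableSet_generateFrom ⟨{x}, by ext ω; simp⟩
    rcases Int.units_eq_one_or a with rfl | rfl
    · exact hplus
    · convert hplus.compl using 1
      ext ω
      rcases Int.units_eq_one_or (ω x) with h | h <;> simp [h]

lemma probabilityMeasure_ext_plusIndicator {μ ν : ProbabilityMeasure (Config d)}
    (h : ∀ A : Finset (Site d), ∫ ω, plusIndicator A ω ∂(μ : Measure (Config d))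
      = ∫ ω, plusIndicator A ω ∂(ν : Measure (Config d))) : μ = ν := by
  refine Subtype.ext (ext_of_generate_finite (μ := (μ : Measure (Config d))) _
    generateFrom_range_plusEvent.symm isPiSystem_range_plusEvent ?_ (by simp))
  rintro _ ⟨A, rfl⟩
  have hA := h A
  rw [plusIndicator_eq_indicator, integral_indicator_one (measurableSet_plusEvent A),
    integral_indicator_one (measurableSet_plusEvent A)] at hA
  exact (measureReal_eq_measureReal_iff (measure_ne_top _ _)
    (measure_ne_top (ν : Measure (Config d)) _)).1 hA

lemma abs_integral_plusIndicator_sub_le (hJ : Admissible J) (hβ : 0 ≤ β)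
    {μ : ProbabilityMeasure (Config d)} (hμ : IsGibbsState J β μ) {A Λ : Finset (Site d)}
    (hA : A ⊆ Λ) :
    |∫ ω, plusIndicator A ω ∂(μ : Measure (Config d))
        - gibbsExp J β Λ (fun _ => 1) fun σ => plusIndicator A (glue Λ σ 1)|
      ≤ ∑ x ∈ A, plusSite J β Λ x := by
  set c := gibbsExp J β Λ (fun _ => 1) fun σ => plusIndicator A (glue Λ σ 1)
  have hDLR : ∫ ω, resample J β Λ (plusIndicator A) ω ∂(μ : Measure (Config d))
      = ∫ ω, plusIndicator A ω ∂(μ : Measure (Config d)) :=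
    hμ Λ _ (continuous_plusIndicator A).measurable ⟨1, abs_plusIndicator_le A⟩
  have hbound (ω : Config d) : ‖resample J β Λ (plusIndicator A) ω - c‖
      ≤ ∑ x ∈ A, plusSite J β Λ x := by
    rw [resample_plusIndicator J β hA]
    exact abs_gibbsExp_plusIndicator_sub_le hJ hβ hA fun y => (abs_spin _).le
  have hint : Integrable (resample J β Λ (plusIndicator A)) (μ : Measure (Config d)) :=
    integrable_of_continuous (continuous_resample hJ β Λ (continuous_plusIndicator A))
  simpa [integral_sub hint (integrable_const c), hDLR] using
    norm_integral_le_of_norm_le_const (μ := (μ : Measure (Config d)))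
      (Eventually.of_forall hbound)

theorem isGibbsState_unique (hJ : Admissible J) (hβ : 0 ≤ β)
    (hm : spontaneousMagnetization J β = 0) {μ ν : ProbabilityMeasure (Config d)}
    (hμ : IsGibbsState J β μ) (hν : IsGibbsState J β ν) : μ = ν := by
  refine probabilityMeasure_ext_plusIndicator fun A => ?_
  have hlim : Tendsto (fun Λ => ∑ x ∈ A, plusSite J β Λ x) atTop (nhds 0) := by
    simpa [hm] using tendsto_finsetSum A fun x _ => tendsto_plusSite hJ hβ x
  have hconv {μ : ProbabilityMeasure (Config d)} (hμ : IsGibbsState J β μ) :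
      Tendsto (fun Λ => gibbsExp J β Λ (fun _ => 1) fun σ => plusIndicator A (glue Λ σ 1)) atTop
        (nhds (∫ ω, plusIndicator A ω ∂(μ : Measure (Config d)))) := by
    refine tendsto_iff_norm_sub_tendsto_zero.2 (squeeze_zero' (.of_forall fun _ => norm_nonneg _)
      ?_ hlim)
    filter_upwards [eventually_ge_atTop A] with Λ hΛ
    rw [norm_sub_rev]
    exact abs_integral_plusIndicator_sub_le hJ hβ hμ hΛ
  exact tendsto_nhds_unique (hconv hμ) (hconv hν)

end Uniqueness

end IsingZd

theorem theorem1_general {d : ℕ} {J : IsingZd.Site d → IsingZd.Site d → ℝ}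
    (hJ : IsingZd.Admissible J) {β : ℝ} (hβ : 0 ≤ β) (hLRO : IsingZd.modifiedLRO J β = 0) :
    IsingZd.spontaneousMagnetization J β = 0 ∧
      ∃! μ : MeasureTheory.ProbabilityMeasure (IsingZd.Config d), IsingZd.IsGibbsState J β μ := by
  have hm := IsingZd.spontaneousMagnetization_eq_zero hJ hβ hLRO
  obtain ⟨μ, hμ⟩ := IsingZd.exists_isGibbsState hJ β
  exact ⟨hm, μ, hμ, fun ν hν => IsingZd.isGibbsState_unique hJ hβ hm hν hμ⟩

theorem theorem1 {d : ℕ} (J : IsingZd.Site d → IsingZd.Site d → ℝ) (hJ : IsingZd.Admissible J)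
    (βc : ℝ) (hβc : IsingZd.IsCriticalBeta J βc) (hLRO : IsingZd.modifiedLRO J βc = 0) :
    IsingZd.spontaneousMagnetization J βc = 0 ∧
      ∃! μ : MeasureTheory.ProbabilityMeasure (IsingZd.Config d), IsingZd.IsGibbsState J βc μ :=
  theorem1_general hJ (hβc.2 fun _ hβ => hβ.1.le) hLRO
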